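/- **Setting.** Let $G$ be a finite directed plane graph with disjoint sets $S=\{s_1,s_2\}$ of two sources and $T=\{t_1\}$ of one sink (so $k=3$ terminals). Every arc $e$ has a reversal $\mathrm{rev}(e)$, drawn along the same edge, whose capacity may be $0$. Arcs have capacities $c(e)\in[0,\infty]$, with $c(e)>0$ or $c(\mathrm{rev}(e))>0$ for every $e$; vertices have capacities $c(v)\in(0,\infty]$, terminals have capacity $\infty$; no arc of positive capacity enters a source or leaves a sink. The *extended graph* $G^\circ$ is obtained as follows. Add to $G$ a supersource $s$, a supersink $t$, and arcs $(s,s_1),(s,s_2),(t_1,t)$ of infinite capacity (with reversals of capacity $0$). Then replace every vertex $v$ of finite capacity by an undirected cycle $C_v$ with one vertex for each edge at $v$, in the clockwise order of these edges around $v$; each edge at $v$ is attached to its own vertex of $C_v$, and both directions of every edge of $C_v$ have capacity $c(v)/2$. Let $f^\circ$ be a maximum $s$–$t$ flow in $G^\circ$ whose restriction $f$ to $G$ is acyclic (there is no directed cycle on which $f$ is positive), and let $x$ be a vertex with positive excess $\mathrm{ex}(f,x)=\max\{0,f^{in}(x)-c(x)\}$. The *auxiliary network* $H$ is obtained from the residual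 graph of $G^\circ$ with respect to $f^\circ$ (residual capacities $c(e)-f^\circ(e)+f^\circ(\mathrm{rev}(e))$) as follows. Remove $C_x$. For every arc $(u,x)$ of $G$ with $f(u,x)>0$ put an arc $(x^{in},u)$ of capacity $f(u,x)$, and for every arc $(x,u)$ of $G$ with $f(x,u)>0$ put an arc $(u,x^{out})$ of capacity $f(x,u)$ (here $u$ stands for the vertex of $G^\circ$ to which the edge is attached at its other end). Split $x^{in}$ into one source for each maximal interval, in the cyclic order around $x$ and ignoring edges without flow, of edges carrying flow into $x$; split $x^{out}$ in the same way into sinks, one for each interval of edges carrying flow out of $x$. An *augmenting path* in $H$ is a directed path along arcs of positive capacity from a source to a sink of $H$. Let $H^-$ be $H$ with the arcs $(s,s_1),(s,s_2)$ and their reversals deleted. **Statement.** 1. If there is an augmenting path in $H$ that contains $s$, then there is an augmenting path in $H$ that does not contain $s$. 2. Consequently the arcs $(s,s_1)$ and $(s,s_2)$ can be deleted: $H$ has an augmenting path if and only if $H^-$ has one; and for every real $r$ with $0\le r\le \mathrm{ex}(f,x)$, $H$ has a feasible flow of value $r$ from its sources to its sinks if and only if $H^-$ has one. 3. $H^-$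 is planar. -/

import Mathlib

open scoped NNReal ENNReal

/-! ### Flow networks -/

/-- A finite directed multigraph with arc capacities in `[0, ∞]`, a set of sources and a set of
sinks. Arcs of capacity `0` are allowed: they can carry no flow. -/
structure FlowNetwork (V E : Type*) where
  tail : E → V
  head : E → V
  cap : E → ℝ≥0∞
  source : Set V
  sink : Set V

namespace FlowNetwork

variable {V E : Type*} (N : FlowNetwork V E)

/-- Total flow into `v`. (All the arc types used below are finite, so this is a finite sum.) -/
noncomputable def inflow (f : E → ℝ≥0) (v : V) : ℝ≥0 :=
  ∑ᶠ e ∈ {e | N.head e = v}, f e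

/-- Total flow out of `v`. -/
noncomputable def outflow (f : E → ℝ≥0) (v : V) : ℝ≥0 :=
  ∑ᶠ e ∈ {e | N.tail e = v}, f e

/-- The value of a flow: the total flow on arcs leaving the sources. -/
noncomputable def value (f : E → ℝ≥0) : ℝ≥0 :=
  ∑ᶠ e ∈ {e | N.tail e ∈ N.source}, f e

/-- Flow conservation off the terminals, together with the arc capacity constraints. -/
structure IsFeasibleFlow (f : E → ℝ≥0) : Prop where
  conservation : ∀ v, v ∉ N.source → v ∉ N.sink → N.inflow f v = N.outflow f v
  le_cap : ∀ e, (f e : ℝ≥0∞) ≤ N.cap e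

/-- A feasible flow of maximum value. -/
def IsMaxFlow (f : E → ℝ≥0) : Prop :=
  N.IsFeasibleFlow f ∧ ∀ g, N.IsFeasibleFlow g → N.value g ≤ N.value f

/-- No directed closed walk all of whose arcs carry flow. -/
def IsAcyclicFlow (f : E → ℝ≥0) : Prop :=
  ∀ v, ¬ Relation.TransGen (fun u w => ∃ e, N.tail e = u ∧ N.head e = w ∧ 0 < f e) v v

/-- An augmenting path: a nonempty sequence of consecutive arcs of positive capacity that starts
at a source and ends at a sink. -/
structure IsAugmentingPath (p : List E) : Prop where
  consecutive : p.IsChain (fun e e' => N.head e = N.tail e')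
  positive : ∀ e ∈ p, 0 < N.cap e
  start : ∃ e, p.head? = some e ∧ N.tail e ∈ N.source
  finish : ∃ e, p.getLast? = some e ∧ N.head e ∈ N.sink

/-- The path `p` contains the vertex `v` if `v` is an endpoint of one of its arcs. -/
def PathContains (p : List E) (v : V) : Prop :=
  ∃ e ∈ p, N.tail e = v ∨ N.head e = v

/-- The network obtained by deleting the arcs in `P`. -/
def deleteArcs (P : Set E) : FlowNetwork V {e : E // e ∉ P} where
  tail e := N.tail e.1
  head e := N.head e.1
  cap e := N.cap e.1
  source := N.source
  sink := N.sink

/-- The underlying undirected simple graph, in which all the arcs count, whatever their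
capacity. -/
def underlyingGraph : SimpleGraph V :=
  SimpleGraph.fromRel (fun u v => ∃ e, N.tail e = u ∧ N.head e = v)

end FlowNetwork

/-! ### Plane graphs as rotation systems -/

/-- Every dart `d` is a directed half of an edge, `rev d` is the other half, and `rot d` is the
next dart in clockwise order around the initial vertex of `d`. The orbits of `rot`, `rev`,
`rot * rev` and `⟨rot, rev⟩` are the vertices, the edges, the faces and the connected components,
and Euler's formula `V + F = E + 2 C` says that every component is embedded in the sphere. -/
def IsPlaneRotation {D : Type*} (rot rev : Equiv.Perm D) : Prop :=
  Nat.card (Quotient (Equiv.Perm.SameCycle.setoid rot)) +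
      Nat.card (Quotient (Equiv.Perm.SameCycle.setoid (rot * rev))) =
    Nat.card (Quotient (Equiv.Perm.SameCycle.setoid rev)) +
      2 * Nat.card (MulAction.orbitRel.Quotient (Subgroup.closure {rot, rev}) D)

/-- A finite simple graph is planar if its darts have a plane rotation system. -/
def SimpleGraph.IsPlanar {V : Type*} (Γ : SimpleGraph V) : Prop :=
  Finite Γ.Dart ∧ ∃ rot : Equiv.Perm Γ.Dart,
    (∀ d d' : Γ.Dart, d.fst = d'.fst ↔ rot.SameCycle d d') ∧
    IsPlaneRotation rot (SimpleGraph.Dart.symm_involutive (G := Γ)).toPerm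

/-- A directed plane graph with arc and vertex capacities, sources `S` and sinks `T`.
The dart `d` is the arc from `src d` to `src (rev d)`, `rev d` is its reversal, and the reversal
of an arc may have capacity `0`. -/
structure PlaneNetwork (V D : Type*) where
  src : D → V
  rev : Equiv.Perm D
  /-- the next dart, clockwise, around the vertex `src d` -/
  rot : Equiv.Perm D
  cap : D → ℝ≥0∞
  vcap : V → ℝ≥0∞
  S : Finset V
  T : Finset V
  rev_rev : ∀ d, rev (rev d) = d
  rev_ne : ∀ d, rev d ≠ d
  src_eq_iff : ∀ d d', src d = src d' ↔ rot.SameCycle d d'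
  plane : IsPlaneRotation rot rev
  cap_pos : ∀ d, 0 < cap d ∨ 0 < cap (rev d)
  vcap_pos : ∀ v, 0 < vcap v
  vcap_terminal : ∀ v, v ∈ S ∨ v ∈ T → vcap v = ⊤
  disjoint : Disjoint S T
  /-- no arc enters a source -/
  cap_into_source : ∀ d, src (rev d) ∈ S → cap d = 0
  /-- no arc leaves a sink -/
  cap_out_of_sink : ∀ d, src d ∈ T → cap d = 0

namespace PlaneNetwork

variable {V D : Type*} (G : PlaneNetwork V D)

theorem src_rot (d : D) : G.src (G.rot d) = G.src d :=
  (G.src_eq_iff _ _).2 ⟨-1, by simp⟩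

/-- `G` as a flow network (this forgets the vertex capacities and the embedding). -/
def toFlowNetwork : FlowNetwork V D where
  tail d := G.src d
  head d := G.src (G.rev d)
  cap := G.cap
  source := {v | v ∈ G.S}
  sink := {v | v ∈ G.T}

/-- The excess of `v` under `f`, that is `max {0, f^in(v) - c(v)}`. -/
noncomputable def excess (f : D → ℝ≥0) (v : V) : ℝ≥0∞ :=
  (G.toFlowNetwork.inflow f v : ℝ≥0∞) - G.vcap v

/-! ### The extended graph `G°` -/

/-- The vertices of `G°`: supersource `s`, supersink `t`, the vertices of `G` of infinite
capacity, and, for every vertex `v` of finite capacity, the vertices of the cycle `C_v`, one for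
each dart at `v` (that is, for each edge at `v`). -/
inductive ExtVertex where
  | s
  | t
  | plain (v : {v : V // G.vcap v = ⊤})
  | cyc (d : {d : D // G.vcap (G.src d) ≠ ⊤})

/-- The arcs of `G°`: the darts of `G`; the two directions of the edge of `C_v` that joins the
vertex of `d` to that of `rot d` (clockwise if the flag is `true`); the arcs `(s, s_i)` and
`(t_i, t)` (flag `true`) and their reversals (flag `false`). -/
inductive ExtArc where
  | old (d : D)
  | cyc (d : {d : D // G.vcap (G.src d) ≠ ⊤}) (clockwise : Bool)
  | super (v : {v : V // v ∈ G.S}) (forward : Bool)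
  | toSink (v : {v : V // v ∈ G.T}) (forward : Bool)

/-- The vertex of `G°` to which the initial end of the dart `d` is attached. -/
noncomputable def attach (d : D) : G.ExtVertex :=
  open Classical in
  if h : G.vcap (G.src d) = ⊤ then .plain ⟨G.src d, h⟩ else .cyc ⟨d, h⟩

/-- The successor on its cycle of a cycle vertex. -/
def nextOnCycle (d : {d : D // G.vcap (G.src d) ≠ ⊤}) : G.ExtVertex :=
  .cyc ⟨G.rot d.1, by rw [G.src_rot]; exact d.2⟩

/-- The initial vertex of an arc of `G°`. -/
noncomputable def extTail : G.ExtArc → G.ExtVertex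
  | .old d => G.attach d
  | .cyc d true => .cyc d
  | .cyc d false => G.nextOnCycle d
  | .super _ true => .s
  | .super v false => .plain ⟨v.1, G.vcap_terminal _ (Or.inl v.2)⟩
  | .toSink v true => .plain ⟨v.1, G.vcap_terminal _ (Or.inr v.2)⟩
  | .toSink _ false => .t

/-- The reversal of an arc of `G°`. -/
def extRev : G.ExtArc → G.ExtArc
  | .old d => .old (G.rev d)
  | .cyc d b => .cyc d (!b)
  | .super v b => .super v (!b)
  | .toSink v b => .toSink v (!b)

/-- The capacities of `G°`: unchanged on the arcs of `G`, `c(v) / 2` on both directions of the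
edges of `C_v`, and `∞` on the arcs `(s, s_i)` and `(t_i, t)`. -/
noncomputable def extCap : G.ExtArc → ℝ≥0∞
  | .old d => G.cap d
  | .cyc d _ => G.vcap (G.src d.1) / 2
  | .super _ b => if b then ⊤ else 0
  | .toSink _ b => if b then ⊤ else 0

/-- The extended graph `G°`, with source `s` and sink `t`. -/
noncomputable def extended : FlowNetwork G.ExtVertex G.ExtArc where
  tail := G.extTail
  head e := G.extTail (G.extRev e)
  cap := G.extCap
  source := {.s}
  sink := {.t}

/-- The residual capacity `c(e) - F(e) + F(rev e)` of an arc of `G°`. -/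
noncomputable def residualCap (F : G.ExtArc → ℝ≥0) (e : G.ExtArc) : ℝ≥0∞ :=
  G.extCap e - F e + F (G.extRev e)

/-- The restriction to `G` of a flow in `G°`. -/
def restrict (F : G.ExtArc → ℝ≥0) (d : D) : ℝ≥0 := F (.old d)

/-- The vertices of the cycle `C_x`. -/
def cycleAt (x : V) : Set G.ExtVertex :=
  {p | ∃ d, p = .cyc d ∧ G.src d.1 = x}

theorem attach_notMem_cycleAt {x : V} {d : D} (h : G.src d ≠ x) : G.attach d ∉ G.cycleAt x := by
  rintro ⟨d', hd', hx⟩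
  unfold attach at hd'
  split_ifs at hd' with h1
  injection hd' with h2
  subst h2
  exact h hx

/-! ### The auxiliary network `H` -/

/-- The darts `(x, u)` at `x` such that the arc `(u, x)` carries flow into `x`.
(No loop carries flow if the flow is acyclic, so that `u ≠ x` is no restriction.) -/
def InDart (f : D → ℝ≥0) (x : V) : Type _ :=
  {d : D // G.src d = x ∧ G.src (G.rev d) ≠ x ∧ 0 < f (G.rev d)}

/-- The darts `(x, u)` at `x` that carry flow out of `x`. -/
def OutDart (f : D → ℝ≥0) (x : V) : Type _ :=
  {d : D // G.src d = x ∧ G.src (G.rev d) ≠ x ∧ 0 < f d}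

/-- The vertices into which `x^in` is split: one for each interval, in the cyclic order around
`x`, of edges that carry flow into `x`. Two such edges are in the same interval if one meets no
edge carrying flow out of `x` when turning clockwise from the one to the other. -/
def InTerminal (f : D → ℝ≥0) (x : V) : Type _ :=
  Quot (fun a b : G.InDart f x =>
    ∃ n : ℕ, (G.rot ^ n) a.1 = b.1 ∧ ∀ i ≤ n, f ((G.rot ^ i) a.1) = 0)

/-- The vertices into which `x^out` is split: one for each interval, in the cyclic order around
`x`, of edges that carry flow out of `x`. -/
def OutTerminal (f : D → ℝ≥0) (x : V) : Type _ :=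
  Quot (fun a b : G.OutDart f x =>
    ∃ n : ℕ, (G.rot ^ n) a.1 = b.1 ∧ ∀ i ≤ n, f (G.rev ((G.rot ^ i) a.1)) = 0)

/-- The vertices of `H`: those of `G°` outside `C_x`, the sources and the sinks. -/
inductive AuxVertex (f : D → ℝ≥0) (x : V) where
  | ext (p : {p : G.ExtVertex // p ∉ G.cycleAt x})
  | xin (a : G.InTerminal f x)
  | xout (b : G.OutTerminal f x)

/-- The supersource `s` as a vertex of `H`. -/
def auxS (f : D → ℝ≥0) (x : V) : G.AuxVertex f x :=
  .ext ⟨.s, by rintro ⟨d, hd, -⟩; cases hd⟩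

/-- The arcs of `H`:
* `ext e`: an arc `e` of `G°` with both ends outside `C_x`;
* `fromIn d`: the residual arc `(x^in, u)` that is the reversal of an arc `(u, x)` carrying flow;
* `toOut d`: the residual arc `(u, x^out)` that is the reversal of an arc `(x, u)` carrying flow.

The arcs into `x^in` and out of `x^out`, and the arcs `(x^in, u)` and `(u, x^out)` of residual
capacity `0`, are left out. -/
inductive AuxArc (f : D → ℝ≥0) (x : V) where
  | ext (e : {e : G.ExtArc // G.extended.tail e ∉ G.cycleAt x ∧ G.extended.head e ∉ G.cycleAt x})
  | fromIn (d : G.InDart f x)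
  | toOut (d : G.OutDart f x)

/-- The auxiliary network `H` that is built from `G°`, the flow `F` in `G°` and the vertex `x`:
in the residual graph of `G°` with respect to `F`, the cycle `C_x` is replaced by the sources
`x^in` and the sinks `x^out`. Every arc has its residual capacity; for `(x^in, u)` and
`(u, x^out)` this is the flow on the arc `(u, x)`, resp. `(x, u)`, of `G`. -/
noncomputable def aux (F : G.ExtArc → ℝ≥0) (x : V) :
    FlowNetwork (G.AuxVertex (G.restrict F) x) (G.AuxArc (G.restrict F) x) where
  tail
    | .ext e => .ext ⟨G.extended.tail e.1, e.2.1⟩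
    | .fromIn d => .xin (Quot.mk _ d)
    | .toOut d => .ext ⟨G.attach (G.rev d.1), G.attach_notMem_cycleAt d.2.2.1⟩
  head
    | .ext e => .ext ⟨G.extended.head e.1, e.2.2⟩
    | .fromIn d => .ext ⟨G.attach (G.rev d.1), G.attach_notMem_cycleAt d.2.2.1⟩
    | .toOut d => .xout (Quot.mk _ d)
  cap
    | .ext e => G.residualCap F e.1
    | .fromIn d => G.restrict F (G.rev d.1)
    | .toOut d => G.restrict F d.1
  source := Set.range .xin
  sink := Set.range .xout

/-- The arcs of `H` at `s`: these are the arcs `(s, s_i)` and their reversals. -/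
def supersourceArcs (F : G.ExtArc → ℝ≥0) (x : V) : Set (G.AuxArc (G.restrict F) x) :=
  {e | (G.aux F x).tail e = G.auxS _ x ∨ (G.aux F x).head e = G.auxS _ x}

/-- The network `H` without the arcs `(s, s_i)` and their reversals. -/
noncomputable def auxDeleted (F : G.ExtArc → ℝ≥0) (x : V) :
    FlowNetwork (G.AuxVertex (G.restrict F) x)
      {e : G.AuxArc (G.restrict F) x // e ∉ G.supersourceArcs F x} :=
  (G.aux F x).deleteArcs (G.supersourceArcs F x)

end PlaneNetwork

/-! The claims about paths and flows follow from a single flow in `H` that vanishes on the arcs at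
the supersource and either has value at least the excess of `x` or saturates a cut of `H`. Scaling
it yields every value up to the excess that `H` admits. If `H` has an augmenting path, then the
value of this flow is positive, and a positive flow that avoids `s` yields an augmenting path that
avoids `s`.

The flow is the difference between `F` and a rerouted vector `φ` (`exists_isOptimal`, `reroute`).
Here `φ` equals `F` on `C_x` and at `s` and `t`, is at most `F` on the arcs at `x`, and has the
balance of `F` outside `C_x`. Among all such vectors it minimises first the flow into `x` and then
the total flow. The first criterion excludes a residual path along which more flow could be led
around `x`; the second makes `φ` acyclic, even after the contraction of `C_x`.

If `φ` brings at most `c(x)` into `x`, then at least the excess has been rerouted. Otherwise the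
vertices reached from `x` in the residual graph, together with `s` and possibly `t`, form a
saturated cut, provided that both sources are reached, so that no arc at `s` leaves it. This is the
heart of the proof (`IsOptimal.source_mem_residualReach`). Suppose that a source `v` is not reached.
The arcs on which `φ` carries flow to or from `x` then avoid `v`, so they form an acyclic plane
digraph whose sources and sinks are among two vertices. By Euler's formula
(`IsPlaneRotation.card_descents_lt`) a single interval `I` of darts at `x` separates the arcs into
`x` from those out of it. For `F`, with three terminals, at most two intervals suffice; let `J` be
their union. The number of intervals is submodular, so `I ∩ J` or `I ∪ J` is at most one interval.
All of `φ` enters `x` through `I ∩ J` and leaves it outside `I ∪ J`, and `F`, which dominates `φ` at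
`x`, has no opposite flow there. Since an interval of `C_x` is joined to the rest of `C_x` by two
edges of capacity `c(x)/2`, at most `c(x)` passes through it (`abs_sum_sub_le`), a contradiction.

Planarity is treated through the genus of rotation systems. It is nonnegative, and splitting a
vertex by a transposition does not raise it. Hence deleting edges
(`IsPlaneRotation.exists_restrict`) and splitting vertices by labels
(`IsPlaneRotation.exists_split`) preserve planarity; inflating vertices to cycles preserves it by a
count. These operations turn `G` into `H` without its arcs at `s` and `t`, and the edge at `t` is
pendant. -/

/-! ### Gluing two classes of an equivalence relation -/

/-- The equivalence relation obtained from `r` by identifying the classes of `u` and `v`. -/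
def Setoid.glue {α : Type*} (r : Setoid α) (u v : α) : Setoid α where
  r a b := r a b ∨ (r a u ∧ r b v) ∨ (r a v ∧ r b u)
  iseqv := by
    refine ⟨fun a => Or.inl (r.refl a), ?_, ?_⟩
    · rintro a b (h | h | h)
      exacts [Or.inl (r.symm h), Or.inr (Or.inr h.symm), Or.inr (Or.inl h.symm)]
    · have key : ∀ {a b c}, r a b → r a c → r b c := fun h h' => r.trans (r.symm h) h'
      rintro a b c (h | ⟨h, h'⟩ | ⟨h, h'⟩) (k | ⟨k, k'⟩ | ⟨k, k'⟩)
      · exact Or.inl (r.trans h k)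
      · exact Or.inr (Or.inl ⟨r.trans h k, k'⟩)
      · exact Or.inr (Or.inr ⟨r.trans h k, k'⟩)
      · exact Or.inr (Or.inl ⟨h, key k h'⟩)
      · exact Or.inl (r.trans h (r.trans (key k h') (r.symm k')))
      · exact Or.inl (r.trans h (r.symm k'))
      · exact Or.inr (Or.inr ⟨h, key k h'⟩)
      · exact Or.inl (r.trans h (r.symm k'))
      · exact Or.inl (r.trans h (r.trans (key k h') (r.symm k')))

namespace Setoid

variable {α : Type*} {r r' : Setoid α} {u v : α}

theorem le_glue : r ≤ r.glue u v := fun _ _ h => Or.inl h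

theorem glue_pair : r.glue u v u v := Or.inr (Or.inl ⟨r.refl u, r.refl v⟩)

theorem glue_le (h : r ≤ r') (huv : r' u v) : r.glue u v ≤ r' := by
  rintro a b (k | ⟨k, k'⟩ | ⟨k, k'⟩)
  · exact h k
  · exact r'.trans (h k) (r'.trans huv (r'.symm (h k')))
  · exact r'.trans (h k) (r'.trans (r'.symm huv) (r'.symm (h k')))

theorem glue_eq_self (huv : r u v) : r.glue u v = r :=
  le_antisymm (glue_le le_rfl huv) le_glue

/-- Every class of the glued relation contains exactly one class of `r` other than that of `v`, so
exactly one class is lost. -/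
theorem card_quotient_glue [Finite α] (huv : ¬ r u v) :
    Nat.card (Quotient (r.glue u v)) + 1 = Nat.card (Quotient r) := by
  classical
  let φ : {q : Quotient r // q ≠ Quotient.mk r v} → Quotient (r.glue u v) := fun q =>
    Quotient.map' (s₂ := r.glue u v) id (fun a b h => Or.inl h) q.1
  have hφ : Function.Bijective φ := by
    constructor
    · rintro ⟨q, hq⟩ ⟨q', hq'⟩ h
      induction q using Quotient.inductionOn with | _ a
      induction q' using Quotient.inductionOn with | _ b
      have ha : ¬ r a v := fun h => hq (Quotient.sound h)
      have hb : ¬ r b v := fun h => hq' (Quotient.sound h)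
      have hab : r.glue u v a b := Quotient.exact h
      rcases hab with k | k | k
      · exact Subtype.ext (Quotient.sound k)
      · exact absurd k.2 hb
      · exact absurd k.1 ha
    · intro q
      induction q using Quotient.inductionOn with | _ a
      by_cases ha : r a v
      · refine ⟨⟨Quotient.mk r u, fun h => huv (Quotient.exact h)⟩, ?_⟩
        exact Quotient.sound (s := r.glue u v) (Or.inr (Or.inl ⟨r.refl u, ha⟩))
      · exact ⟨⟨Quotient.mk r a, fun h => ha (Quotient.exact h)⟩, rfl⟩
  have h1 := Nat.card_congr (Equiv.ofBijective φ hφ)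
  rw [← h1]
  have h2 := Nat.card_congr (Equiv.sumCompl (fun q : Quotient r => q = Quotient.mk r v))
  rw [Nat.card_sum, Nat.card_unique] at h2
  rw [← h2, add_comm]

end Setoid

/-! ### Cycles of permutations -/

namespace Equiv.Perm

variable {D : Type*}

theorem sameCycle_apply_self (σ : Perm D) (a : D) : σ.SameCycle a (σ a) := ⟨1, by simp⟩

theorem SameCycle.rel_of_forall {σ : Perm D} {r : Setoid D} (h : ∀ a, r a (σ a)) {a b : D}
    (hab : σ.SameCycle a b) : r a b := by
  obtain ⟨n, rfl⟩ := hab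
  induction n using Int.induction_on with
  | zero => exact r.refl _
  | succ n ih =>
    rw [add_comm, zpow_add, zpow_one]
    exact r.trans ih (h _)
  | pred n ih =>
    have := h ((σ ^ (-(n : ℤ) - 1)) a)
    rw [← mul_apply, ← zpow_one_add, add_sub_cancel] at this
    exact r.trans ih (r.symm this)

theorem SameCycle.apply_eq {L : Type*} {σ : Perm D} {ℓ : D → L} (h : ∀ a, ℓ (σ a) = ℓ a) {a b : D}
    (hab : σ.SameCycle a b) : ℓ a = ℓ b :=
  SameCycle.rel_of_forall (r := Setoid.ker ℓ) (fun a => (h a).symm) hab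

/-- The equivalence relation generated by the orbits of two permutations. -/
def compSetoid (σ τ : Perm D) : Setoid D :=
  MulAction.orbitRel (Subgroup.closure {σ, τ}) D

theorem compSetoid_left (σ τ : Perm D) (a : D) : compSetoid σ τ a (σ a) :=
  Setoid.symm' _ ⟨⟨σ, Subgroup.subset_closure (by simp)⟩, rfl⟩

theorem compSetoid_right (σ τ : Perm D) (a : D) : compSetoid σ τ a (τ a) :=
  Setoid.symm' _ ⟨⟨τ, Subgroup.subset_closure (by simp)⟩, rfl⟩

theorem compSetoid_le {σ τ : Perm D} {r : Setoid D} (h : ∀ a, r a (σ a)) (h' : ∀ a, r a (τ a)) :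
    compSetoid σ τ ≤ r := by
  rintro a b ⟨⟨g, hg⟩, rfl⟩
  suffices ∀ b, r (g b) b from this b
  induction hg using Subgroup.closure_induction with
  | mem x hx =>
    rcases hx with rfl | rfl
    exacts [fun b => r.symm (h b), fun b => r.symm (h' b)]
  | one => exact fun b => r.refl _
  | mul x y _ _ hx hy => exact fun b => r.trans (hx (y b)) (hy b)
  | inv x _ hx => exact fun b => by simpa using r.symm (hx (x⁻¹ b))

theorem sameCycle_le_compSetoid (σ τ : Perm D) : SameCycle.setoid σ ≤ compSetoid σ τ :=
  fun _ _ h => h.rel_of_forall (compSetoid_left σ τ)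

theorem sameCycle_mul_le_compSetoid (σ τ : Perm D) : SameCycle.setoid (σ * τ) ≤ compSetoid σ τ :=
  fun _ _ h => h.rel_of_forall fun a =>
    (compSetoid σ τ).trans (compSetoid_right σ τ a) (compSetoid_left σ τ (τ a))

/-! ### Multiplication by a transposition -/

variable [DecidableEq D]

theorem swap_mul_swap_mul (u v : D) (σ : Perm D) : swap u v * (swap u v * σ) = σ := by
  rw [← mul_assoc, swap_mul_self, one_mul]

theorem _root_.Setoid.rel_swap {r : Setoid D} {u v : D} (h : r u v) (c : D) :
    r c (swap u v c) := by
  rcases eq_or_ne c u with rfl | h1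
  · simpa using h
  rcases eq_or_ne c v with rfl | h2
  · simpa using r.symm h
  · rw [swap_apply_of_ne_of_ne h1 h2]

theorem sameCycle_swap_mul_le (σ : Perm D) (u v : D) :
    SameCycle.setoid (swap u v * σ) ≤ (SameCycle.setoid σ).glue u v := fun _ _ h =>
  h.rel_of_forall fun a => Setoid.trans' _ (Setoid.le_glue (sameCycle_apply_self σ a))
    (Setoid.rel_swap Setoid.glue_pair (σ a))

/-- One inclusion suffices: the transposition is an involution, so the other follows by exchanging
the roles of `σ` and `swap u v * σ`. -/
theorem glue_sameCycle_swap_mul (σ : Perm D) (u v : D) :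
    (SameCycle.setoid (swap u v * σ)).glue u v = (SameCycle.setoid σ).glue u v := by
  refine le_antisymm (Setoid.glue_le (sameCycle_swap_mul_le σ u v) Setoid.glue_pair)
    (Setoid.glue_le ?_ Setoid.glue_pair)
  have := sameCycle_swap_mul_le (swap u v * σ) u v
  rwa [swap_mul_swap_mul] at this

theorem compSetoid_swap_mul_le (σ τ : Perm D) (u v : D) :
    compSetoid (swap u v * σ) τ ≤ (compSetoid σ τ).glue u v :=
  compSetoid_le (fun a => Setoid.trans' _ (Setoid.le_glue (compSetoid_left σ τ a))
    (Setoid.rel_swap Setoid.glue_pair (σ a))) fun a => Setoid.le_glue (compSetoid_right σ τ a)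

theorem glue_compSetoid_swap_mul (σ τ : Perm D) (u v : D) :
    (compSetoid (swap u v * σ) τ).glue u v = (compSetoid σ τ).glue u v := by
  refine le_antisymm (Setoid.glue_le (compSetoid_swap_mul_le σ τ u v) Setoid.glue_pair)
    (Setoid.glue_le ?_ Setoid.glue_pair)
  have := compSetoid_swap_mul_le (swap u v * σ) τ u v
  rwa [swap_mul_swap_mul] at this

/-- Multiplication with `swap u v` separates `u` from `v` or joins them. -/
theorem sameCycle_swap_mul_iff [Finite D] {σ : Perm D} {u v : D} (huv : u ≠ v) :
    (swap u v * σ).SameCycle u v ↔ ¬ σ.SameCycle u v := by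
  -- Let `n` be the first positive time at which the orbit of `u` meets `u` or `v`. Before time `n`
  -- the orbits of `u` under `σ` and `swap u v * σ` agree, and at time `n` the transposition
  -- exchanges the two outcomes. An orbit that returns to `u` first never meets `v`.
  have hex : ∃ n, 0 < n ∧ ((σ ^ n) u = u ∨ (σ ^ n) u = v) :=
    ⟨orderOf σ, orderOf_pos σ, Or.inl (by rw [pow_orderOf_eq_one]; rfl)⟩
  classical
  obtain ⟨hn, hn'⟩ := Nat.find_spec hex
  set n := Nat.find hex with hndef
  have hmin : ∀ k, 0 < k → k < n → (σ ^ k) u ≠ u ∧ (σ ^ k) u ≠ v := fun k hk hkn => by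
    have := Nat.find_min hex hkn
    tauto
  have hpow : ∀ k < n, ((swap u v * σ) ^ k) u = (σ ^ k) u := by
    intro k
    induction k with
    | zero => intro _; rfl
    | succ k ih =>
      intro hk
      rw [pow_succ', mul_apply, ih (by omega), mul_apply, ← mul_apply σ, ← pow_succ']
      have := hmin (k + 1) (by omega) hk
      exact swap_apply_of_ne_of_ne this.1 this.2
  have hpown : ((swap u v * σ) ^ n) u = swap u v ((σ ^ n) u) := by
    obtain ⟨m, hm⟩ : ∃ m, n = m + 1 := ⟨n - 1, by omega⟩
    rw [hm, pow_succ', mul_apply, hpow m (by omega), mul_apply, ← mul_apply σ, ← pow_succ']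
  -- a permutation that returns to `u` after `n` steps without meeting `v`
  have aux : ∀ τ : Perm D, (∀ k < n, (τ ^ k) u = (σ ^ k) u) → (τ ^ n) u = u →
      ¬ τ.SameCycle u v := by
    intro τ h1 h2 h3
    obtain ⟨i, hi⟩ := h3.exists_nat_pow_eq
    have hmod : ∀ q, (τ ^ (n * q)) u = u := fun q => by
      rw [pow_mul]
      induction q with
      | zero => rfl
      | succ q ih => rw [pow_succ, mul_apply, h2, ih]
    have h4 : (τ ^ i) u = (τ ^ (i % n)) u := by
      conv_lhs => rw [← Nat.mod_add_div i n, pow_add, mul_apply, hmod]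
    have hlt := Nat.mod_lt i hn
    rw [hi, h1 _ hlt] at h4
    rcases Nat.eq_zero_or_pos (i % n) with h0 | h0
    · rw [h0] at h4
      exact huv h4.symm
    · exact (hmin _ h0 hlt).2 h4.symm
  rcases hn' with h | h
  · have hnot : ¬ σ.SameCycle u v := aux σ (fun _ _ => rfl) h
    simp only [hnot, not_false_eq_true, iff_true]
    exact ⟨n, by rw [zpow_natCast, hpown, h, swap_apply_left]⟩
  · have hs : σ.SameCycle u v := ⟨n, by simpa using h⟩
    simp only [hs, not_true_eq_false, iff_false]
    exact aux _ hpow (by rw [hpown, h, swap_apply_right])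

/-- The number of cycles, fixed points included. -/
noncomputable def numCycles {D : Type*} (σ : Perm D) : ℕ :=
  Nat.card (Quotient (SameCycle.setoid σ))

/-- The number of orbits of the group generated by two permutations. -/
noncomputable def numComp {D : Type*} (σ τ : Perm D) : ℕ := Nat.card (Quotient (compSetoid σ τ))

theorem numCycles_swap_mul_of_sameCycle [Finite D] {σ : Perm D} {u v : D} (huv : u ≠ v)
    (h : σ.SameCycle u v) : numCycles (swap u v * σ) = numCycles σ + 1 := by
  have h' : ¬ (SameCycle.setoid (swap u v * σ)) u v := fun k =>
    (sameCycle_swap_mul_iff huv).1 k h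
  have h1 := Setoid.card_quotient_glue h'
  rw [glue_sameCycle_swap_mul, Setoid.glue_eq_self (r := SameCycle.setoid σ) h] at h1
  exact h1.symm

theorem numCycles_swap_mul_of_not_sameCycle [Finite D] {σ : Perm D} {u v : D} (huv : u ≠ v)
    (h : ¬ σ.SameCycle u v) : numCycles (swap u v * σ) + 1 = numCycles σ := by
  have h2 := numCycles_swap_mul_of_sameCycle huv ((sameCycle_swap_mul_iff huv).2 h)
  rw [swap_mul_swap_mul] at h2
  exact h2.symm

end Equiv.Perm

open Equiv Equiv.Perm

/-! ### The genus of a rotation system -/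

/-- Twice the genus of a rotation system. -/
noncomputable def doubleGenus {D : Type*} (rot rev : Perm D) : ℤ :=
  2 * numComp rot rev + numCycles rev - numCycles rot - numCycles (rot * rev)

theorem isPlaneRotation_iff {D : Type*} {rot rev : Perm D} :
    IsPlaneRotation rot rev ↔ doubleGenus rot rev = 0 := by
  have : IsPlaneRotation rot rev ↔
    numCycles rot + numCycles (rot * rev) = numCycles rev + 2 * numComp rot rev := Iff.rfl
  rw [this, doubleGenus]
  omega

/-! ### The effect of splitting and joining vertices on the genus -/

section

variable {D : Type*} [Finite D]

/-- Splitting a vertex adds one vertex. If `u` and `v` lie on one face, this face is split as well,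
and the number of components grows by at most one, which the two gains offset. If they lie on
different faces, these faces merge; the merged face keeps the component connected, and the genus is
unchanged. -/
theorem doubleGenus_swap_mul_le [DecidableEq D] {rot rev : Perm D} {u v : D} (huv : u ≠ v)
    (h : rot.SameCycle u v) : doubleGenus (swap u v * rot) rev ≤ doubleGenus rot rev := by
  have hV := numCycles_swap_mul_of_sameCycle huv h
  have hC : (compSetoid (swap u v * rot) rev).glue u v = compSetoid rot rev := by
    rw [glue_compSetoid_swap_mul, Setoid.glue_eq_self (sameCycle_le_compSetoid _ _ h)]
  unfold doubleGenus
  rw [mul_assoc]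
  by_cases hF : (rot * rev).SameCycle u v
  · have hF' := numCycles_swap_mul_of_sameCycle huv hF
    have : numComp (swap u v * rot) rev ≤ numComp rot rev + 1 := by
      unfold numComp
      by_cases hc : compSetoid (swap u v * rot) rev u v
      · rw [← hC, Setoid.glue_eq_self hc]
        omega
      · rw [← hC, Setoid.card_quotient_glue hc]
    omega
  · have hF' := numCycles_swap_mul_of_not_sameCycle huv hF
    have hc : compSetoid (swap u v * rot) rev u v := by
      refine sameCycle_mul_le_compSetoid _ _ ?_
      rw [mul_assoc]
      exact (sameCycle_swap_mul_iff huv).2 hF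
    have : numComp (swap u v * rot) rev = numComp rot rev := by
      unfold numComp
      rw [← hC, Setoid.glue_eq_self hc]
    omega

/-- Joining two components at a vertex loses one vertex, one face and one component, and these
losses cancel. -/
theorem doubleGenus_swap_mul_of_not_compSetoid [DecidableEq D] {rot rev : Perm D} {u v : D}
    (h : ¬ compSetoid rot rev u v) : doubleGenus (swap u v * rot) rev = doubleGenus rot rev := by
  have huv : u ≠ v := by
    rintro rfl
    exact h (Setoid.refl' _ u)
  have hr : ¬ rot.SameCycle u v := fun k => h (sameCycle_le_compSetoid _ _ k)
  have hV := numCycles_swap_mul_of_not_sameCycle huv hr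
  have hF := numCycles_swap_mul_of_not_sameCycle (σ := rot * rev) huv
    fun k => h (sameCycle_mul_le_compSetoid _ _ k)
  have hC : numComp (swap u v * rot) rev + 1 = numComp rot rev := by
    unfold numComp
    rw [← Setoid.card_quotient_glue h, ← glue_compSetoid_swap_mul, Setoid.glue_eq_self]
    exact sameCycle_le_compSetoid _ _ ((sameCycle_swap_mul_iff huv).2 hr)
  unfold doubleGenus
  rw [mul_assoc]
  omega

theorem card_eq_two_mul_numCycles {rev : Perm D} (hrev : ∀ d, rev (rev d) = d)
    (hne : ∀ d, rev d ≠ d) : Nat.card D = 2 * numCycles rev := by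
  classical
  have := Fintype.ofFinite D
  have := Fintype.ofFinite (Quotient (SameCycle.setoid rev))
  unfold numCycles
  rw [Nat.card_eq_fintype_card, Nat.card_eq_fintype_card, ← Finset.card_univ, ← Finset.card_univ,
    Finset.card_eq_sum_card_fiberwise (f := fun d => Quotient.mk (SameCycle.setoid rev) d)
      (t := Finset.univ) (by simp), Finset.sum_const_nat (m := 2), mul_comm]
  intro q _
  induction q using Quotient.inductionOn with | _ a
  have : (Finset.univ.filter fun d => Quotient.mk (SameCycle.setoid rev) d = Quotient.mk _ a)
      = {a, rev a} := by
    ext d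
    simp only [Finset.mem_filter, Finset.mem_univ, true_and, Finset.mem_insert,
      Finset.mem_singleton]
    constructor
    · intro h
      have h' : rev.SameCycle a d := (Quotient.exact h).symm
      obtain ⟨n, rfl⟩ := h'.exists_nat_pow_eq
      induction n with
      | zero => left; rfl
      | succ n ih =>
        rw [pow_succ', mul_apply]
        rcases ih (Quotient.sound (s := SameCycle.setoid rev)
          (SameCycle.symm ⟨n, by simp⟩)) ⟨n, by simp⟩ with h | h
        · right; rw [h]
        · left; rw [h, hrev]
    · rintro (rfl | rfl)
      · rfl
      · exact Quotient.sound (s := SameCycle.setoid rev) (sameCycle_apply_self rev a).symm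
  rw [this, Finset.card_pair (hne a).symm]

theorem numCycles_one {D : Type*} : numCycles (1 : Perm D) = Nat.card D := by
  unfold numCycles
  refine (Nat.card_congr (Equiv.ofBijective (Quotient.mk (SameCycle.setoid (1 : Perm D)))
    ⟨fun a b h => ?_, Quotient.mk_surjective⟩)).symm
  have h' : (1 : Perm D).SameCycle a b := Quotient.exact h
  simpa using h'

/-- Cutting a dart off its vertex does not raise the genus and shrinks the support of the rotation.
At the end only isolated edges are left, and these have genus zero. -/
theorem doubleGenus_nonneg {rot rev : Perm D} (hrev : ∀ d, rev (rev d) = d)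
    (hne : ∀ d, rev d ≠ d) : 0 ≤ doubleGenus rot rev := by
  classical
  have := Fintype.ofFinite D
  induction hk : rot.support.card using Nat.strong_induction_on generalizing rot with
  | _ k ih =>
    by_cases h1 : rot = 1
    · subst h1
      have hC : compSetoid 1 rev = SameCycle.setoid rev :=
        le_antisymm (compSetoid_le (fun a => Setoid.refl' _ a) (sameCycle_apply_self rev))
          fun _ _ h => h.rel_of_forall (compSetoid_right 1 rev)
      have := card_eq_two_mul_numCycles hrev hne
      rw [doubleGenus, one_mul, numCycles_one, this, numComp, hC]
      change (0 : ℤ) ≤ 2 * (numCycles rev : ℤ) + _ - _ - _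
      push_cast
      omega
    · obtain ⟨a, ha⟩ : ∃ a, rot a ≠ a := by
        by_contra! h
        exact h1 (Equiv.ext h)
      refine (ih _ ?_ rfl).trans
        (doubleGenus_swap_mul_le (u := a) (v := rot a) ha.symm (sameCycle_apply_self rot a))
      rw [← hk]
      exact card_support_swap_mul ha

end

/-! ### Invariant subsets of a rotation system -/

section

variable {K N D : Type*}

theorem Setoid.card_quotient_sum {r : Setoid D} {ι : K → D} {κ : N → D} [Finite D]
    (hι : ι.Injective) (hκ : κ.Injective)
    (hcov : ∀ d, (∃ k, ι k = d) ∨ ∃ n, κ n = d) (hdisj : ∀ k n, ¬ r (ι k) (κ n)) :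
    Nat.card (Quotient r) =
      Nat.card (Quotient (r.comap ι)) + Nat.card (Quotient (r.comap κ)) := by
  have := Finite.of_injective ι hι
  have := Finite.of_injective κ hκ
  rw [← Nat.card_sum]
  refine (Nat.card_congr (Equiv.ofBijective (Sum.elim
    (Quotient.map' (s₁ := r.comap ι) (s₂ := r) ι fun _ _ h => h)
    (Quotient.map' (s₁ := r.comap κ) (s₂ := r) κ fun _ _ h => h)) ⟨?_, ?_⟩)).symm
  · rintro (a | a) (b | b) h <;> induction a using Quotient.inductionOn with | _ a <;>
      induction b using Quotient.inductionOn with | _ b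
    · exact congrArg Sum.inl (Quotient.sound (s := r.comap ι) (Quotient.exact (s := r) h))
    · exact absurd (Quotient.exact (s := r) h) (hdisj _ _)
    · exact absurd (r.symm (Quotient.exact (s := r) h)) (hdisj _ _)
    · exact congrArg Sum.inr (Quotient.sound (s := r.comap κ) (Quotient.exact (s := r) h))
  · intro q
    induction q using Quotient.inductionOn with | _ d
    rcases hcov d with ⟨k, rfl⟩ | ⟨n, rfl⟩
    exacts [⟨Sum.inl (Quotient.mk _ k), rfl⟩, ⟨Sum.inr (Quotient.mk _ n), rfl⟩]

/-- The complement of the image is invariant too, so an invariant function on `K` extends by `none`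
to an invariant function on `D`. Such functions serve to show that orbits in `D` do not connect more
than those in `K`. -/
theorem extend_apply_eq_of_semiconj {β : Type*} {ι : K → D} (hι : ι.Injective) {σ : Perm D}
    {σK : Perm K} (h : ∀ k, ι (σK k) = σ (ι k)) {c : K → β} (hc : ∀ k, c (σK k) = c k) (d : D) :
    Function.extend ι (fun k => some (c k)) (fun _ => none) d =
      Function.extend ι (fun k => some (c k)) (fun _ => none) (σ d) := by
  by_cases hd : ∃ k, ι k = d
  · obtain ⟨k, rfl⟩ := hd
    rw [← h, hι.extend_apply, hι.extend_apply, hc]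
  · rw [Function.extend_apply' _ _ _ hd, Function.extend_apply']
    rintro ⟨k, hk⟩
    refine hd ⟨σK.symm k, σ.injective ?_⟩
    rw [← h, Equiv.apply_symm_apply, hk]

theorem comap_compSetoid {ι : K → D} (hι : ι.Injective) {σ τ : Perm D} {σK τK : Perm K}
    (hσ : ∀ k, ι (σK k) = σ (ι k)) (hτ : ∀ k, ι (τK k) = τ (ι k)) :
    (compSetoid σ τ).comap ι = compSetoid σK τK := by
  refine le_antisymm (fun a b h => ?_) (compSetoid_le (fun k => ?_) fun k => ?_)
  · have key : compSetoid σ τ ≤ Setoid.ker (Function.extend ι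
        (fun k => some (Quotient.mk (compSetoid σK τK) k)) (fun _ => none)) :=
      compSetoid_le
        (extend_apply_eq_of_semiconj hι hσ fun k =>
          Quotient.sound (Setoid.symm' _ (compSetoid_left σK τK k)))
        (extend_apply_eq_of_semiconj hι hτ fun k =>
          Quotient.sound (Setoid.symm' _ (compSetoid_right σK τK k)))
    have h' := key h
    rw [Setoid.ker_def, hι.extend_apply, hι.extend_apply, Option.some_inj] at h'
    exact Quotient.exact h'
  · rw [Setoid.comap_rel, hσ]
    exact compSetoid_left _ _ _
  · rw [Setoid.comap_rel, hτ]
    exact compSetoid_right _ _ _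

theorem compSetoid_one_right (σ : Perm D) : compSetoid σ 1 = SameCycle.setoid σ :=
  le_antisymm (compSetoid_le (sameCycle_apply_self σ) fun a => Setoid.refl' _ a)
    (sameCycle_le_compSetoid σ 1)

theorem not_compSetoid_of_disjoint {ι : K → D} (hι : ι.Injective) {σ τ : Perm D} {σK τK : Perm K}
    (hσ : ∀ k, ι (σK k) = σ (ι k)) (hτ : ∀ k, ι (τK k) = τ (ι k)) {k : K} {d : D}
    (hd : ∀ l, ι l ≠ d) : ¬ compSetoid σ τ (ι k) d := by
  intro h
  have key : compSetoid σ τ ≤ Setoid.ker (Function.extend ι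
      (fun _ => some ()) (fun _ => none)) :=
    compSetoid_le (extend_apply_eq_of_semiconj hι hσ fun _ => rfl)
      (extend_apply_eq_of_semiconj hι hτ fun _ => rfl)
  have h' := key h
  rw [Setoid.ker_def, hι.extend_apply, Function.extend_apply' _ _ _ (by simpa using hd)] at h'
  cases h'

theorem numComp_sum [Finite D] {ι : K → D} {κ : N → D} (hι : ι.Injective) (hκ : κ.Injective)
    (hcov : ∀ d, (∃ k, ι k = d) ∨ ∃ n, κ n = d) (hdisj : ∀ k n, ι k ≠ κ n)
    {σ τ : Perm D} {σK τK : Perm K} {σN τN : Perm N}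
    (hσ : ∀ k, ι (σK k) = σ (ι k)) (hτ : ∀ k, ι (τK k) = τ (ι k))
    (hσ' : ∀ k, κ (σN k) = σ (κ k)) (hτ' : ∀ k, κ (τN k) = τ (κ k)) :
    numComp σ τ = numComp σK τK + numComp σN τN := by
  unfold numComp
  rw [Setoid.card_quotient_sum hι hκ hcov, comap_compSetoid hι hσ hτ, comap_compSetoid hκ hσ' hτ']
  exact fun k n => not_compSetoid_of_disjoint hι hσ hτ fun l => hdisj l n

theorem numCycles_sum [Finite D] {ι : K → D} {κ : N → D} (hι : ι.Injective) (hκ : κ.Injective)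
    (hcov : ∀ d, (∃ k, ι k = d) ∨ ∃ n, κ n = d) (hdisj : ∀ k n, ι k ≠ κ n)
    {σ : Perm D} {σK : Perm K} {σN : Perm N}
    (hσ : ∀ k, ι (σK k) = σ (ι k)) (hσ' : ∀ k, κ (σN k) = σ (κ k)) :
    numCycles σ = numCycles σK + numCycles σN := by
  have := numComp_sum hι hκ hcov hdisj hσ (τ := 1) (τK := 1) (fun _ => rfl) hσ' (τN := 1)
    (fun _ => rfl)
  simp only [numComp, compSetoid_one_right] at this
  exact this

theorem doubleGenus_sum [Finite D] {ι : K → D} {κ : N → D} (hι : ι.Injective) (hκ : κ.Injective)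
    (hcov : ∀ d, (∃ k, ι k = d) ∨ ∃ n, κ n = d) (hdisj : ∀ k n, ι k ≠ κ n)
    {σ τ : Perm D} {σK τK : Perm K} {σN τN : Perm N}
    (hσ : ∀ k, ι (σK k) = σ (ι k)) (hτ : ∀ k, ι (τK k) = τ (ι k))
    (hσ' : ∀ k, κ (σN k) = σ (κ k)) (hτ' : ∀ k, κ (τN k) = τ (κ k)) :
    doubleGenus σ τ = doubleGenus σK τK + doubleGenus σN τN := by
  unfold doubleGenus
  rw [numComp_sum hι hκ hcov hdisj hσ hτ hσ' hτ', numCycles_sum hι hκ hcov hdisj hσ hσ',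
    numCycles_sum hι hκ hcov hdisj hτ hτ',
    numCycles_sum (σ := σ * τ) (σK := σK * τK) (σN := σN * τN) hι hκ hcov hdisj
      (by simp [hσ, hτ]) (by simp [hσ', hτ'])]
  push_cast
  ring

/-- A rotation system all of whose vertices have degree one. -/
theorem doubleGenus_one [Finite D] {rev : Perm D} (hrev : ∀ d, rev (rev d) = d)
    (hne : ∀ d, rev d ≠ d) : doubleGenus 1 rev = 0 := by
  have hC : compSetoid 1 rev = SameCycle.setoid rev :=
    le_antisymm (compSetoid_le (fun a => Setoid.refl' _ a) (sameCycle_apply_self rev))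
      fun _ _ h => h.rel_of_forall (compSetoid_right 1 rev)
  have := card_eq_two_mul_numCycles hrev hne
  rw [doubleGenus, one_mul, numCycles_one, this, numComp, hC]
  change 2 * (numCycles rev : ℤ) + _ - _ - _ = 0
  push_cast
  ring

/-! ### Deleting edges -/

/-- The permutation `σK` of `K` is the first return map of `σ` to the image of `K`. -/
def IsFirstReturn (ι : K → D) (σ : Perm D) (σK : Perm K) : Prop :=
  ∀ k, ∃ n : ℕ, ι (σK k) = (σ ^ (n + 1)) (ι k) ∧
    ∀ i, 0 < i → i ≤ n → ∀ l, ι l ≠ (σ ^ i) (ι k)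

/-- In the harder direction a `σ`-walk between two points of the image is shortened by one return at
a time. -/
theorem IsFirstReturn.sameCycle_iff [Finite D] {ι : K → D} (hι : ι.Injective) {σ : Perm D}
    {σK : Perm K} (h : IsFirstReturn ι σ σK) {a b : K} :
    σK.SameCycle a b ↔ σ.SameCycle (ι a) (ι b) := by
  constructor
  · intro hab
    refine SameCycle.rel_of_forall (r := (SameCycle.setoid σ).comap ι) (fun k => ?_) hab
    obtain ⟨n, hn, -⟩ := h k
    exact ⟨(n + 1 : ℕ), by rw [hn, zpow_natCast]⟩
  · intro hab
    obtain ⟨m, hm⟩ := hab.exists_nat_pow_eq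
    clear hab
    induction m using Nat.strong_induction_on generalizing a with
    | _ m ih =>
      rcases Nat.eq_zero_or_pos m with rfl | hpos
      · exact hι hm ▸ SameCycle.refl _ _
      · obtain ⟨n, hn, hn'⟩ := h a
        by_cases hmn : m ≤ n
        · exact absurd hm.symm (hn' m hpos hmn b)
        · refine (sameCycle_apply_self σK a).trans (ih (m - (n + 1)) (by omega) ?_)
          rw [hn, ← mul_apply, ← pow_add, Nat.sub_add_cancel (by omega), hm]

/-- The darts of `M` are cut off one after the other by transpositions within their vertices, which
cannot raise the genus. Each time the predecessor of the dart merely skips it, whence the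
description of the new rotation as a first return. -/
theorem exists_detach [Finite D] (rot rev : Perm D) (M : Finset D) :
    ∃ rot' : Perm D, doubleGenus rot' rev ≤ doubleGenus rot rev ∧ (∀ a ∈ M, rot' a = a) ∧
      ∀ e ∉ M, ∃ n : ℕ, rot' e = (rot ^ (n + 1)) e ∧
        ∀ i, 0 < i → i ≤ n → (rot ^ i) e ∈ M := by
  classical
  induction M using Finset.induction_on with
  | empty => exact ⟨rot, le_rfl, by simp, fun e _ => ⟨0, by simp, by omega⟩⟩
  | insert a M haM ih =>
    obtain ⟨rot', hg, hfix, hret⟩ := ih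
    refine ⟨swap a (rot' a) * rot', ?_, ?_, ?_⟩
    · rcases eq_or_ne (rot' a) a with ha | ha
      · rwa [ha, swap_self, ← Perm.one_def, one_mul]
      · exact (doubleGenus_swap_mul_le ha.symm (sameCycle_apply_self rot' a)).trans hg
    · intro b hb
      rw [mul_apply]
      rcases eq_or_ne b a with rfl | hba
      · exact swap_apply_right _ _
      · have hbM : b ∈ M := by simpa [hba] using hb
        rw [hfix b hbM, swap_apply_of_ne_of_ne hba]
        intro h
        exact hba (rot'.injective ((hfix b hbM).trans h))
    · intro e he
      rw [Finset.mem_insert, not_or] at he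
      obtain ⟨n, hn, hn'⟩ := hret e he.2
      by_cases hea : rot' e = a
      -- The predecessor of `a` now skips it: its new return is its old one followed by that of `a`.
      · obtain ⟨m, hm, hm'⟩ := hret a haM
        have hshift : ∀ j, (rot ^ (j + (n + 1))) e = (rot ^ j) a := fun j => by
          rw [pow_add, mul_apply, ← hn, hea]
        refine ⟨m + (n + 1), ?_, fun i hi hi' => ?_⟩
        · rw [mul_apply, hea, swap_apply_left, hm, ← hshift]
          congr 2
          omega
        · rcases lt_trichotomy i (n + 1) with h | rfl | h
          · exact Finset.mem_insert_of_mem (hn' i hi (by omega))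
          · rw [← hn, hea]
            exact Finset.mem_insert_self _ _
          · obtain ⟨j, rfl⟩ : ∃ j, i = j + (n + 1) := ⟨i - (n + 1), by omega⟩
            rw [hshift]
            exact Finset.mem_insert_of_mem (hm' j (by omega) (by omega))
      · refine ⟨n, ?_, fun i hi hi' => Finset.mem_insert_of_mem (hn' i hi hi')⟩
        rw [mul_apply, swap_apply_of_ne_of_ne hea, hn]
        exact fun h => he.1 (rot'.injective h)

/-- A rotation system stays plane when edges are deleted. -/
theorem IsPlaneRotation.exists_restrict [Finite D] {rot rev : Perm D}
    (hplane : IsPlaneRotation rot rev) (hrev : ∀ d, rev (rev d) = d) (hne : ∀ d, rev d ≠ d)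
    {ι : K → D} (hι : ι.Injective) {revK : Perm K} (hK : ∀ k, ι (revK k) = rev (ι k)) :
    ∃ rotK : Perm K, IsPlaneRotation rotK revK ∧ IsFirstReturn ι rot rotK := by
  classical
  have := Fintype.ofFinite D
  have := Finite.of_injective ι hι
  obtain ⟨rot', hg, hfix, hret⟩ := exists_detach rot rev
    (Finset.univ.filter fun d => ∀ k, ι k ≠ d)
  simp only [Finset.mem_filter, Finset.mem_univ, true_and] at hfix hret
  have hmaps : ∀ k, ∃ l, ι l = rot' (ι k) := by
    intro k
    by_contra! h
    exact h k (rot'.injective (hfix _ h)).symm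
  choose f hf using hmaps
  have hfinj : f.Injective := fun a b h => hι (rot'.injective (by rw [← hf, ← hf, h]))
  let rotK : Perm K := Equiv.ofBijective f (Finite.injective_iff_bijective.1 hfinj)
  have hrotK : ∀ k, ι (rotK k) = rot' (ι k) := hf
  let N := {d : D // ∀ k, ι k ≠ d}
  have hrevN : ∀ d : D, (∀ k, ι k ≠ rev d) ↔ ∀ k, ι k ≠ d := fun d =>
    ⟨fun h k hk => h (revK k) (by rw [hK, hk]), fun h k hk => h (revK k) (by rw [hK, hk, hrev])⟩
  let revN : Perm N := rev.subtypePerm hrevN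
  -- The deleted darts have become isolated edges of genus zero, so the part that is kept has genus
  -- at most zero, hence zero.
  have hsum : doubleGenus rot' rev = doubleGenus rotK revK + doubleGenus (1 : Perm N) revN := by
    refine doubleGenus_sum (κ := Subtype.val) hι Subtype.val_injective (fun d => ?_)
      (fun k (n : N) => n.2 k) hrotK hK (fun n => (hfix _ n.2).symm) (fun n => rfl)
    by_cases h : ∃ k, ι k = d
    · exact Or.inl h
    · exact Or.inr ⟨⟨d, fun k hk => h ⟨k, hk⟩⟩, rfl⟩
  have h1 : doubleGenus (1 : Perm N) revN = 0 :=
    doubleGenus_one (fun n => Subtype.ext (hrev n.1)) fun n h => hne n.1 (congrArg Subtype.val h)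
  have h2 : 0 ≤ doubleGenus rotK revK := doubleGenus_nonneg
    (fun k => hι (by rw [hK, hK, hrev])) fun k h => hne (ι k) (by rw [← hK, h])
  rw [isPlaneRotation_iff] at hplane
  refine ⟨rotK, isPlaneRotation_iff.2 (by omega), fun k => ?_⟩
  obtain ⟨n, hn, hn'⟩ := hret (ι k) (by simp)
  exact ⟨n, by rw [hrotK, hn], hn'⟩

/-! ### Splitting vertices -/

/-- If the darts are labelled, the vertices of a plane rotation system can be split so that each
vertex only gets darts of one label. Successive darts with the same label stay successive. -/
theorem IsPlaneRotation.exists_split [Finite D] {rot rev : Perm D}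
    (hplane : IsPlaneRotation rot rev) (hrev : ∀ d, rev (rev d) = d) (hne : ∀ d, rev d ≠ d)
    {L : Type*} (ℓ : D → L) :
    ∃ rot' : Perm D, IsPlaneRotation rot' rev ∧ (∀ e, ℓ (rot' e) = ℓ e) ∧
      ∀ e, ℓ (rot e) = ℓ e → rot' e = rot e := by
  classical
  have := Fintype.ofFinite D
  induction hm : (Finset.univ.filter fun e => ℓ (rot e) ≠ ℓ e).card using
    Nat.strong_induction_on generalizing rot with
  | _ m ih =>
    by_cases hbad : ∃ e, ℓ (rot e) ≠ ℓ e
    swap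
    · push Not at hbad
      exact ⟨rot, hplane, hbad, fun _ _ => rfl⟩
    obtain ⟨e, he⟩ := hbad
    -- The label changes after `e`; let `c` be the next dart with the label of `e`. The
    -- transposition makes `c` the successor of `e` and splits off the darts in between. It alters
    -- the successors of `e` and of the predecessor `c'` of `c` only, and the label changed at both,
    -- so the number of changes drops.
    have hex : ∃ n, ℓ ((rot ^ (n + 1)) e) = ℓ e := by
      refine ⟨orderOf rot - 1, ?_⟩
      rw [Nat.sub_add_cancel (orderOf_pos rot), pow_orderOf_eq_one]
      rfl
    have hspec := Nat.find_spec hex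
    have hmin : ∀ k < Nat.find hex, _ := fun k hk => Nat.find_min hex hk
    set n := Nat.find hex
    have hn : n ≠ 0 := by
      intro h0
      rw [h0] at hspec
      exact he (by simpa using hspec)
    have hpred : ℓ ((rot ^ n) e) ≠ ℓ e := by
      have := hmin (n - 1) (by omega)
      rwa [Nat.sub_add_cancel (by omega)] at this
    set c := (rot ^ (n + 1)) e with hc
    set c' := (rot ^ n) e with hc'
    have hcc' : rot c' = c := by rw [hc, hc', pow_succ', mul_apply]
    have hbc : rot e ≠ c := fun h => he (by rw [h, hspec])
    have hsame : rot.SameCycle (rot e) c :=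
      (sameCycle_apply_self rot e).symm.trans ⟨(n + 1 : ℕ), by rw [zpow_natCast]⟩
    set rot₁ := swap (rot e) c * rot with hrot₁
    have he₁ : rot₁ e = c := by rw [hrot₁, mul_apply, swap_apply_left]
    have hc₁ : rot₁ c' = rot e := by rw [hrot₁, mul_apply, hcc', swap_apply_right]
    have hother : ∀ d, d ≠ e → d ≠ c' → rot₁ d = rot d := fun d h1 h2 => by
      rw [hrot₁, mul_apply, swap_apply_of_ne_of_ne]
      · exact fun h => h1 (rot.injective h)
      · exact fun h => h2 (rot.injective (h.trans hcc'.symm))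
    have hgood : ∀ d, ℓ (rot d) = ℓ d → rot₁ d = rot d := fun d hd => by
      refine hother d ?_ ?_
      · rintro rfl
        exact he hd
      · rintro rfl
        rw [hcc', hspec] at hd
        exact hpred hd.symm
    have hplane₁ : IsPlaneRotation rot₁ rev := by
      rw [isPlaneRotation_iff] at hplane ⊢
      have h1 := doubleGenus_swap_mul_le (rev := rev) hbc hsame
      have h2 := doubleGenus_nonneg (rot := rot₁) hrev hne
      rw [← hrot₁] at h1
      omega
    have hlt : (Finset.univ.filter fun e => ℓ (rot₁ e) ≠ ℓ e).card < m := by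
      rw [← hm]
      refine Finset.card_lt_card (Finset.ssubset_iff_of_subset (fun d hd => ?_) |>.2 ⟨e, ?_, ?_⟩)
      · simp only [Finset.mem_filter, Finset.mem_univ, true_and] at hd ⊢
        exact fun h => hd (by rw [hgood d h, h])
      · simpa using he
      · simp [he₁, hspec]
    obtain ⟨rot', h1, h2, h3⟩ := ih _ hlt hplane₁ rfl
    exact ⟨rot', h1, h2, fun d hd => by rw [h3 d (by rw [hgood d hd, hd]), hgood d hd]⟩

end

/-! ### Replacing vertices by cycles -/

section Inflate

variable {D : Type*} {X : D → Prop}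

theorem Setoid.card_le_of_surjective {A B : Type*} [Finite A] {r : Setoid A} (f : A → B)
    (hf : f.Surjective) (h : r ≤ Setoid.ker f) : Nat.card B ≤ Nat.card (Quotient r) :=
  Nat.card_le_card_of_surjective (Quotient.lift f fun _ _ k => h k) fun b => by
    obtain ⟨a, rfl⟩ := hf b
    exact ⟨Quotient.mk r a, rfl⟩

open Classical in
/-- The clockwise successor map of the darts when every vertex with a dart in `X` is replaced by
a cycle with one vertex for each dart. The dart `inr (d, true)` leads from the cycle vertex of `d`
to that of `rot d`, and `inr (d, false)` is its reversal. -/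
noncomputable def inflateRotFun (rot : Perm D) (hX : ∀ d, X (rot d) ↔ X d) :
    D ⊕ {d // X d} × Bool → D ⊕ {d // X d} × Bool
  | .inl d => if h : X d then .inr (⟨d, h⟩, true) else .inl (rot d)
  | .inr (d, true) => .inr (⟨rot⁻¹ d.1, by rw [← hX]; simpa using d.2⟩, false)
  | .inr (d, false) => .inl (rot d.1)

theorem inflateRotFun_injective (rot : Perm D) (hX : ∀ d, X (rot d) ↔ X d) :
    (inflateRotFun rot hX).Injective := by
  rintro (a | ⟨a, (_ | _)⟩) (b | ⟨b, (_ | _)⟩) h <;> simp only [inflateRotFun] at h <;>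
    (try split_ifs at h) <;> simp_all [Subtype.ext_iff]
  · exact absurd b.2 (by assumption)
  · exact absurd a.2 (by subst h; assumption)

/-- The rotation system in which every vertex with a dart in `X` is replaced by a cycle. -/
noncomputable def inflateRot [Finite D] (rot : Perm D) (hX : ∀ d, X (rot d) ↔ X d) :
    Perm (D ⊕ {d // X d} × Bool) :=
  Equiv.ofBijective _ (Finite.injective_iff_bijective.1 (inflateRotFun_injective rot hX))

/-- The edge involution that belongs to `inflateRot`. -/
def inflateRev (X : D → Prop) (rev : Perm D) : Perm (D ⊕ {d // X d} × Bool) :=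
  Equiv.sumCongr rev (Equiv.prodCongr (Equiv.refl _) Equiv.boolNot)

theorem inflateRev_inl {rev : Perm D} (d : D) : inflateRev X rev (.inl d) = .inl (rev d) := rfl

theorem inflateRev_inr {rev : Perm D} (d : {d // X d}) (b : Bool) :
    inflateRev X rev (.inr (d, b)) = .inr (d, !b) := rfl

variable [Finite D] {rot rev : Perm D} {hX : ∀ d, X (rot d) ↔ X d}

theorem inflateRot_inl_of_mem {d : D} (h : X d) :
    inflateRot rot hX (.inl d) = .inr (⟨d, h⟩, true) := by
  simp [inflateRot, inflateRotFun, h]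

theorem inflateRot_inl_of_notMem {d : D} (h : ¬ X d) :
    inflateRot rot hX (.inl d) = .inl (rot d) := by
  simp [inflateRot, inflateRotFun, h]

theorem inflateRot_inr_true (d : {d // X d}) :
    inflateRot rot hX (.inr (d, true)) =
      .inr (⟨rot⁻¹ d.1, by rw [← hX]; simpa using d.2⟩, false) := rfl

theorem inflateRot_inr_false (d : {d // X d}) :
    inflateRot rot hX (.inr (d, false)) = .inl (rot d.1) := rfl

theorem sameCycle_inflateRot_inr (d : {d // X d}) (b : Bool) :
    (inflateRot rot hX).SameCycle (.inr (d, b)) (.inl (if b then d.1 else rot d.1)) := by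
  cases b
  · simpa [inflateRot_inr_false] using sameCycle_apply_self (inflateRot rot hX) (.inr (d, false))
  · simpa [inflateRot_inl_of_mem d.2] using
      (sameCycle_apply_self (inflateRot rot hX) (.inl d.1)).symm

theorem sameCycle_inflateRot_inl {d d' : D} (hd : ¬ X d) (h : rot.SameCycle d d') :
    (inflateRot rot hX).SameCycle (.inl d) (.inl d') := by
  obtain ⟨n, rfl⟩ := h.exists_nat_pow_eq
  have hn : ∀ n : ℕ, ¬ X ((rot ^ n) d) := fun n => by
    induction n with
    | zero => exact hd
    | succ n ih => rwa [pow_succ', mul_apply, hX]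
  clear h
  induction n with
  | zero => exact SameCycle.refl _ _
  | succ n ih =>
    refine ih.trans ?_
    have := sameCycle_apply_self (inflateRot rot hX) (.inl ((rot ^ n) d))
    rwa [inflateRot_inl_of_notMem (hn n), ← mul_apply, ← pow_succ'] at this

/-- A cycle in place of a vertex of degree `m` brings `m` edges, `m - 1` additional vertices and one
face. Since the genus is nonnegative, it is enough to bound vertices and faces from below and
components from above; labels that are constant on orbits give the lower bounds. -/
theorem isPlaneRotation_inflate (hplane : IsPlaneRotation rot rev)
    (hrev : ∀ d, rev (rev d) = d) (hne : ∀ d, rev d ≠ d) :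
    IsPlaneRotation (inflateRot rot hX) (inflateRev X rev) := by
  classical
  set R := inflateRot rot hX
  set E := inflateRev X rev
  have hE : ∀ d, E (E d) = d := by
    rintro (d | ⟨d, b⟩) <;> simp [E, inflateRev_inl, inflateRev_inr, hrev]
  have hEne : ∀ d, E d ≠ d := by
    rintro (d | ⟨d, b⟩) <;> simp [E, inflateRev_inl, inflateRev_inr, hne]
  have hXpow : ∀ {a b}, rot.SameCycle a b → (X a = X b) := fun h =>
    h.apply_eq (fun d => propext (hX d))
  have hVsum := Setoid.card_quotient_sum (r := SameCycle.setoid rot)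
    (ι := (Subtype.val : {d // X d} → D))
    (κ := (Subtype.val : {d // ¬ X d} → D)) Subtype.val_injective Subtype.val_injective
    (fun d => (em (X d)).imp (fun h => ⟨⟨d, h⟩, rfl⟩) fun h => ⟨⟨d, h⟩, rfl⟩)
    fun k n h => n.2 ((hXpow h) ▸ k.2)
  set rX := (SameCycle.setoid rot).comap (Subtype.val : {d // X d} → D)
  set rN := (SameCycle.setoid rot).comap (Subtype.val : {d // ¬ X d} → D)
  have hV : Nat.card (Quotient rN) + Nat.card {d // X d} ≤ numCycles R := by
    rw [← Nat.card_sum]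
    let lab : D ⊕ {d // X d} × Bool → Quotient rN ⊕ {d // X d} := fun a => match a with
      | .inl d => if h : X d then .inr ⟨d, h⟩ else .inl (Quotient.mk _ ⟨d, h⟩)
      | .inr (d, true) => .inr d
      | .inr (d, false) => .inr ⟨rot d.1, (hX _).2 d.2⟩
    refine Setoid.card_le_of_surjective lab ?_ fun a b h => SameCycle.apply_eq (fun a => ?_) h
    · rintro (q | d)
      · induction q using Quotient.inductionOn with | _ d
        exact ⟨.inl d.1, by simp [lab, d.2]⟩
      · exact ⟨.inr (d, true), rfl⟩
    · rcases a with d | ⟨d, (_ | _)⟩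
      · by_cases h : X d
        · simp [R, inflateRot_inl_of_mem h, lab, h]
        · have h' : ¬ X (rot d) := by rwa [hX]
          simp only [R, inflateRot_inl_of_notMem h, lab, h, h', dif_neg, not_false_iff]
          exact congrArg Sum.inl (Quotient.sound (s := rN) (sameCycle_apply_self rot d).symm)
      · have h' : X (rot d.1) := by rw [hX]; exact d.2
        simp [R, inflateRot_inr_false, lab, h']
      · simp [R, inflateRot_inr_true, lab]
  have hF : numCycles (rot * rev) + Nat.card (Quotient rX) ≤ numCycles (R * E) := by
    unfold numCycles
    rw [← Nat.card_sum]
    -- The clockwise cycle dart of `d` lies on the old face of `rot d`; the counterclockwise ones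
    -- bound the new face of the cycle.
    let lab : D ⊕ {d // X d} × Bool → Quotient (SameCycle.setoid (rot * rev)) ⊕ Quotient rX :=
      fun a => match a with
      | .inl d => .inl (Quotient.mk _ d)
      | .inr (d, true) => .inl (Quotient.mk _ (rot d.1))
      | .inr (d, false) => .inr (Quotient.mk _ d)
    refine Setoid.card_le_of_surjective lab ?_ fun a b h => SameCycle.apply_eq (fun a => ?_) h
    · rintro (q | q) <;> induction q using Quotient.inductionOn with | _ d
      exacts [⟨.inl d, rfl⟩, ⟨.inr (d, false), rfl⟩]
    · rcases a with d | ⟨d, (_ | _)⟩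
      · have hs : (Sum.inl (Quotient.mk (SameCycle.setoid (rot * rev)) (rot (rev d))) :
            Quotient (SameCycle.setoid (rot * rev)) ⊕ Quotient rX) =
            .inl (Quotient.mk (SameCycle.setoid (rot * rev)) d) :=
          congrArg Sum.inl (Quotient.sound (s := SameCycle.setoid (rot * rev))
            (sameCycle_apply_self (rot * rev) d).symm)
        by_cases h : X (rev d)
        · simpa only [R, E, mul_apply, inflateRev_inl, inflateRot_inl_of_mem h, lab] using hs
        · simpa only [R, E, mul_apply, inflateRev_inl, inflateRot_inl_of_notMem h, lab] using hs
      · simp only [R, E, mul_apply, inflateRev_inr, Bool.not_false, inflateRot_inr_true, lab]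
        exact congrArg Sum.inr (Quotient.sound (s := rX)
          (show rot.SameCycle _ _ from ⟨1, by simp⟩))
      · simp [R, E, inflateRev_inr, inflateRot_inr_false, lab]
  have hC : numComp R E ≤ numComp rot rev := by
    have hinl : ∀ d, compSetoid R E (.inl d) (.inl (rot d)) := fun d => by
      by_cases h : X d
      · refine Setoid.trans' _ (sameCycle_le_compSetoid R E
          (sameCycle_inflateRot_inr ⟨d, h⟩ true).symm)
          (Setoid.trans' _ (compSetoid_right R E _)
            (sameCycle_le_compSetoid R E (sameCycle_inflateRot_inr ⟨d, h⟩ false)))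
      · exact sameCycle_le_compSetoid R E
          (sameCycle_inflateRot_inl h (sameCycle_apply_self rot d))
    refine Setoid.card_le_of_surjective (fun d => Quotient.mk (compSetoid R E) (.inl d)) ?_ ?_
    · intro q
      induction q using Quotient.inductionOn with | _ a
      rcases a with d | ⟨d, b⟩
      · exact ⟨d, rfl⟩
      · exact ⟨_, Quotient.sound (Setoid.symm' _
          (sameCycle_le_compSetoid R E (sameCycle_inflateRot_inr d b)))⟩
    · exact compSetoid_le (fun d => Quotient.sound (hinl d))
        fun d => Quotient.sound (compSetoid_right R E (.inl d))
  have hD := card_eq_two_mul_numCycles hrev hne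
  have hD' := card_eq_two_mul_numCycles hE hEne
  rw [Nat.card_sum, Nat.card_prod, Nat.card_eq_fintype_card (α := Bool), Fintype.card_bool] at hD'
  have hg := doubleGenus_nonneg (rot := R) hE hEne
  rw [isPlaneRotation_iff] at hplane ⊢
  change numCycles rot = _ at hVsum
  unfold doubleGenus at hplane hg ⊢
  omega

end Inflate

/-! ### Pendant edges -/

/-- The edge is first added as a component of its own, which does not change the genus. If `w`
already has a dart, one transposition joins the two components there; otherwise nothing is left to
do. -/
theorem IsPlaneRotation.exists_pendant {D W : Type*} [Finite D] {rot rev : Perm D}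
    (hplane : IsPlaneRotation rot rev) {src : D → W}
    (hsrc : ∀ a b, src a = src b ↔ rot.SameCycle a b) {w t : W} (htw : t ≠ w)
    (ht : ∀ d, src d ≠ t) :
    ∃ rot' : Perm (D ⊕ Bool), IsPlaneRotation rot' (Equiv.sumCongr rev Equiv.boolNot) ∧
      ∀ a b, Sum.elim src (fun c => if c then w else t) a =
        Sum.elim src (fun c => if c then w else t) b ↔ rot'.SameCycle a b := by
  classical
  set R : Perm (D ⊕ Bool) := Equiv.sumCongr rot 1
  have hll : ∀ a b, R.SameCycle (.inl a) (.inl b) ↔ src a = src b := fun a b => by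
    rw [hsrc]
    exact (IsFirstReturn.sameCycle_iff (σK := rot) Sum.inl_injective
      fun k => ⟨0, by simp [R], by omega⟩).symm
  have hrr : ∀ a b, R.SameCycle (.inr a) (.inr b) ↔ a = b := fun a b => by
    rw [← IsFirstReturn.sameCycle_iff (σK := (1 : Perm Bool)) Sum.inr_injective
      fun k => ⟨0, by simp [R], by omega⟩, sameCycle_one]
  have hlr : ∀ a b, ¬ R.SameCycle (.inl a) (.inr b) := fun a b h => by
    have := SameCycle.apply_eq (ℓ := Sum.isLeft) (fun a => by cases a <;> simp [R]) h
    simp at this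
  have hrl : ∀ a b, ¬ R.SameCycle (.inr a) (.inl b) := fun a b h => hlr b a h.symm
  have hg : doubleGenus R (Equiv.sumCongr rev Equiv.boolNot) = 0 := by
    rw [doubleGenus_sum (σK := rot) (τK := rev) (σN := 1) (τN := Equiv.boolNot)
      (ι := (Sum.inl : D → D ⊕ Bool)) (κ := (Sum.inr : Bool → D ⊕ Bool)) Sum.inl_injective
      Sum.inr_injective
      (by rintro (d | d) <;> simp) (by simp) (fun _ => rfl) (fun _ => rfl) (fun _ => rfl)
      (fun _ => rfl), isPlaneRotation_iff.1 hplane,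
      doubleGenus_one (by simp) (by simp), add_zero]
  by_cases hw : ∃ d, src d = w
  · obtain ⟨d, hd⟩ := hw
    have hnot : ¬ R.SameCycle (.inl d) (.inr true) := hlr _ _
    have hcomp : ¬ compSetoid R (Equiv.sumCongr rev Equiv.boolNot) (Sum.inl d) (Sum.inr true) :=
      not_compSetoid_of_disjoint (σK := rot) (τK := rev) Sum.inl_injective (fun _ => rfl)
        (fun _ => rfl) (by simp)
    refine ⟨swap (Sum.inl d) (Sum.inr true) * R, isPlaneRotation_iff.2 ?_, fun a b => ?_⟩
    · rw [doubleGenus_swap_mul_of_not_compSetoid hcomp, hg]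
    · have h1 : SameCycle.setoid (swap (Sum.inl d) (Sum.inr true) * R) =
          (SameCycle.setoid R).glue (.inl d) (.inr true) := by
        rw [← glue_sameCycle_swap_mul, Setoid.glue_eq_self]
        exact (sameCycle_swap_mul_iff (by simp)).2 hnot
      have h2 : (swap (Sum.inl d) (Sum.inr true) * R).SameCycle a b ↔
          (SameCycle.setoid R).glue (.inl d) (.inr true) a b := by
        rw [← h1]
        rfl
      have h4 : (SameCycle.setoid R).glue (.inl d) (.inr true) a b ↔
        R.SameCycle a b ∨ (R.SameCycle a (.inl d) ∧ R.SameCycle b (.inr true)) ∨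
          (R.SameCycle a (.inr true) ∧ R.SameCycle b (.inl d)) := Iff.rfl
      rw [h2, h4]
      rcases a with a | (_ | _) <;> rcases b with b | (_ | _) <;>
        simp [hll, hrr, hlr, hrl, hd, ht, htw, Ne.symm htw, (ht _).symm, eq_comm]
  · push Not at hw
    refine ⟨R, isPlaneRotation_iff.2 hg, fun a b => ?_⟩
    rcases a with a | (_ | _) <;> rcases b with b | (_ | _) <;>
      simp [hll, hrr, hlr, hrl, hw, ht, htw, Ne.symm htw, (ht _).symm, (hw _).symm]

/-! ### The simple graph of a plane multigraph -/

theorem SimpleGraph.isPlanar_of_isPlaneRotation {D W : Type*} [Finite D] {rot rev : Perm D}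
    (hplane : IsPlaneRotation rot rev) (hrev : ∀ d, rev (rev d) = d) (hne : ∀ d, rev d ≠ d)
    {src : D → W} (hsrc : ∀ a b, src a = src b ↔ rot.SameCycle a b) (Γ : SimpleGraph W)
    (hadj : ∀ u w, Γ.Adj u w → ∃ d, src d = u ∧ src (rev d) = w) : Γ.IsPlanar := by
  classical
  choose c hc hc' using fun δ : Γ.Dart => hadj _ _ δ.adj
  -- `P` selects one of the two darts of each edge. Only for that one the chosen representative `c`
  -- is used, and the opposite dart gets its reversal; otherwise two parallel edges could represent
  -- the two directions.
  let P : Γ.Dart → Prop := fun δ => δ.toProd = Quot.out δ.edge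
  have hP : ∀ δ : Γ.Dart, P δ.symm ↔ ¬ P δ := fun δ => by
    have h1 : s((Quot.out δ.edge).1, (Quot.out δ.edge).2) = s(δ.fst, δ.snd) := by
      change Quot.mk _ (Quot.out δ.edge) = δ.edge
      exact Quot.out_eq _
    have h2 := δ.adj.ne
    simp only [P, SimpleGraph.Dart.edge_symm, SimpleGraph.Dart.symm_toProd, Prod.ext_iff,
      Prod.fst_swap, Prod.snd_swap]
    rw [Sym2.eq_iff] at h1
    rcases h1 with ⟨h, h'⟩ | ⟨h, h'⟩
    · rw [h, h']
      simp [h2.symm]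
    · rw [h, h']
      simp [h2]
  let ι : Γ.Dart → D := fun δ => if P δ then c δ else rev (c δ.symm)
  have hι : ∀ δ, src (ι δ) = δ.fst := fun δ => by
    by_cases h : P δ
    · simp only [ι, h, if_true, hc]
    · simp only [ι, h, if_false, hc']
      rfl
  have hιrev : ∀ δ : Γ.Dart, ι δ.symm = rev (ι δ) := fun δ => by
    by_cases h : P δ
    · simp [ι, h, hP]
    · simp [ι, h, hP, hrev]
  have hinj : ι.Injective := fun δ δ' h => by
    refine SimpleGraph.Dart.ext _ _ (Prod.ext ?_ ?_)
    · rw [← hι, ← hι, h]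
    · change δ.symm.fst = δ'.symm.fst
      rw [← hι, ← hι, hιrev, hιrev, h]
  have := Finite.of_injective ι hinj
  obtain ⟨rotK, h1, h2⟩ := hplane.exists_restrict hrev hne hinj
    (revK := (SimpleGraph.Dart.symm_involutive (G := Γ)).toPerm) hιrev
  refine ⟨this, rotK, fun d d' => ?_, h1⟩
  rw [h2.sameCycle_iff hinj, ← hsrc, hι, hι]

/-! ### The index of an acyclic orientation -/

theorem Equiv.Perm.SameCycle.exists_descent {D : Type*} [Finite D] {σ : Perm D} {o : D → Prop}
    {d d' : D}
    (h : σ.SameCycle d d') (ho : o d' ↔ ¬ o d) : ∃ e, σ.SameCycle d e ∧ o e ∧ ¬ o (σ e) := by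
  by_contra! hcon
  have key : ∀ a b, σ.SameCycle d a → σ.SameCycle a b → o a → o b := by
    intro a b hda hab ha
    obtain ⟨n, rfl⟩ := hab.exists_nat_pow_eq
    clear hab
    induction n with
    | zero => exact ha
    | succ n ih =>
      rw [pow_succ', mul_apply]
      exact hcon _ (hda.trans ⟨n, by simp⟩) ih
  by_cases hd : o d
  · exact (ho.1 (key d d' (SameCycle.refl _ _) h hd)) hd
  · exact hd (key d' d h h.symm (ho.2 hd))

/-- In a plane digraph without a directed face boundary and with at most `k` vertices that are
sources or sinks, one meets at most `k - 1` times an arc of the one direction followed by an arc of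
the other direction when turning around a vertex. -/
theorem IsPlaneRotation.card_descents_lt {D V : Type*} [Finite D] {rot rev : Perm D}
    (hplane : IsPlaneRotation rot rev) (hrev : ∀ d, rev (rev d) = d) (hne : ∀ d, rev d ≠ d)
    {src : D → V} (hsrc : ∀ a b, src a = src b ↔ rot.SameCycle a b) {o : D → Prop}
    (ho : ∀ d, o (rev d) ↔ ¬ o d)
    (hface : ∀ d, ∃ d', (rot * rev).SameCycle d d' ∧ (o d' ↔ ¬ o d)) (B : Finset V)
    (hB : ∀ d, src d ∉ B → ∃ d', src d' = src d ∧ (o d' ↔ ¬ o d)) {x : V}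
    (hxD : ∃ d, src d = x) :
    {d | src d = x ∧ o d ∧ ¬ o (rot d)}.ncard < B.card := by
  classical
  have := Fintype.ofFinite D
  have := Fintype.ofFinite (Quotient (SameCycle.setoid rot))
  have := Fintype.ofFinite (Quotient (SameCycle.setoid (rot * rev)))
  obtain ⟨d₀, hd₀⟩ := hxD
  have hE := card_eq_two_mul_numCycles hrev hne
  have hout : (Finset.univ.filter fun d => ¬ o d).card = numCycles rev := by
    have h1 := Finset.card_filter_add_card_filter_not (s := (Finset.univ : Finset D)) (fun d => o d)
    have h2 : (Finset.univ.filter fun d => o d).card = (Finset.univ.filter fun d => ¬ o d).card :=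
      Finset.card_bij (fun d _ => rev d) (by simp [ho]) (by simp)
        (fun d hd => ⟨rev d, by simpa [ho] using hd, hrev d⟩)
    rw [Finset.card_univ, ← Nat.card_eq_fintype_card, hE] at h1
    omega
  have hout' : (Finset.univ.filter fun d => ¬ o (rot d)).card = numCycles rev := by
    rw [← hout]
    exact Finset.card_bij (fun d _ => rot d) (by simp) (by simp)
      (fun d hd => ⟨rot⁻¹ d, by simpa using hd, by simp⟩)
  -- There are as many darts `d` with `¬ o (rot d)` as edges. Those with `o d` are descents at
  -- vertices; for those with `¬ o d` there is a descent from `rev d` to `rot d` along a face. Every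
  -- face has one of the latter, every vertex outside `B` one of the former, and Euler's formula
  -- bounds what is left for `x`.
  have hsplit := Finset.card_filter_add_card_filter_not
    (s := Finset.univ.filter fun d => ¬ o (rot d)) (fun d => o d)
  rw [hout', Finset.filter_filter, Finset.filter_filter] at hsplit
  have hfaces : numCycles (rot * rev) ≤
      (Finset.univ.filter fun d => ¬ o (rot d) ∧ ¬ o d).card := by
    have h1 : ∀ q : Quotient (SameCycle.setoid (rot * rev)), ∃ e,
        (¬ o (rot e) ∧ ¬ o e) ∧ Quotient.mk _ (rev e) = q := by
      intro q
      induction q using Quotient.inductionOn with | _ d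
      obtain ⟨d', h, h'⟩ := hface d
      obtain ⟨e, he, he', he''⟩ := Equiv.Perm.SameCycle.exists_descent h h'
      refine ⟨rev e, ⟨he'', by simpa [ho] using he'⟩, ?_⟩
      rw [hrev]
      exact Quotient.sound (s := SameCycle.setoid (rot * rev)) he.symm
    choose f hf hf' using h1
    rw [numCycles, Nat.card_eq_fintype_card, ← Finset.card_univ]
    refine Finset.card_le_card_of_injOn f (by simpa using hf) fun a _ b _ h => ?_
    rw [← hf' a, ← hf' b, h]
  -- All descents at `x` are counted, and one at each other vertex outside `B`; the summand 1 makes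
  -- up for the vertex `x` itself.
  have hverts : numCycles rot + {d | src d = x ∧ o d ∧ ¬ o (rot d)}.ncard ≤
      (Finset.univ.filter fun d => ¬ o (rot d) ∧ o d).card + B.card + 1 := by
    set S := Finset.univ.filter fun d => ¬ o (rot d) ∧ o d
    set Q := Quotient (SameCycle.setoid rot)
    set srcQ : Q → V := Quotient.lift src fun a b h => (hsrc a b).2 h
    have hsrcQ : srcQ.Injective := by
      intro a b h
      induction a using Quotient.inductionOn with | _ a
      induction b using Quotient.inductionOn with | _ b
      exact Quotient.sound (s := SameCycle.setoid rot) ((hsrc a b).1 h)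
    have hBQ : (Finset.univ.filter fun q : Q => srcQ q ∈ B).card ≤ B.card :=
      Finset.card_le_card_of_injOn srcQ (by intro q; simp) hsrcQ.injOn
    obtain ⟨N, hN⟩ : ∃ N : Q → ℕ,
        ∀ q, N q = (S.filter fun d => (Quotient.mk _ d : Q) = q).card := ⟨_, fun _ => rfl⟩
    have hS : S.card = ∑ q : Q, N q := by
      simp only [hN]
      convert Finset.card_eq_sum_card_fiberwise (s := S) (t := (Finset.univ : Finset Q))
        (f := fun d => Quotient.mk _ d) (by simp)
    have hS' := Finset.sum_erase_add Finset.univ N (Finset.mem_univ (Quotient.mk _ d₀))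
    have hx' : {d | src d = x ∧ o d ∧ ¬ o (rot d)}.ncard =
        N (Quotient.mk _ d₀) := by
      rw [hN, ← Set.ncard_coe_finset]
      congr 1
      ext d
      have : (Quotient.mk _ d : Q) = Quotient.mk _ d₀ ↔ src d = x := by
        rw [← hd₀, hsrc]
        exact Quotient.eq (r := SameCycle.setoid rot)
      simp only [Set.mem_ofPred_eq, Finset.coe_filter, S, Finset.mem_filter, Finset.mem_univ,
        true_and, this]
      tauto
    have hge : ∀ q ∈ (Finset.univ : Finset Q).erase (Quotient.mk _ d₀),
        1 ≤ N q + if srcQ q ∈ B then 1 else 0 := by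
      intro q _
      split_ifs with hq
      · omega
      · rw [hN, add_zero, Nat.one_le_iff_ne_zero, ← Nat.pos_iff_ne_zero, Finset.card_pos]
        induction q using Quotient.inductionOn with | _ d
        obtain ⟨d', h, h'⟩ := hB d hq
        obtain ⟨e, he, he', he''⟩ := Equiv.Perm.SameCycle.exists_descent ((hsrc _ _).1 h.symm) h'
        exact ⟨e, by simpa [S, he', he''] using Quotient.sound (s := SameCycle.setoid rot) he.symm⟩
    have hsum := Finset.sum_le_sum hge
    rw [Finset.sum_const, smul_eq_mul, mul_one, Finset.card_erase_of_mem (Finset.mem_univ _),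
      Finset.card_univ, ← Nat.card_eq_fintype_card, Finset.sum_add_distrib] at hsum
    have hle : (∑ q ∈ (Finset.univ : Finset Q).erase (Quotient.mk _ d₀),
        if srcQ q ∈ B then 1 else 0) ≤ B.card := by
      refine le_trans ?_ hBQ
      rw [Finset.card_filter]
      exact Finset.sum_le_sum_of_subset (Finset.erase_subset _ _)
    rw [hx', hS, ← hS']
    change Nat.card Q + _ ≤ _
    omega
  -- A component contributes 2 in Euler's formula, against the summand 1 for `x`; this makes the
  -- bound strict.
  have hC : 1 ≤ numComp rot rev := by
    have : Nonempty (Quotient (compSetoid rot rev)) := ⟨Quotient.mk _ d₀⟩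
    exact Nat.card_pos
  rw [isPlaneRotation_iff] at hplane
  unfold doubleGenus at hplane
  omega

/-! ### Cuts -/

section NetOut

variable {V E : Type*} [Fintype E] (tail head : E → V)

/-- The net amount of `φ` that leaves the vertex set `A`. -/
noncomputable def netOut (φ : E → ℝ) (A : Set V) : ℝ :=
  ∑ e, φ e * (A.indicator 1 (tail e) - A.indicator 1 (head e))

theorem netOut_add (φ ψ : E → ℝ) (A : Set V) :
    netOut tail head (φ + ψ) A = netOut tail head φ A + netOut tail head ψ A := by
  simp [netOut, add_mul, Finset.sum_add_distrib]

theorem netOut_smul (c : ℝ) (φ : E → ℝ) (A : Set V) :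
    netOut tail head (c • φ) A = c * netOut tail head φ A := by
  simp [netOut, Finset.mul_sum, mul_assoc]

theorem netOut_single [DecidableEq E] (e : E) (c : ℝ) (A : Set V) :
    netOut tail head (Pi.single e c) A =
      c * (A.indicator 1 (tail e) - A.indicator 1 (head e)) := by
  rw [netOut, Finset.sum_eq_single e]
  · simp
  · intro b _ hb
    simp [hb]
  · simp

theorem netOut_union (φ : E → ℝ) {A B : Set V} (h : Disjoint A B) :
    netOut tail head φ (A ∪ B) = netOut tail head φ A + netOut tail head φ B := by
  have hu : ∀ v, (A ∪ B).indicator (1 : V → ℝ) v = A.indicator 1 v + B.indicator 1 v :=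
    congrFun (Set.indicator_union_of_disjoint h _)
  simp only [netOut, ← Finset.sum_add_distrib, hu]
  exact Finset.sum_congr rfl fun e _ => by ring

theorem netOut_eq_zero [Finite V] (φ : E → ℝ) (A : Set V)
    (h : ∀ v ∈ A, netOut tail head φ {v} = 0) : netOut tail head φ A = 0 := by
  induction A, A.toFinite using Set.Finite.induction_on with
  | empty => simp [netOut]
  | insert ha _ ih =>
    rw [Set.insert_eq, netOut_union _ _ _ (Set.disjoint_singleton_left.2 ha),
      h _ (Set.mem_insert _ _), ih fun v hv => h v (Set.mem_insert_of_mem _ hv), add_zero]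

theorem netOut_univ (φ : E → ℝ) : netOut tail head φ Set.univ = 0 := by simp [netOut]

open Classical in
theorem netOut_eq_sub (φ : E → ℝ) (A : Set V) :
    netOut tail head φ A = (∑ e, if tail e ∈ A then φ e else 0) -
      ∑ e, if head e ∈ A then φ e else 0 := by
  simp [netOut, mul_sub, Finset.sum_sub_distrib, Set.indicator_apply]

open Classical in
theorem netOut_eq_cut (φ : E → ℝ) (A : Set V) :
    netOut tail head φ A = (∑ e, if tail e ∈ A ∧ head e ∉ A then φ e else 0) -
      ∑ e, if tail e ∉ A ∧ head e ∈ A then φ e else 0 := by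
  rw [netOut, ← Finset.sum_sub_distrib]
  refine Finset.sum_congr rfl fun e _ => ?_
  by_cases h : tail e ∈ A <;> by_cases h' : head e ∈ A <;> simp [h, h']

end NetOut

/-! ### Augmenting paths, cuts and flow values -/

namespace FlowNetwork

variable {V E : Type*} {N : FlowNetwork V E}

/-- A walk along arcs of positive capacity from a source is part of an augmenting path once it
reaches a sink. -/
theorem exists_isAugmentingPath_of_reachable {u v : V}
    (h : Relation.TransGen (fun u w => ∃ e, N.tail e = u ∧ N.head e = w ∧ 0 < N.cap e) u v)
    (hu : u ∈ N.source) (hv : v ∈ N.sink) : ∃ p, N.IsAugmentingPath p := by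
  suffices ∃ p : List E, p.IsChain (fun e e' => N.head e = N.tail e') ∧ (∀ e ∈ p, 0 < N.cap e) ∧
      (∃ e, p.head? = some e ∧ N.tail e = u) ∧ ∃ e, p.getLast? = some e ∧ N.head e = v by
    obtain ⟨p, h1, h2, ⟨e, h3, rfl⟩, ⟨e', h4, rfl⟩⟩ := this
    exact ⟨p, h1, h2, ⟨e, h3, hu⟩, ⟨e', h4, hv⟩⟩
  clear hu hv
  induction h with
  | single h =>
    obtain ⟨e, h1, h2, h3⟩ := h
    exact ⟨[e], by simp, by simpa using h3, ⟨e, by simp, h1⟩, ⟨e, by simp, h2⟩⟩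
  | tail _ h ih =>
    obtain ⟨p, h1, h2, ⟨e, h3, h4⟩, ⟨e', h5, h6⟩⟩ := ih
    obtain ⟨e'', k1, k2, k3⟩ := h
    refine ⟨p ++ [e''], ?_, ?_, ⟨e, by simp [List.head?_append, h3], h4⟩, ⟨e'', by simp, k2⟩⟩
    · refine List.isChain_append.2 ⟨h1, by simp, ?_⟩
      simp [h5, h6, k1]
    · intro a ha
      rcases List.mem_append.1 ha with ha | ha
      · exact h2 a ha
      · rw [List.mem_singleton.1 ha]
        exact k3

/-- An augmenting path leaves every vertex set that contains the sources but no sink. -/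
theorem IsAugmentingPath.exists_leaving {p : List E}
    (hp : N.IsAugmentingPath p) {A : Set V} (hA : N.source ⊆ A) (hA' : ∀ v ∈ A, v ∉ N.sink) :
    ∃ e ∈ p, N.tail e ∈ A ∧ N.head e ∉ A := by
  obtain ⟨h1, -, ⟨e, he, he'⟩, ⟨e', k, k'⟩⟩ := hp
  by_contra! hcon
  replace he' := hA he'
  induction p generalizing e with
  | nil => simp at he
  | cons a p ih =>
    obtain rfl : a = e := by simpa using he
    have ha := hcon a (by simp) he'
    rcases p with _ | ⟨b, p⟩
    · obtain rfl : a = e' := by simpa using k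
      exact hA' _ ha k'
    · rw [List.isChain_cons_cons] at h1
      refine ih h1.2 b (by simp) (by simpa using k) (fun e he => hcon e (by simp [he])) ?_
      rwa [← h1.1]

variable [Fintype E]

open Classical in
theorem coe_finsum_mem (f : E → ℝ≥0) (S : Set E) :
    ((∑ᶠ e ∈ S, f e : ℝ≥0) : ℝ) = ∑ e, if e ∈ S then (f e : ℝ) else 0 := by
  rw [finsum_mem_def, finsum_eq_sum_of_fintype, NNReal.coe_sum]
  refine Finset.sum_congr rfl fun e _ => ?_
  by_cases h : e ∈ S <;> simp [h]

theorem netOut_singleton (f : E → ℝ≥0) (v : V) :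
    netOut N.tail N.head (fun e => (f e : ℝ)) {v} = N.outflow f v - N.inflow f v := by
  rw [outflow, inflow, coe_finsum_mem, coe_finsum_mem, netOut_eq_sub]
  rfl

theorem isFeasibleFlow_iff {f : E → ℝ≥0} : N.IsFeasibleFlow f ↔
    (∀ v, v ∉ N.source → v ∉ N.sink → netOut N.tail N.head (fun e => (f e : ℝ)) {v} = 0) ∧
      ∀ e, (f e : ℝ≥0∞) ≤ N.cap e := by
  simp only [netOut_singleton, sub_eq_zero, NNReal.coe_inj]
  exact ⟨fun h => ⟨fun v h1 h2 => (h.1 v h1 h2).symm, h.2⟩,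
    fun h => ⟨fun v h1 h2 => (h.1 v h1 h2).symm, h.2⟩⟩

/-- By conservation the vertices of `A` that are not sources contribute nothing, and since no arc
enters a source, the net outflow of the sources is the value. -/
theorem value_eq_netOut [Finite V] {f : E → ℝ≥0} (hf : N.IsFeasibleFlow f)
    (hsource : ∀ e, N.head e ∉ N.source) {A : Set V} (hA : N.source ⊆ A)
    (hA' : ∀ v ∈ A, v ∉ N.sink) :
    (N.value f : ℝ) = netOut N.tail N.head (fun e => (f e : ℝ)) A := by
  rw [← Set.union_sdiff_cancel hA, netOut_union _ _ _ Set.disjoint_sdiff_right,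
    netOut_eq_zero _ _ _ (A \ N.source) fun v hv =>
      (isFeasibleFlow_iff.1 hf).1 v hv.2 (hA' v hv.1),
    add_zero, netOut_eq_sub, value, coe_finsum_mem]
  simp [hsource]

/-- A flow that saturates a cut has maximum value. -/
theorem value_le_of_saturated [Finite V] {f g : E → ℝ≥0} (hf : N.IsFeasibleFlow f)
    (hg : N.IsFeasibleFlow g) (hsource : ∀ e, N.head e ∉ N.source) {A : Set V}
    (hA : N.source ⊆ A) (hA' : ∀ v ∈ A, v ∉ N.sink)
    (hout : ∀ e, N.tail e ∈ A → N.head e ∉ A → N.cap e ≤ f e)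
    (hin : ∀ e, N.tail e ∉ A → N.head e ∈ A → f e = 0) : N.value g ≤ N.value f := by
  classical
  rw [← NNReal.coe_le_coe, value_eq_netOut hf hsource hA hA', value_eq_netOut hg hsource hA hA',
    netOut_eq_cut, netOut_eq_cut]
  refine sub_le_sub (Finset.sum_le_sum fun e _ => ?_) (Finset.sum_le_sum fun e _ => ?_)
  · split_ifs with h
    · exact_mod_cast (hg.2 e).trans (hout e h.1 h.2)
    · exact le_rfl
  · split_ifs with h
    · rw [hin e h.1 h.2]
      positivity
    · exact le_rfl

/-- A network with a flow of positive value has an augmenting path. -/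
theorem exists_isAugmentingPath_of_value_pos [Finite V] {f : E → ℝ≥0} (hf : N.IsFeasibleFlow f)
    (hsource : ∀ e, N.head e ∉ N.source) (hdisj : Disjoint N.source N.sink)
    (hpos : 0 < N.value f) : ∃ p, N.IsAugmentingPath p := by
  classical
  by_contra hno
  -- Every arc that leaves the set reached from the sources has capacity 0, so the net outflow of
  -- this set is not positive.
  let A : Set V := {v | ∃ u ∈ N.source, Relation.ReflTransGen
    (fun u w => ∃ e, N.tail e = u ∧ N.head e = w ∧ 0 < N.cap e) u v}
  have h := value_eq_netOut hf hsource (A := A) (fun v hv => ⟨v, hv, .refl⟩) ?_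
  · rw [netOut_eq_cut] at h
    have h1 : (∑ e, if N.tail e ∈ A ∧ N.head e ∉ A then (f e : ℝ) else 0) = 0 := by
      refine Finset.sum_eq_zero fun e _ => ?_
      split_ifs with he
      · obtain ⟨⟨u, hu, hur⟩, he'⟩ := he
        have h0 : N.cap e = 0 := by
          by_contra h0
          exact he' ⟨u, hu, hur.tail ⟨e, rfl, rfl, pos_iff_ne_zero.2 h0⟩⟩
        have := hf.2 e
        rw [h0] at this
        simpa using this
      · rfl
    have h2 : 0 ≤ ∑ e, if N.tail e ∉ A ∧ N.head e ∈ A then (f e : ℝ) else 0 :=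
      Finset.sum_nonneg fun e _ => by split_ifs <;> positivity
    have h3 : (0 : ℝ) < N.value f := hpos
    linarith
  · rintro v ⟨u, hu, huv⟩ hv
    rcases Relation.reflTransGen_iff_eq_or_transGen.1 huv with rfl | huv
    · exact Set.disjoint_left.1 hdisj hu hv
    · exact hno (exists_isAugmentingPath_of_reachable huv hu hv)

theorem isFeasibleFlow_smul {f : E → ℝ≥0} (hf : N.IsFeasibleFlow f) {c : ℝ≥0} (hc : c ≤ 1) :
    N.IsFeasibleFlow (fun e => c * f e) ∧ N.value (fun e => c * f e) = c * N.value f := by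
  classical
  refine ⟨isFeasibleFlow_iff.2 ⟨fun v h1 h2 => ?_, fun e => ?_⟩, ?_⟩
  · have := netOut_smul N.tail N.head c (fun e => (f e : ℝ)) {v}
    rw [(isFeasibleFlow_iff.1 hf).1 v h1 h2, mul_zero] at this
    simpa [Pi.smul_def] using this
  · refine le_trans ?_ (hf.2 e)
    exact_mod_cast mul_le_of_le_one_left (zero_le) hc
  · rw [← NNReal.coe_inj, NNReal.coe_mul, value, value, coe_finsum_mem, coe_finsum_mem,
      Finset.mul_sum]
    exact Finset.sum_congr rfl fun e _ => by split_ifs <;> simp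

theorem sum_subtype_notMem {P : Set E} [Fintype {e // e ∉ P}] {f : E → ℝ}
    (hf : ∀ e ∈ P, f e = 0) : ∑ e : {e // e ∉ P}, f e.1 = ∑ e, f e := by
  classical
  rw [← Finset.sum_subtype (Finset.univ.filter fun e => e ∉ P) (by simp) f]
  exact Finset.sum_filter_of_ne fun e _ he h => he (hf e h)

theorem isFeasibleFlow_deleteArcs_iff {P : Set E} {f : E → ℝ≥0} (hf : ∀ e ∈ P, f e = 0) :
    (N.deleteArcs P).IsFeasibleFlow (fun e => f e.1) ↔ N.IsFeasibleFlow f := by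
  classical
  have := Fintype.ofFinite {e // e ∉ P}
  rw [isFeasibleFlow_iff, isFeasibleFlow_iff]
  refine and_congr ?_ ⟨fun h e => ?_, fun h e => h e.1⟩
  · refine forall_congr' fun v => forall₂_congr fun _ _ => ?_
    rw [netOut, netOut, ← sum_subtype_notMem (P := P)]
    · rfl
    · intro e he
      simp [hf e he]
  · by_cases he : e ∈ P
    · simp [hf e he]
    · exact h ⟨e, he⟩

theorem value_deleteArcs {P : Set E} {f : E → ℝ≥0} (hf : ∀ e ∈ P, f e = 0) :
    (N.deleteArcs P).value (fun e => f e.1) = N.value f := by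
  classical
  have := Fintype.ofFinite {e // e ∉ P}
  rw [← NNReal.coe_inj, value, value, coe_finsum_mem, coe_finsum_mem,
    ← sum_subtype_notMem (P := P)]
  · rfl
  · intro e he
    simp [hf e he]

end FlowNetwork

/-! ### Optimal points of polyhedra -/

-- A short step stays in the box if its direction respects the constraints that are active at `φ`;
-- there are only finitely many coordinates.
open Filter Topology in
theorem eventually_add_smul_mem_box {E : Type*} [Finite E] {l : E → ℝ} {u : E → ℝ≥0∞}
    {φ h : E → ℝ} (hl : ∀ e, l e ≤ φ e) (hu : ∀ e, ENNReal.ofReal (φ e) ≤ u e)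
    (hneg : ∀ e, h e < 0 → l e < φ e) (hpos : ∀ e, 0 < h e → ENNReal.ofReal (φ e) < u e) :
    ∀ᶠ ε : ℝ in 𝓝[>] 0, ∀ e, l e ≤ φ e + ε * h e ∧ ENNReal.ofReal (φ e + ε * h e) ≤ u e := by
  rw [Filter.eventually_all]
  intro e
  have hcont : Tendsto (fun ε : ℝ => φ e + ε * h e) (𝓝[>] 0) (𝓝 (φ e)) := by
    have : Continuous fun ε : ℝ => φ e + ε * h e := by fun_prop
    simpa using (this.tendsto 0).mono_left nhdsWithin_le_nhds
  have hpos' : ∀ᶠ ε : ℝ in 𝓝[>] 0, 0 < ε := eventually_mem_nhdsWithin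
  rcases lt_trichotomy (h e) 0 with he | he | he
  · filter_upwards [hcont.eventually (lt_mem_nhds (hneg e he)), hpos'] with ε h1 h2
    refine ⟨h1.le, le_trans (ENNReal.ofReal_le_ofReal ?_) (hu e)⟩
    nlinarith
  · filter_upwards with ε
    simpa [he] using ⟨hl e, hu e⟩
  · have := (ENNReal.continuous_ofReal.tendsto (φ e)).comp hcont
    filter_upwards [this.eventually (gt_mem_nhds (hpos e he)), hpos'] with ε h1 h2
    refine ⟨le_trans (hl e) ?_, h1.le⟩
    nlinarith

/-- In a nonempty polyhedron of nonnegative vectors, some point is lexicographically optimal with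
respect to a nonnegative linear functional and the sum of the coordinates. -/
theorem exists_lexicographic_min {E : Type*} [Fintype E] (P : Submodule ℝ (E → ℝ)) {l : E → ℝ}
    {u : E → ℝ≥0∞} {F : E → ℝ} (hl0 : ∀ e, 0 ≤ l e) (hFl : ∀ e, l e ≤ F e)
    (hFu : ∀ e, ENNReal.ofReal (F e) ≤ u e) {a : E → ℝ} (ha : ∀ e, 0 ≤ a e) :
    ∃ φ : E → ℝ, (∀ e, l e ≤ φ e) ∧ (∀ e, ENNReal.ofReal (φ e) ≤ u e) ∧ φ - F ∈ P ∧
      ∀ h ∈ P, (∀ e, h e < 0 → l e < φ e) → (∀ e, 0 < h e → ENNReal.ofReal (φ e) < u e) →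
        0 ≤ ∑ e, a e * h e ∧ (∑ e, a e * h e = 0 → 0 ≤ ∑ e, h e) := by
  classical
  -- There are finitely many patterns of admissible signs. For each one that allows the functional
  -- `a` to decrease, one such direction is fixed, with a weight that makes the weighted functional
  -- plus the coordinate sum decrease too. With a common bound `W` of these weights, the
  -- lexicographic problem becomes the minimisation of `Ψ`.
  let dirs : Set E × Set E → Set (E → ℝ) := fun p =>
    {h | h ∈ P ∧ (∀ e, h e < 0 → e ∈ p.1) ∧ (∀ e, 0 < h e → e ∈ p.2) ∧ ∑ e, a e * h e < 0}
  have hw : ∀ p, ∃ w : ℝ, (dirs p).Nonempty →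
      ∃ h ∈ dirs p, ∑ e, h e + w * ∑ e, a e * h e < 0 := by
    intro p
    by_cases hp : (dirs p).Nonempty
    · obtain ⟨h, hh⟩ := hp
      have hneg := hh.2.2.2
      refine ⟨(∑ e, h e + 1) / (-∑ e, a e * h e), fun _ => ⟨h, hh, ?_⟩⟩
      have : (∑ e, h e + 1) / (-∑ e, a e * h e) * ∑ e, a e * h e = -(∑ e, h e + 1) := by
        rw [div_neg, neg_mul, div_mul_cancel₀ _ hneg.ne]
      linarith
    · exact ⟨0, fun h => absurd h hp⟩
  choose w hw using hw
  obtain ⟨W₀, hW₀⟩ := Finite.bddAbove_range w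
  have hW₀' : ∀ p, w p ≤ W₀ := fun p => hW₀ ⟨p, rfl⟩
  set W := max W₀ 0
  have hW0 : 0 ≤ W := le_max_right _ _
  let Ψ : (E → ℝ) → ℝ := fun φ => ∑ e, φ e + W * ∑ e, a e * φ e
  have hΨ : Continuous Ψ := by fun_prop
  let K : Set (E → ℝ) := {φ | (∀ e, l e ≤ φ e) ∧ (∀ e, ENNReal.ofReal (φ e) ≤ u e) ∧ φ - F ∈ P}
  have hK : IsClosed K := by
    have h1 : IsClosed {φ : E → ℝ | ∀ e, l e ≤ φ e} := by
      simp only [Set.ofPred_forall]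
      exact isClosed_iInter fun e => isClosed_le continuous_const (continuous_apply e)
    have h2 : IsClosed {φ : E → ℝ | ∀ e, ENNReal.ofReal (φ e) ≤ u e} := by
      simp only [Set.ofPred_forall]
      exact isClosed_iInter fun e => isClosed_le
        (ENNReal.continuous_ofReal.comp (continuous_apply e)) continuous_const
    have h3 : IsClosed {φ : E → ℝ | φ - F ∈ P} :=
      P.closed_of_finiteDimensional.preimage (continuous_id.sub continuous_const)
    exact h1.inter (h2.inter h3)
  have hFK : F ∈ K := ⟨hFl, hFu, by simp⟩
  -- On nonnegative vectors `Ψ` dominates each coordinate, because `W` was made nonnegative; so the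
  -- sublevel set is bounded although `u` may be infinite.
  have hcompact : IsCompact (K ∩ {φ | Ψ φ ≤ Ψ F}) := by
    refine IsCompact.of_isClosed_subset (isCompact_univ_pi fun _ : E => isCompact_Icc (a := 0)
      (b := Ψ F)) (hK.inter (isClosed_le hΨ continuous_const)) ?_
    rintro φ ⟨⟨h1, -, -⟩, h2⟩ e -
    have h0 : ∀ e, 0 ≤ φ e := fun e => (hl0 e).trans (h1 e)
    refine ⟨h0 e, le_trans ?_ h2⟩
    have h3 : φ e ≤ ∑ e, φ e := Finset.single_le_sum (fun e _ => h0 e) (Finset.mem_univ e)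
    have h4 : 0 ≤ W * ∑ e, a e * φ e :=
      mul_nonneg hW0 (Finset.sum_nonneg fun e _ => mul_nonneg (ha e) (h0 e))
    exact h3.trans (le_add_of_nonneg_right h4)
  obtain ⟨φ, ⟨hφK, hφΨ⟩, hmin⟩ := hcompact.exists_isMinOn ⟨F, hFK, le_refl (Ψ F)⟩ hΨ.continuousOn
  obtain ⟨h1, h2, h3⟩ := hφK
  have hopt : ∀ h ∈ P, (∀ e, h e < 0 → l e < φ e) → (∀ e, 0 < h e → ENNReal.ofReal (φ e) < u e) →
      0 ≤ ∑ e, h e + W * ∑ e, a e * h e := by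
    intro h hP hneg hpos
    obtain ⟨ε, hε, hε0⟩ := ((eventually_add_smul_mem_box h1 h2 hneg hpos).and
      eventually_mem_nhdsWithin).exists
    have hε0 : 0 < ε := hε0
    have hlin : Ψ (φ + ε • h) = Ψ φ + ε * (∑ e, h e + W * ∑ e, a e * h e) := by
      simp only [Ψ, Pi.add_apply, Pi.smul_apply, smul_eq_mul, mul_add, Finset.sum_add_distrib,
        Finset.mul_sum]
      have : ∀ e, W * (a e * (ε * h e)) = ε * (W * (a e * h e)) := fun e => by ring
      simp only [this]
      ring
    have hmem : φ + ε • h ∈ K := by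
      refine ⟨fun e => (hε e).1, fun e => (hε e).2, ?_⟩
      rw [add_sub_right_comm]
      exact P.add_mem h3 (P.smul_mem ε hP)
    by_contra! hcon
    have hlt : Ψ (φ + ε • h) < Ψ φ := by
      rw [hlin]
      have := mul_neg_of_pos_of_neg hε0 hcon
      linarith
    have := hmin ⟨hmem, hlt.le.trans hφΨ⟩
    exact absurd hlt (not_lt.2 this)
  refine ⟨φ, h1, h2, h3, fun h hP hneg hpos => ?_⟩
  have h4 : 0 ≤ ∑ e, a e * h e := by
    by_contra! hcon
    -- The direction fixed for the pattern of inactive constraints at `φ` would decrease `Ψ`, since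
    -- replacing its weight by the larger `W` only helps.
    obtain ⟨k, ⟨k1, k2, k3, k4⟩, k5⟩ := hw ({e | l e < φ e}, {e | ENNReal.ofReal (φ e) < u e})
      ⟨h, hP, hneg, hpos, hcon⟩
    have h5 := hopt k k1 k2 k3
    have h6 : W * ∑ e, a e * k e ≤ w ({e | l e < φ e}, {e | ENNReal.ofReal (φ e) < u e}) *
        ∑ e, a e * k e :=
      mul_le_mul_of_nonpos_right ((hW₀' _).trans (le_max_left _ _)) k4.le
    linarith
  refine ⟨h4, fun h0 => ?_⟩
  have h5 := hopt h hP hneg hpos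
  rwa [h0, mul_zero, add_zero] at h5

/-! ### Separating the arcs into a vertex from those out of it -/

/-- If `n + 1` is the order of the face permutation, this closes a face boundary of uniform
direction to a directed closed walk. -/
theorem transGen_pow {D V : Type*} {σ : Perm D} {r : V → V → Prop} {v : D → V} {d : D}
    (h : ∀ d', σ.SameCycle d d' → r (v d') (v (σ d'))) (n : ℕ) :
    Relation.TransGen r (v d) (v ((σ ^ (n + 1)) d)) := by
  induction n with
  | zero => simpa using Relation.TransGen.single (h d (SameCycle.refl _ _))
  | succ n ih =>
    refine ih.tail ?_
    rw [pow_succ' _ (n + 1), mul_apply]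
    exact h _ ⟨(n + 1 : ℕ), by rw [zpow_natCast]⟩

/-- In an acyclic plane digraph whose sources and sinks are in `B`, fewer than `#B` intervals of
darts at `x` contain all the darts of arcs into `x` and none of an arc out of `x`. -/
theorem IsPlaneRotation.exists_separator {D V : Type*} [Finite D] {rot rev : Perm D}
    (hplane : IsPlaneRotation rot rev) (hrev : ∀ d, rev (rev d) = d) (hne : ∀ d, rev d ≠ d)
    {src : D → V} (hsrc : ∀ a b, src a = src b ↔ rot.SameCycle a b) {pos : D → Prop}
    (hacyclic : ∀ v, ¬ Relation.TransGen
      (fun u w => ∃ d, src d = u ∧ src (rev d) = w ∧ pos d) v v) (B : Finset V)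
    (hB : ∀ v ∉ B, (∃ d, src d = v ∧ pos d) ↔ ∃ d, src d = v ∧ pos (rev d)) {x : V}
    (hx : ∃ d, src d = x ∧ pos (rev d)) :
    ∃ I : Set D, (∀ d ∈ I, src d = x) ∧ (∀ d, src d = x → pos (rev d) → d ∈ I) ∧
      (∀ d, src d = x → pos d → d ∉ I) ∧ {d | d ∈ I ∧ rot d ∉ I}.ncard < B.card := by
  classical
  -- Only the edges with flow are kept. The index bound is applied to `o` being flow towards the
  -- initial vertex of the dart.
  let K := {d : D // pos d ∨ pos (rev d)}
  let revK : Perm K := rev.subtypePerm fun d => by rw [hrev, or_comm]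
  have hrevK : ∀ k : K, ((revK k : K) : D) = rev k.1 := fun k => rfl
  obtain ⟨rotK, hplaneK, hret⟩ := hplane.exists_restrict hrev hne
    (ι := (Subtype.val : K → D)) Subtype.val_injective hrevK
  have hnot : ∀ d, pos d → ¬ pos (rev d) := fun d h h' =>
    hacyclic (src d) (.tail (.single ⟨d, rfl, rfl, h⟩) ⟨rev d, rfl, by rw [hrev], h'⟩)
  have hsrcK : ∀ a b : K, src a.1 = src b.1 ↔ rotK.SameCycle a b := fun a b => by
    rw [hret.sameCycle_iff Subtype.val_injective, hsrc]
  have hsrc_rotK : ∀ k, src (rotK k).1 = src k.1 := fun k =>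
    (hsrcK _ _).2 (sameCycle_apply_self rotK k).symm
  have hposK : ∀ k : K, ¬ pos (rev k.1) → pos k.1 := fun k h => k.2.resolve_right h
  have hlt := hplaneK.card_descents_lt (fun k => Subtype.ext (hrev k.1))
    (fun k h => hne k.1 (congrArg Subtype.val h)) hsrcK (o := fun k => pos (rev k.1))
    (fun k => ⟨fun h h' => hnot _ h' h, fun h => by
      rw [hrevK, hrev]
      exact hposK k h⟩) ?_ B ?_ (x := x) ?_
  -- `I` consists of the darts at `x` from which, clockwise and starting with the dart itself, the
  -- first edge with flow carries it into `x`. Such a set can only be left at an incoming dart whose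
  -- successor in `K` is outgoing, that is, at a descent.
  · refine ⟨{d | src d = x ∧ ∃ n, (∃ k : K, (rot ^ n) d = k.1 ∧ pos (rev k.1)) ∧
      ∀ i < n, ∀ k : K, (rot ^ i) d ≠ k.1}, fun d hd => hd.1, fun d hd hd' => ?_,
      fun d hd hd' hI => ?_, lt_of_le_of_lt ?_ hlt⟩
    · exact ⟨hd, 0, ⟨⟨d, Or.inr hd'⟩, rfl, hd'⟩, by simp⟩
    · obtain ⟨-, n, ⟨k, hk, hk'⟩, hn⟩ := hI
      rcases Nat.eq_zero_or_pos n with rfl | h0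
      · rw [← hk] at hk'
        exact hnot d hd' hk'
      · exact hn 0 h0 ⟨d, Or.inl hd'⟩ rfl
    · rw [← Set.ncard_image_of_injective _
        (Subtype.val_injective : (Subtype.val : K → D).Injective)]
      refine Set.ncard_le_ncard ?_ (Set.toFinite _)
      rintro d ⟨⟨hd, n, ⟨k, hk, hk'⟩, hn⟩, hd'⟩
      have hdx : src (rot d) = x := by
        rw [← hd]
        exact (hsrc _ _).2 (sameCycle_apply_self rot d).symm
      rcases n with _ | n
      · obtain rfl : d = k.1 := hk
        refine ⟨k, ⟨hd, hk', fun h => hd' ⟨hdx, ?_⟩⟩, rfl⟩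
        obtain ⟨m, hm, hm'⟩ := hret k
        refine ⟨m, ⟨rotK k, ?_, h⟩, fun i hi l hl => hm' (i + 1) (by omega) (by omega) l ?_⟩
        · rw [hm, pow_succ, mul_apply]
        · rw [← hl, pow_succ, mul_apply]
      · refine absurd ⟨hdx, n, ⟨k, ?_, hk'⟩, fun i hi l hl => hn (i + 1) (by omega) l ?_⟩ hd'
        · rw [← hk, pow_succ, mul_apply]
        · rw [← hl, pow_succ, mul_apply]
  -- A face on which the direction never changes would be a directed closed walk, followed backwards
  -- if `pos (rev k)` holds.
  · intro k
    by_contra! hcon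
    have hsame : ∀ l, (rotK * revK).SameCycle k l → (pos (rev l.1) ↔ pos (rev k.1)) :=
      fun l hl => by
        have := hcon l hl
        tauto
    have hn := pow_orderOf_eq_one (rotK * revK)
    have hn0 := orderOf_pos (rotK * revK)
    obtain ⟨n, hn'⟩ : ∃ n, orderOf (rotK * revK) = n + 1 := ⟨_, (Nat.sub_add_cancel hn0).symm⟩
    rw [hn'] at hn
    by_cases hk : pos (rev k.1)
    · refine hacyclic (src k.1) ?_
      have := transGen_pow (σ := rotK * revK) (v := fun k : K => src k.1) (d := k)
        (r := Function.swap fun u w => ∃ d, src d = u ∧ src (rev d) = w ∧ pos d)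
        (fun l hl => ⟨rev l.1, by rw [mul_apply, hsrc_rotK, hrevK], by rw [hrev],
          (hsame l hl).2 hk⟩) n
      rw [hn] at this
      exact Relation.transGen_swap.1 this
    · refine hacyclic (src k.1) ?_
      have := transGen_pow (σ := rotK * revK) (v := fun k : K => src k.1) (d := k)
        (r := fun u w => ∃ d, src d = u ∧ src (rev d) = w ∧ pos d)
        (fun l hl => ⟨l.1, rfl, by rw [mul_apply, hsrc_rotK, hrevK],
          hposK l (fun h => hk ((hsame l hl).1 h))⟩) n
      rw [hn] at this
      exact this
  · intro k hk
    by_cases h : pos (rev k.1)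
    · obtain ⟨d, hd, hd'⟩ := (hB _ hk).2 ⟨k.1, rfl, h⟩
      exact ⟨⟨d, Or.inl hd'⟩, hd, by simp [h, hnot d hd']⟩
    · obtain ⟨d, hd, hd'⟩ := (hB _ hk).1 ⟨k.1, rfl, hposK k h⟩
      exact ⟨⟨d, Or.inr hd'⟩, hd, by simp [h, hd']⟩
  · obtain ⟨d, hd, hd'⟩ := hx
    exact ⟨⟨d, Or.inr hd'⟩, hd⟩

/-- The number of elements of `I` that a permutation maps out of `I` is submodular. -/
theorem ncard_exits_submodular {D : Type*} [Finite D] (σ : Perm D) (I J : Set D) :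
    {d | d ∈ I ∩ J ∧ σ d ∉ I ∩ J}.ncard + {d | d ∈ I ∪ J ∧ σ d ∉ I ∪ J}.ncard ≤
      {d | d ∈ I ∧ σ d ∉ I}.ncard + {d | d ∈ J ∧ σ d ∉ J}.ncard := by
  rw [← Set.ncard_union_add_ncard_inter, ← Set.ncard_union_add_ncard_inter {d | d ∈ I ∧ σ d ∉ I}]
  refine add_le_add (Set.ncard_le_ncard ?_ (Set.toFinite _))
    (Set.ncard_le_ncard ?_ (Set.toFinite _))
  · rintro d (⟨h, h'⟩ | ⟨h, h'⟩) <;> simp only [Set.mem_inter_iff, Set.mem_union] at h h' <;>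
      simp only [Set.mem_union, Set.mem_ofPred_eq] <;> tauto
  · rintro d ⟨⟨h, h'⟩, ⟨k, k'⟩⟩
    simp only [Set.mem_inter_iff, Set.mem_union] at h h' k k'
    simp only [Set.mem_inter_iff, Set.mem_ofPred_eq]
    tauto

/-- `I` and its preimage have the same size, hence also what each has outside the other: the
intervals of `I` have as many beginnings as ends. -/
theorem ncard_entries {D : Type*} [Finite D] (σ : Perm D) (I : Set D) :
    {d | d ∉ I ∧ σ d ∈ I}.ncard = {d | d ∈ I ∧ σ d ∉ I}.ncard := by
  have h1 : (σ ⁻¹' I).ncard = I.ncard :=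
    Set.ncard_preimage_of_injective_subset_range σ.injective (by simp)
  have h2 := Set.ncard_inter_add_ncard_sdiff_eq_ncard (σ ⁻¹' I) I
  have h3 := Set.ncard_inter_add_ncard_sdiff_eq_ncard I (σ ⁻¹' I)
  rw [Set.inter_comm] at h3
  have h4 : σ ⁻¹' I \ I = {d | d ∉ I ∧ σ d ∈ I} := by ext; simp [and_comm]
  have h5 : I \ σ ⁻¹' I = {d | d ∈ I ∧ σ d ∉ I} := rfl
  rw [← h4, ← h5]
  omega

namespace PlaneNetwork

variable {V D : Type*} (G : PlaneNetwork V D)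

/-! ### Vertices and arcs of `G°` -/

theorem attach_of_eq_top {d : D} (h : G.vcap (G.src d) = ⊤) :
    G.attach d = .plain ⟨G.src d, h⟩ := dif_pos h

theorem attach_of_ne_top {d : D} (h : G.vcap (G.src d) ≠ ⊤) : G.attach d = .cyc ⟨d, h⟩ :=
  dif_neg h

@[simp] theorem extRev_extRev (e : G.ExtArc) : G.extRev (G.extRev e) = e := by
  cases e <;> simp [extRev, G.rev_rev]

/-- The reversal of arcs of `G°` as a permutation. -/
def extRevPerm : Perm G.ExtArc := ⟨G.extRev, G.extRev, G.extRev_extRev, G.extRev_extRev⟩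

/-- The terminal vertex of an arc of `G°`. -/
noncomputable def extHead (e : G.ExtArc) : G.ExtVertex := G.extTail (G.extRev e)

@[simp] theorem extHead_extRev (e : G.ExtArc) : G.extHead (G.extRev e) = G.extTail e := by
  rw [extHead, extRev_extRev]

/-- The arcs of `G°` by kind. -/
def extArcEquiv : G.ExtArc ≃ (D ⊕ ({d : D // G.vcap (G.src d) ≠ ⊤} × Bool)) ⊕
    (({v : V // v ∈ G.S} × Bool) ⊕ ({v : V // v ∈ G.T} × Bool)) where
  toFun
    | .old d => .inl (.inl d)
    | .cyc d b => .inl (.inr (d, b))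
    | .super v b => .inr (.inl (v, b))
    | .toSink v b => .inr (.inr (v, b))
  invFun
    | .inl (.inl d) => .old d
    | .inl (.inr (d, b)) => .cyc d b
    | .inr (.inl (v, b)) => .super v b
    | .inr (.inr (v, b)) => .toSink v b
  left_inv e := by cases e <;> rfl
  right_inv e := by rcases e with (_ | _) | (_ | _) <;> rfl

instance [Finite D] : Finite G.ExtArc := Finite.of_equiv _ G.extArcEquiv.symm

instance [Finite V] [Finite D] : Finite G.ExtVertex :=
  Finite.of_injective (β := Option (Bool ⊕ (V ⊕ D)))
    (fun p => match p with
      | .s => none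
      | .t => some (.inl true)
      | .plain v => some (.inr (.inl v.1))
      | .cyc d => some (.inr (.inr d.1)))
    (by rintro (_ | _ | _ | _) (_ | _ | _ | _) h <;> simp_all [Subtype.ext_iff])

instance [Finite D] (f : D → ℝ≥0) (x : V) : Finite (G.InDart f x) := Subtype.finite

instance [Finite D] (f : D → ℝ≥0) (x : V) : Finite (G.OutDart f x) := Subtype.finite

instance [Finite D] (f : D → ℝ≥0) (x : V) : Finite (G.InTerminal f x) := Quot.finite _

instance [Finite D] (f : D → ℝ≥0) (x : V) : Finite (G.OutTerminal f x) := Quot.finite _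

instance [Finite V] [Finite D] (f : D → ℝ≥0) (x : V) : Finite (G.AuxVertex f x) :=
  Finite.of_injective
    (β := {p : G.ExtVertex // p ∉ G.cycleAt x} ⊕ (G.InTerminal f x ⊕ G.OutTerminal f x))
    (fun p => match p with
      | .ext p => .inl p
      | .xin a => .inr (.inl a)
      | .xout a => .inr (.inr a))
    (by rintro (_ | _ | _) (_ | _ | _) h <;> simp_all)

section

variable {G} {x : V} (hx : G.vcap x ≠ ⊤)
include hx

theorem attach_mem_cycleAt_iff {d : D} : G.attach d ∈ G.cycleAt x ↔ G.src d = x := by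
  refine ⟨fun h => by_contra fun h' => G.attach_notMem_cycleAt h' h, fun h => ?_⟩
  have h' : G.vcap (G.src d) ≠ ⊤ := by rwa [h]
  exact ⟨⟨d, h'⟩, G.attach_of_ne_top h', h⟩

end

theorem cyc_mem_cycleAt_iff {x : V} {d : {d : D // G.vcap (G.src d) ≠ ⊤}} :
    ExtVertex.cyc d ∈ G.cycleAt x ↔ G.src d.1 = x := by
  refine ⟨?_, fun h => ⟨d, rfl, h⟩⟩
  rintro ⟨d', h, h'⟩
  cases h
  exact h'

theorem plain_notMem_cycleAt {x : V} (v : {v : V // G.vcap v = ⊤}) :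
    ExtVertex.plain v ∉ G.cycleAt x := by
  rintro ⟨_, h, -⟩
  cases h

theorem s_notMem_cycleAt {x : V} : ExtVertex.s ∉ G.cycleAt x := by
  rintro ⟨_, h, -⟩
  cases h

theorem t_notMem_cycleAt {x : V} : ExtVertex.t ∉ G.cycleAt x := by
  rintro ⟨_, h, -⟩
  cases h

theorem extTail_cyc_mem_cycleAt_iff {x : V} {d : {d : D // G.vcap (G.src d) ≠ ⊤}} {b : Bool} :
    G.extTail (.cyc d b) ∈ G.cycleAt x ↔ G.src d.1 = x := by
  cases b
  · exact (G.cyc_mem_cycleAt_iff).trans (by rw [G.src_rot])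
  · exact G.cyc_mem_cycleAt_iff

theorem extTail_super_notMem_cycleAt {x : V} (v : {v : V // v ∈ G.S}) (b : Bool) :
    G.extTail (.super v b) ∉ G.cycleAt x := by
  cases b
  · exact G.plain_notMem_cycleAt _
  · exact G.s_notMem_cycleAt

theorem extTail_toSink_notMem_cycleAt {x : V} (v : {v : V // v ∈ G.T}) (b : Bool) :
    G.extTail (.toSink v b) ∉ G.cycleAt x := by
  cases b
  · exact G.t_notMem_cycleAt
  · exact G.plain_notMem_cycleAt _

/-! ### The flow through a vertex -/

section Flow

variable [Fintype D] [Fintype G.ExtArc]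

theorem sum_extArc (ψ : G.ExtArc → ℝ) [Fintype {d : D // G.vcap (G.src d) ≠ ⊤}] :
    ∑ e, ψ e = (∑ d, ψ (.old d) + ∑ d, ∑ b, ψ (.cyc d b)) +
      (∑ v, ∑ b, ψ (.super v b) + ∑ v, ∑ b, ψ (.toSink v b)) := by
  rw [← Equiv.sum_comp G.extArcEquiv.symm]
  simp only [Fintype.sum_sum_type, Fintype.sum_prod_type]
  rfl

variable {G} {F : G.ExtArc → ℝ≥0}

open Classical in
/-- The flow that passes through the part `J` of the cycle `C_x` is bounded by the capacities of
the edges at the ends of the intervals of `J`. -/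
theorem abs_sum_sub_le [Finite V] (hF : G.extended.IsFeasibleFlow F) {x : V} (hx : G.vcap x ≠ ⊤)
    {J : Set D} (hJ : ∀ d ∈ J, G.src d = x) :
    |∑ d, if d ∈ J then ((F (.old d) : ℝ) - F (.old (G.rev d))) else 0| ≤
      {d | d ∈ J ∧ G.rot d ∉ J}.ncard * (G.vcap x).toReal := by
  -- Conservation on the part `B` of `C_x` that belongs to `J` equates the net flow on the edges of
  -- `G` at `J` with that on the edges of `C_x` between `J` and its complement.
  let B : Set G.ExtVertex := {p | ∃ d, p = .cyc d ∧ d.1 ∈ J}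
  have hB : ∀ d, ExtVertex.cyc d ∈ B ↔ d.1 ∈ J := fun d => by
    refine ⟨?_, fun h => ⟨d, rfl, h⟩⟩
    rintro ⟨d', h, h'⟩
    cases h
    exact h'
  have hBplain : ∀ v, ExtVertex.plain v ∉ B := by
    rintro v ⟨_, h, -⟩
    cases h
  have hBs : ExtVertex.s ∉ B := by
    rintro ⟨_, h, -⟩
    cases h
  have hBt : ExtVertex.t ∉ B := by
    rintro ⟨_, h, -⟩
    cases h
  have hattach : ∀ d, G.attach d ∈ B ↔ d ∈ J := fun d => by
    by_cases h : G.vcap (G.src d) = ⊤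
    · rw [G.attach_of_eq_top h]
      refine iff_of_false (hBplain _) fun h' => hx ?_
      rw [← hJ d h', h]
    · rw [G.attach_of_ne_top h, hB]
  have hzero : netOut G.extended.tail G.extended.head (fun e => (F e : ℝ)) B = 0 := by
    refine netOut_eq_zero _ _ _ _ fun v hv => (FlowNetwork.isFeasibleFlow_iff.1 hF).1 v ?_ ?_
    · rintro rfl
      exact hBs hv
    · rintro rfl
      exact hBt hv
  rw [netOut, G.sum_extArc] at hzero
  have hold : ∀ d, (B.indicator (1 : G.ExtVertex → ℝ) (G.extended.tail (.old d)) -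
      B.indicator 1 (G.extended.head (.old d))) =
        (if d ∈ J then 1 else 0) - if G.rev d ∈ J then 1 else 0 := fun d => by
    change B.indicator 1 (G.attach d) - B.indicator 1 (G.attach (G.rev d)) = _
    simp only [Set.indicator_apply, hattach, Pi.one_apply]
  have hcyc : ∀ d, ∑ b, (F (.cyc d b) : ℝ) *
      (B.indicator (1 : G.ExtVertex → ℝ) (G.extended.tail (.cyc d b)) -
        B.indicator 1 (G.extended.head (.cyc d b))) =
        ((F (.cyc d true) : ℝ) - F (.cyc d false)) *
          ((if d.1 ∈ J then 1 else 0) - if G.rot d.1 ∈ J then 1 else 0) := fun d => by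
    rw [Fintype.sum_bool]
    change (F (.cyc d true) : ℝ) * (B.indicator 1 (.cyc d) - B.indicator 1 (G.nextOnCycle d)) +
      (F (.cyc d false) : ℝ) * (B.indicator 1 (G.nextOnCycle d) - B.indicator 1 (.cyc d)) = _
    simp only [nextOnCycle, Set.indicator_apply, hB, Pi.one_apply]
    ring
  have hsuper : ∀ v, ∑ b, (F (.super v b) : ℝ) *
      (B.indicator (1 : G.ExtVertex → ℝ) (G.extended.tail (.super v b)) -
        B.indicator 1 (G.extended.head (.super v b))) = 0 := fun v => by
    simp [extended, extRev, extTail, hBplain, hBs]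
  have hsink : ∀ v, ∑ b, (F (.toSink v b) : ℝ) *
      (B.indicator (1 : G.ExtVertex → ℝ) (G.extended.tail (.toSink v b)) -
        B.indicator 1 (G.extended.head (.toSink v b))) = 0 := fun v => by
    simp [extended, extRev, extTail, hBplain, hBt]
  simp only [hold, hcyc, hsuper, hsink, Finset.sum_const_zero, add_zero] at hzero
  have hmain : ∑ d, (F (.old d) : ℝ) * ((if d ∈ J then 1 else 0) - if G.rev d ∈ J then 1 else 0) =
      ∑ d, if d ∈ J then ((F (.old d) : ℝ) - F (.old (G.rev d))) else 0 := by
    have h1 : ∑ d, (F (.old d) : ℝ) * (if G.rev d ∈ J then 1 else 0) =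
        ∑ d, (F (.old (G.rev d)) : ℝ) * (if d ∈ J then 1 else 0) := by
      rw [← Equiv.sum_comp G.rev]
      simp only [G.rev_rev]
    simp only [mul_sub, Finset.sum_sub_distrib, h1]
    rw [← Finset.sum_sub_distrib]
    refine Finset.sum_congr rfl fun d _ => ?_
    split_ifs <;> simp
  rw [hmain] at hzero
  rw [eq_neg_of_add_eq_zero_left hzero, abs_neg]
  set c := (G.vcap x).toReal
  have hbound : ∀ d : {d : D // G.vcap (G.src d) ≠ ⊤},
      |((F (.cyc d true) : ℝ) - F (.cyc d false)) *
          ((if d.1 ∈ J then 1 else 0) - if G.rot d.1 ∈ J then 1 else 0)| ≤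
        c / 2 * ((if d.1 ∈ J ∧ G.rot d.1 ∉ J then 1 else 0) +
          if d.1 ∉ J ∧ G.rot d.1 ∈ J then 1 else 0) := by
    intro d
    by_cases hd : G.src d.1 = x
    · have hb : ∀ b, (F (.cyc d b) : ℝ) ≤ c / 2 := fun b => by
        have h1 : (F (.cyc d b) : ℝ≥0∞) ≤ G.vcap (G.src d.1) / 2 := hF.2 (.cyc d b)
        rw [hd] at h1
        have h2 := ENNReal.toReal_mono (ENNReal.div_ne_top hx two_ne_zero) h1
        simpa [ENNReal.toReal_div] using h2
      have h0 : ∀ b, (0 : ℝ) ≤ F (.cyc d b) := fun b => NNReal.coe_nonneg _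
      have habs : |(F (.cyc d true) : ℝ) - F (.cyc d false)| ≤ c / 2 :=
        abs_sub_le_iff.2 ⟨by linarith [hb true, h0 false], by linarith [hb false, h0 true]⟩
      by_cases h1 : d.1 ∈ J <;> by_cases h2 : G.rot d.1 ∈ J <;> simp [h1, h2] <;>
        linarith [abs_sub_comm (F (.cyc d true) : ℝ) (F (.cyc d false))]
    · have h1 : d.1 ∉ J := fun h => hd (hJ _ h)
      have h2 : G.rot d.1 ∉ J := fun h => hd (by rw [← G.src_rot, hJ _ h])
      simp [h1, h2]
  refine (Finset.abs_sum_le_sum_abs _ _).trans ((Finset.sum_le_sum fun d _ => hbound d).trans ?_)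
  rw [← Finset.mul_sum, Finset.sum_add_distrib]
  have hcount : ∀ (P : D → Prop) [DecidablePred P], (∑ d : {d : D // G.vcap (G.src d) ≠ ⊤},
      if P d.1 then (1 : ℝ) else 0) ≤ {d | P d}.ncard := fun P _ => by
    rw [Finset.sum_boole, ← Set.ncard_coe_finset, Nat.cast_le,
      ← Set.ncard_image_of_injective _ Subtype.val_injective]
    refine Set.ncard_le_ncard ?_ (Set.toFinite _)
    rintro _ ⟨d, hd, rfl⟩
    simpa using hd
  have h1 := hcount fun d => d ∈ J ∧ G.rot d ∉ J
  have h2 := hcount fun d => d ∉ J ∧ G.rot d ∈ J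
  -- There are as many entries as exits, each worth `c(x)/2`, so each interval of `J` costs `c(x)`.
  rw [ncard_entries] at h2
  have hc : 0 ≤ c / 2 := div_nonneg ENNReal.toReal_nonneg zero_le_two
  exact (mul_le_mul_of_nonneg_left (add_le_add h1 h2) hc).trans (by linarith)

-- At a vertex of infinite capacity this is conservation in `G°`. At one of finite capacity the
-- previous bound is applied to the whole cycle, which has no ends.
open Classical in
theorem sum_src_eq [Finite V] (hF : G.extended.IsFeasibleFlow F) {v : V} (hS : v ∉ G.S)
    (hT : v ∉ G.T) :
    (∑ d, if G.src d = v then ((F (.old d) : ℝ) - F (.old (G.rev d))) else 0) = 0 := by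
  by_cases hv : G.vcap v = ⊤
  · have h := (FlowNetwork.isFeasibleFlow_iff.1 hF).1 (.plain ⟨v, hv⟩) (by simp [extended])
      (by simp [extended])
    rw [netOut, G.sum_extArc] at h
    have hattach : ∀ d, G.attach d = .plain ⟨v, hv⟩ ↔ G.src d = v := fun d => by
      by_cases hd : G.vcap (G.src d) = ⊤
      · rw [G.attach_of_eq_top hd]
        simp
      · rw [G.attach_of_ne_top hd]
        simp only [reduceCtorEq, false_iff]
        rintro rfl
        exact hd hv
    have hS' : ∀ w ∈ G.S, w ≠ v := fun w hw h => hS (h ▸ hw)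
    have hT' : ∀ w ∈ G.T, w ≠ v := fun w hw h => hT (h ▸ hw)
    simp only [extended, extRev, Set.indicator_apply, Set.mem_singleton_iff, Pi.one_apply,
      Fintype.sum_bool, extTail, Bool.not_true, Bool.not_false, nextOnCycle, hattach, reduceCtorEq,
      if_false, sub_zero, mul_zero, add_zero, Finset.sum_const_zero, ExtVertex.plain.injEq,
      Subtype.mk.injEq] at h
    simp only [fun w : {w // w ∈ G.S} => hS' w.1 w.2,
      fun w : {w // w ∈ G.T} => hT' w.1 w.2, if_false, sub_zero, mul_zero, add_zero,
      Finset.sum_const_zero] at h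
    have h1 : ∑ d, (F (.old d) : ℝ) * (if G.src (G.rev d) = v then 1 else 0) =
        ∑ d, (F (.old (G.rev d)) : ℝ) * (if G.src d = v then 1 else 0) := by
      rw [← Equiv.sum_comp G.rev]
      simp only [G.rev_rev]
    simp only [mul_sub, Finset.sum_sub_distrib, h1] at h
    refine Eq.trans ?_ h
    rw [← Finset.sum_sub_distrib]
    refine Finset.sum_congr rfl fun d _ => ?_
    split_ifs <;> simp
  · have h := abs_sum_sub_le hF hv (J := {d | G.src d = v}) fun d hd => hd
    have h0 : {d | d ∈ {d | G.src d = v} ∧ G.rot d ∉ {d | G.src d = v}} = ∅ := by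
      ext d
      simp [G.src_rot]
    rw [h0, Set.ncard_empty, Nat.cast_zero, zero_mul] at h
    exact abs_nonpos_iff.1 h

end Flow

end PlaneNetwork

namespace PlaneNetwork

variable {V D : Type*} (G : PlaneNetwork V D)

/-! ### Rerouting a flow outside `C_x` -/

/-- The arcs of `G°` apart from those of `C_x` and those at `s` and `t`. -/
def IsFree (x : V) : G.ExtArc → Prop
  | .old _ => True
  | .cyc d _ => G.src d.1 ≠ x
  | _ => False

theorem isFree_extRev {x : V} {e : G.ExtArc} : G.IsFree x (G.extRev e) ↔ G.IsFree x e := by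
  cases e <;> rfl

open Classical in
/-- The vertices of `G°` after the contraction of `C_x` to the vertex `none`. -/
noncomputable def contract (x : V) (p : G.ExtVertex) : Option G.ExtVertex :=
  if p ∈ G.cycleAt x then none else some p

variable {G}

theorem contract_eq_none {x : V} {p : G.ExtVertex} : G.contract x p = none ↔ p ∈ G.cycleAt x := by
  simp [contract]

theorem contract_eq_some {x : V} {p q : G.ExtVertex} :
    G.contract x p = some q ↔ p ∉ G.cycleAt x ∧ p = q := by
  unfold contract
  split_ifs with h <;> simp [h]

variable (G)

/-- The arcs that carry `φ` after the contraction of `C_x`. -/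
def FlowStep (x : V) (φ : G.ExtArc → ℝ) (u w : Option G.ExtVertex) : Prop :=
  ∃ e, G.IsFree x e ∧ G.contract x (G.extTail e) = u ∧ G.contract x (G.extHead e) = w ∧ 0 < φ e

/-- The residual arcs outside `C_x`. -/
def ResidualStep (x : V) (φ : G.ExtArc → ℝ) (p q : G.ExtVertex) : Prop :=
  ∃ e, G.IsFree x e ∧ G.extTail e = p ∧ G.extHead e = q ∧ p ∉ G.cycleAt x ∧ q ∉ G.cycleAt x ∧
    (ENNReal.ofReal (φ e) < G.extCap e ∨ 0 < φ (G.extRev e))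

/-- The vertices that are reachable from `x` in the residual graph when one starts against an arc
that carries flow into `x`. -/
def residualReach (x : V) (φ : G.ExtArc → ℝ) : Set G.ExtVertex :=
  {p | ∃ e, G.IsFree x e ∧ G.extHead e ∈ G.cycleAt x ∧ G.extTail e ∉ G.cycleAt x ∧ 0 < φ e ∧
    Relation.ReflTransGen (G.ResidualStep x φ) (G.extTail e) p}

/-- A flow outside `C_x` that is obtained from `F` by reducing the flow through `x` by a maximum
amount, without a change at `s` and `t`, and that has no cycles. -/
structure IsOptimal [Fintype G.ExtArc] (F : G.ExtArc → ℝ≥0) (x : V) (φ : G.ExtArc → ℝ) :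
    Prop where
  nonneg : ∀ e, 0 ≤ φ e
  eq_of_not_isFree : ∀ e, ¬ G.IsFree x e → φ e = F e
  le_cap : ∀ e, ENNReal.ofReal (φ e) ≤ G.extCap e
  le_of_tail : ∀ e, G.extTail e ∈ G.cycleAt x → φ e ≤ F e
  le_of_head : ∀ e, G.extHead e ∈ G.cycleAt x → φ e ≤ F e
  conservation : ∀ p ∉ G.cycleAt x,
    netOut G.extTail G.extHead φ {p} = netOut G.extTail G.extHead (fun e => (F e : ℝ)) {p}
  acyclic : ∀ u, ¬ Relation.TransGen (G.FlowStep x φ) u u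
  -- If such an arc out of `x` still carried flow, it would complete a residual path along which
  -- more flow could be led around `x`.
  maximal : ∀ e, G.IsFree x e → G.extTail e ∈ G.cycleAt x → G.extHead e ∈ G.residualReach x φ →
    φ e ≤ 0

variable {G}

theorem notMem_cycleAt_of_mem_residualReach {x : V} {φ : G.ExtArc → ℝ} {p : G.ExtVertex}
    (hp : p ∈ G.residualReach x φ) : p ∉ G.cycleAt x := by
  obtain ⟨e, -, -, h, -, hr⟩ := hp
  rcases Relation.ReflTransGen.cases_tail hr with rfl | ⟨_, -, _, -, -, -, -, h', -⟩
  exacts [h, h']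

open Classical in
theorem indicator_singleton_eq_contract {x : V} {p : G.ExtVertex} (hp : p ∉ G.cycleAt x)
    (q : G.ExtVertex) :
    ({p} : Set G.ExtVertex).indicator (1 : G.ExtVertex → ℝ) q =
      if G.contract x q = some p then 1 else 0 := by
  simp only [Set.indicator_apply, Set.mem_singleton_iff, Pi.one_apply, contract_eq_some]
  by_cases h : q = p
  · subst h
    simp [hp]
  · simp [h]

section

variable [Fintype G.ExtArc]

-- `φ` is lowered by one for each passage of the walk through an arc. On a closed walk this is
-- balanced outside `C_x`, lowers the total flow and does not raise the flow into `x`.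
open Classical in
theorem exists_direction_of_flowStep {x : V} {φ : G.ExtArc → ℝ} {u w : Option G.ExtVertex}
    (h : Relation.TransGen (G.FlowStep x φ) u w) :
    ∃ k : G.ExtArc → ℝ, (∀ e, k e ≤ 0) ∧ (∀ e, k e < 0 → G.IsFree x e ∧ 0 < φ e) ∧
      ∑ e, k e < 0 ∧ ∀ p ∉ G.cycleAt x, netOut G.extTail G.extHead k {p} =
        (if w = some p then 1 else 0) - if u = some p then 1 else 0 := by
  have key : ∀ {u w}, G.FlowStep x φ u w →
      ∃ k : G.ExtArc → ℝ, (∀ e, k e ≤ 0) ∧ (∀ e, k e < 0 → G.IsFree x e ∧ 0 < φ e) ∧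
      ∑ e, k e < 0 ∧ ∀ p ∉ G.cycleAt x, netOut G.extTail G.extHead k {p} =
        (if w = some p then 1 else 0) - if u = some p then 1 else 0 := by
    rintro u w ⟨e, he, rfl, rfl, hφ⟩
    refine ⟨Pi.single e (-1), fun e' => ?_, fun e' => ?_, ?_, fun p hp => ?_⟩
    · by_cases h : e' = e
      · subst h
        simp
      · simp [h]
    · by_cases h : e' = e
      · subst h
        exact fun _ => ⟨he, hφ⟩
      · simp [h]
    · simp
    · rw [netOut_single, indicator_singleton_eq_contract hp, indicator_singleton_eq_contract hp]
      ring
  induction h with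
  | single h => exact key h
  | tail _ h ih =>
    obtain ⟨k₁, a₁, b₁, c₁, d₁⟩ := ih
    obtain ⟨k₂, a₂, b₂, c₂, d₂⟩ := key h
    refine ⟨k₁ + k₂, fun e => add_nonpos (a₁ e) (a₂ e), fun e he => ?_, ?_, fun p hp => ?_⟩
    · rcases lt_or_ge (k₁ e) 0 with h | h
      · exact b₁ e h
      · exact b₂ e (by rw [Pi.add_apply] at he; linarith)
    · simp only [Pi.add_apply, Finset.sum_add_distrib]
      exact add_neg c₁ c₂
    · rw [netOut_add, d₁ p hp, d₂ p hp]
      ring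

/-- The arcs that carry flow from outside into `x`. -/
def IsInArc (x : V) (e : G.ExtArc) : Prop :=
  G.IsFree x e ∧ G.extHead e ∈ G.cycleAt x ∧ G.extTail e ∉ G.cycleAt x

-- The direction follows the residual path: one unit less on the first arc into `x`, then for each
-- step one unit more on the arc or one less on its reversal. Only the first change affects the flow
-- into `x`, as all later arcs avoid `C_x`.
open Classical in
theorem exists_direction_of_mem_residualReach {x : V} {φ : G.ExtArc → ℝ} {q : G.ExtVertex}
    (hq : q ∈ G.residualReach x φ) :
    ∃ k : G.ExtArc → ℝ, (∀ e, k e < 0 → G.IsFree x e ∧ 0 < φ e) ∧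
      (∀ e, 0 < k e → G.IsFree x e ∧ G.extTail e ∉ G.cycleAt x ∧ G.extHead e ∉ G.cycleAt x ∧
        ENNReal.ofReal (φ e) < G.extCap e) ∧
      (∑ e, (if IsInArc x e then 1 else 0) * k e) = -1 ∧
      ∀ p ∉ G.cycleAt x, netOut G.extTail G.extHead k {p} = -if q = p then 1 else 0 := by
  obtain ⟨e, he, hhead, htail, hφ, hr⟩ := hq
  have hind : ∀ p q : G.ExtVertex, ({p} : Set G.ExtVertex).indicator (1 : G.ExtVertex → ℝ) q =
      if q = p then 1 else 0 := fun p q => by simp [Set.indicator_apply]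
  induction hr with
  | refl =>
    refine ⟨Pi.single e (-1), fun e' => ?_, fun e' => ?_, ?_, fun p hp => ?_⟩
    · by_cases h : e' = e
      · subst h
        exact fun _ => ⟨he, hφ⟩
      · simp [h]
    · by_cases h : e' = e
      · subst h
        intro h
        simp only [Pi.single_eq_same] at h
        linarith
      · simp [h]
    · rw [Finset.sum_eq_single e]
      · simp [IsInArc, he, hhead, htail]
      · intro b _ hb
        simp [hb]
      · simp
    · have h1 : G.extHead e ≠ p := fun h => hp (h ▸ hhead)
      rw [netOut_single, hind, hind, if_neg h1]
      ring
  | tail _ h ih =>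
    obtain ⟨k, a, b, c, d⟩ := ih
    obtain ⟨e', f1, rfl, rfl, f2, f3, f4⟩ := h
    rcases f4 with f4 | f4
    · refine ⟨k + Pi.single e' 1, fun e'' => ?_, fun e'' => ?_, ?_, fun p hp => ?_⟩
      · by_cases h : e'' = e'
        · subst h
          intro h
          simp only [Pi.add_apply, Pi.single_eq_same] at h
          exact a _ (by linarith)
        · simpa [h] using a e''
      · by_cases h : e'' = e'
        · subst h
          exact fun _ => ⟨f1, f2, f3, f4⟩
        · simpa [h] using b e''
      · simp only [Pi.add_apply, mul_add, Finset.sum_add_distrib, c]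
        rw [Finset.sum_eq_single e']
        · simp [IsInArc, f3]
        · intro b _ hb
          simp [hb]
        · simp
      · rw [netOut_add, d p hp, netOut_single, hind, hind]
        ring
    · refine ⟨k + Pi.single (G.extRev e') (-1), fun e'' => ?_, fun e'' => ?_, ?_, fun p hp => ?_⟩
      · by_cases h : e'' = G.extRev e'
        · subst h
          exact fun _ => ⟨G.isFree_extRev.2 f1, f4⟩
        · simpa [h] using a e''
      · by_cases h : e'' = G.extRev e'
        · subst h
          intro h
          simp only [Pi.add_apply, Pi.single_eq_same] at h
          exact b _ (by linarith)
        · simpa [h] using b e''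
      · simp only [Pi.add_apply, mul_add, Finset.sum_add_distrib, c]
        rw [Finset.sum_eq_single (G.extRev e')]
        · simp [IsInArc, f2]
        · intro b _ hb
          simp [hb]
        · simp
      · rw [netOut_add, d p hp, netOut_single, hind, hind, extHead_extRev]
        change _ + -1 * ((if G.extHead e' = p then (1 : ℝ) else 0) - _) = _
        ring

theorem exists_isOptimal {F : G.ExtArc → ℝ≥0} (hF : G.extended.IsFeasibleFlow F) (x : V) :
    ∃ φ, G.IsOptimal F x φ := by
  classical
  let P : Submodule ℝ (G.ExtArc → ℝ) :=
    { carrier := {k | ∀ p ∉ G.cycleAt x, netOut G.extTail G.extHead k {p} = 0}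
      add_mem' := fun h h' p hp => by rw [netOut_add, h p hp, h' p hp, add_zero]
      zero_mem' := fun p _ => by simp [netOut]
      smul_mem' := fun c k h p hp => by rw [netOut_smul, h p hp, mul_zero] }
  have hP : ∀ k, k ∈ P ↔ ∀ p ∉ G.cycleAt x, netOut G.extTail G.extHead k {p} = 0 :=
    fun _ => Iff.rfl
  -- The arcs of `C_x` and those at `s` and `t` are frozen, the other arcs at `C_x` may only lose
  -- flow, and the rest is bounded by the capacities.
  let l : G.ExtArc → ℝ := fun e => if G.IsFree x e then 0 else F e
  let u : G.ExtArc → ℝ≥0∞ := fun e =>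
    if G.IsFree x e ∧ G.extTail e ∉ G.cycleAt x ∧ G.extHead e ∉ G.cycleAt x then G.extCap e else F e
  have hFu : ∀ e, (F e : ℝ≥0∞) ≤ u e := fun e => by
    by_cases h : G.IsFree x e ∧ G.extTail e ∉ G.cycleAt x ∧ G.extHead e ∉ G.cycleAt x
    · simp only [u, if_pos h]
      exact hF.2 e
    · simp only [u, if_neg h, le_refl]
  obtain ⟨φ, h1, h2, h3, h4⟩ := exists_lexicographic_min P (l := l) (u := u)
    (F := fun e => (F e : ℝ)) (a := fun e => if IsInArc x e then 1 else 0)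
    (fun e => by simp only [l]; split_ifs <;> simp) (fun e => by simp only [l]; split_ifs <;> simp)
    (fun e => by simpa using hFu e) (fun e => by split_ifs <;> simp)
  have hle : ∀ e, ¬ (G.IsFree x e ∧ G.extTail e ∉ G.cycleAt x ∧ G.extHead e ∉ G.cycleAt x) →
      φ e ≤ F e := fun e he => by
    have := h2 e
    simp only [u, if_neg he] at this
    rwa [← ENNReal.ofReal_coe_nnreal, ENNReal.ofReal_le_ofReal_iff (NNReal.coe_nonneg _)] at this
  have h0 : ∀ e, 0 ≤ φ e := fun e => by
    refine le_trans ?_ (h1 e)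
    simp only [l]
    split_ifs <;> simp
  have hlfree : ∀ e, G.IsFree x e → l e = 0 := fun e he => by simp only [l, if_pos he]
  refine ⟨φ, h0, fun e he => le_antisymm (hle e fun h => he h.1) ?_, fun e => ?_,
    fun e he => hle e fun h => h.2.1 he, fun e he => hle e fun h => h.2.2 he, fun p hp => ?_,
    fun v hv => ?_, fun e he htail hhead => ?_⟩
  · have := h1 e
    simpa only [l, if_neg he] using this
  · refine (h2 e).trans ?_
    simp only [u]
    split_ifs
    exacts [le_rfl, hF.2 e]
  · have := h3 p hp
    have h5 := netOut_add G.extTail G.extHead (φ - fun e => (F e : ℝ)) (fun e => (F e : ℝ)) {p}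
    rw [sub_add_cancel, this, zero_add] at h5
    exact h5
  -- Cancelling a closed walk cannot decrease the minimal flow into `x`, so leaves it unchanged;
  -- then the second criterion is violated.
  · obtain ⟨k, a, b, c, d⟩ := exists_direction_of_flowStep hv
    have hk := h4 k (fun p hp => by rw [d p hp, sub_self])
      (fun e he => by rw [hlfree e (b e he).1]; exact (b e he).2)
      (fun e he => absurd (a e) (not_le.2 he))
    have hle : ∑ e, (if IsInArc x e then 1 else 0) * k e ≤ 0 :=
      Finset.sum_nonpos fun e _ => mul_nonpos_of_nonneg_of_nonpos (by split_ifs <;> simp) (a e)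
    exact absurd c (not_lt.2 (hk.2 (le_antisymm hle hk.1)))
  · by_contra! hφ
    have hheadC := notMem_cycleAt_of_mem_residualReach hhead
    obtain ⟨k, a, b, c, d⟩ := exists_direction_of_mem_residualReach hhead
    -- Lowering the outgoing arc `e` balances the residual path at the head of `e`, and the flow
    -- into `x` drops by one, against the first criterion.
    have hk := h4 (k + Pi.single e (-1)) (fun p hp => ?_) (fun e' he' => ?_) (fun e' he' => ?_)
    · have h5 := hk.1
      simp only [Pi.add_apply, mul_add, Finset.sum_add_distrib, c] at h5
      rw [Finset.sum_eq_single e] at h5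
      · simp only [IsInArc, hheadC, false_and, and_false, if_false, zero_mul] at h5
        linarith
      · intro b _ hb
        simp [hb]
      · simp
    · have h5 : G.extTail e ≠ p := fun h => hp (h ▸ htail)
      rw [netOut_add, d p hp, netOut_single]
      simp only [Set.indicator_apply, Set.mem_singleton_iff, h5, if_false, Pi.one_apply]
      split_ifs <;> norm_num
    · by_cases h : e' = e
      · subst h
        rwa [hlfree _ he]
      · have h6 := a e' (by simpa [h] using he')
        rw [hlfree _ h6.1]
        exact h6.2
    · by_cases h : e' = e
      · subst h
        simp only [Pi.add_apply, Pi.single_eq_same] at he'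
        exact absurd htail (b e' (by linarith)).2.1
      · obtain ⟨k1, k2, k3, k4⟩ := b e' (by simpa [h] using he')
        simpa only [u, if_pos (And.intro k1 (And.intro k2 k3))] using k4

end

end PlaneNetwork

theorem exists_pos_iff_of_netOut_eq_zero {V E : Type*} [Fintype E] {tail head : E → V}
    {φ : E → ℝ} (h0 : ∀ e, 0 ≤ φ e) {p : V} (h : netOut tail head φ {p} = 0) :
    (∃ e, tail e = p ∧ 0 < φ e) ↔ ∃ e, head e = p ∧ 0 < φ e := by
  classical
  have hpos : ∀ (v : E → V) (A : Set V), (∃ e, v e ∈ A ∧ 0 < φ e) ↔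
      0 < ∑ e, if v e ∈ A then φ e else 0 := fun v A => by
    rw [Finset.sum_pos_iff_of_nonneg fun e _ => by split_ifs <;> simp [h0]]
    refine exists_congr fun e => ?_
    by_cases he : v e ∈ A <;> simp [he]
  rw [netOut_eq_sub, sub_eq_zero] at h
  simp only [← Set.mem_singleton_iff (b := p), hpos, h]

namespace PlaneNetwork

variable {V D : Type*} (G : PlaneNetwork V D)

/-! ### The plane graph outside `C_x` -/

/-- The darts at the vertices other than `x` that are replaced by cycles. -/
def Inflated (x : V) (d : D) : Prop := G.vcap (G.src d) ≠ ⊤ ∧ G.src d ≠ x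

theorem inflated_rot (x : V) (d : D) : G.Inflated x (G.rot d) ↔ G.Inflated x d := by
  rw [Inflated, Inflated, G.src_rot]

/-- The darts of the graph that is obtained from `G` by inflating the vertices of finite capacity
other than `x`. -/
abbrev OuterDart (x : V) : Type _ := D ⊕ {d : D // G.Inflated x d} × Bool

/-- The arc of `G°` that corresponds to a dart outside `C_x`. -/
def outerArc (x : V) : G.OuterDart x → G.ExtArc
  | .inl d => .old d
  | .inr (d, b) => .cyc ⟨d.1, d.2.1⟩ b

/-- The edge involution outside `C_x`. -/
def outerRev (x : V) : Perm (G.OuterDart x) := inflateRev (G.Inflated x) G.rev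

/-- The rotation outside `C_x`. -/
noncomputable def outerRot [Finite D] (x : V) : Perm (G.OuterDart x) :=
  inflateRot G.rot (G.inflated_rot x)

/-- The initial vertex of a dart outside `C_x`, where `none` stands for `x`. -/
noncomputable def outerSrc (x : V) (δ : G.OuterDart x) : Option G.ExtVertex :=
  G.contract x (G.extTail (G.outerArc x δ))

variable {G}

theorem outerArc_outerRev (x : V) (δ : G.OuterDart x) :
    G.outerArc x (G.outerRev x δ) = G.extRev (G.outerArc x δ) := by
  rcases δ with d | ⟨d, b⟩ <;> rfl

theorem outerSrc_outerRev (x : V) (δ : G.OuterDart x) :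
    G.outerSrc x (G.outerRev x δ) = G.contract x (G.extHead (G.outerArc x δ)) := by
  rw [outerSrc, outerArc_outerRev]
  rfl

theorem outerRev_outerRev (x : V) (δ : G.OuterDart x) : G.outerRev x (G.outerRev x δ) = δ := by
  rcases δ with d | ⟨d, b⟩
  · exact congrArg Sum.inl (G.rev_rev d)
  · simp [outerRev, inflateRev_inr]

theorem outerRev_ne (x : V) (δ : G.OuterDart x) : G.outerRev x δ ≠ δ := by
  rcases δ with d | ⟨d, b⟩
  · exact fun h => G.rev_ne d (Sum.inl_injective h)
  · simp [outerRev, inflateRev_inr]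

theorem isFree_outerArc (x : V) (δ : G.OuterDart x) : G.IsFree x (G.outerArc x δ) := by
  rcases δ with d | ⟨d, b⟩
  exacts [trivial, d.2.2]

theorem exists_outerArc_eq {x : V} {e : G.ExtArc} (he : G.IsFree x e) :
    ∃ δ, G.outerArc x δ = e := by
  rcases e with d | ⟨d, b⟩ | _ | _
  exacts [⟨.inl d, rfl⟩, ⟨.inr (⟨d.1, d.2, he⟩, b), rfl⟩, he.elim, he.elim]

theorem isPlaneRotation_outer [Finite D] (x : V) :
    IsPlaneRotation (G.outerRot x) (G.outerRev x) :=
  isPlaneRotation_inflate G.plane G.rev_rev G.rev_ne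

theorem outerSrc_inl_of_inflated {x : V} {d : D} (h : G.Inflated x d) :
    G.outerSrc x (.inl d) = some (.cyc ⟨d, h.1⟩) := by
  change G.contract x (G.attach d) = _
  rw [G.attach_of_ne_top h.1, contract_eq_some]
  exact ⟨fun h' => h.2 (G.cyc_mem_cycleAt_iff.1 h'), rfl⟩

theorem outerSrc_inr (x : V) (d : {d : D // G.Inflated x d}) (b : Bool) :
    G.outerSrc x (.inr (d, b)) = G.outerSrc x (.inl (if b then d.1 else G.rot d.1)) := by
  cases b
  · have h : G.Inflated x (G.rot d.1) := (G.inflated_rot x d.1).2 d.2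
    rw [if_neg Bool.false_ne_true, outerSrc_inl_of_inflated h, outerSrc, contract_eq_some]
    exact ⟨fun h' => h.2 (G.cyc_mem_cycleAt_iff.1 h'), rfl⟩
  · rw [if_pos rfl, outerSrc_inl_of_inflated d.2, outerSrc, contract_eq_some]
    exact ⟨fun h' => d.2.2 (G.cyc_mem_cycleAt_iff.1 h'), rfl⟩

theorem outerSrc_inl_eq_iff {x : V} (hx : G.vcap x ≠ ⊤) {a b : D} (ha : ¬ G.Inflated x a)
    (hb : ¬ G.Inflated x b) :
    G.outerSrc x (.inl a) = G.outerSrc x (.inl b) ↔ G.src a = G.src b := by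
  have key : ∀ {d}, ¬ G.Inflated x d →
      (G.src d = x ∧ G.outerSrc x (.inl d) = none) ∨ ∃ h : G.vcap (G.src d) = ⊤, G.src d ≠ x ∧
        G.outerSrc x (.inl d) = some (.plain ⟨G.src d, h⟩) := fun {d} hd => by
    by_cases h : G.src d = x
    · exact Or.inl ⟨h, contract_eq_none.2 ((attach_mem_cycleAt_iff hx).2 h)⟩
    · have h' : G.vcap (G.src d) = ⊤ := by
        by_contra h'
        exact hd ⟨h', h⟩
      refine Or.inr ⟨h', h, ?_⟩
      rw [← G.attach_of_eq_top h', outerSrc, contract_eq_some]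
      exact ⟨G.attach_notMem_cycleAt h, rfl⟩
  rcases key ha with ⟨h1, h2⟩ | ⟨h1, h2, h3⟩ <;> rcases key hb with ⟨k1, k2⟩ | ⟨k1, k2, k3⟩
  · simp [h1, h2, k1, k2]
  · simp [h1, h2, k3, k2.symm]
  · simp [k1, h2, k2, h3]
  · simp [h3, k3]

/-- Every dart shares its vertex with a dart of `G`. Among these, the inflated ones have private
vertices and the others keep the vertices of `G`, where the contracted `C_x` is again `x`. -/
theorem outerSrc_eq_iff [Finite D] {x : V} (hx : G.vcap x ≠ ⊤) (a b : G.OuterDart x) :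
    G.outerSrc x a = G.outerSrc x b ↔ (G.outerRot x).SameCycle a b := by
  have hrep : ∀ δ : G.OuterDart x, ∃ d, G.outerSrc x δ = G.outerSrc x (.inl d) ∧
      (G.outerRot x).SameCycle δ (.inl d) := by
    rintro (d | ⟨d, b⟩)
    · exact ⟨d, rfl, SameCycle.refl _ _⟩
    · exact ⟨_, outerSrc_inr x d b, sameCycle_inflateRot_inr d b⟩
  constructor
  · intro h
    obtain ⟨a', ha, ha'⟩ := hrep a
    obtain ⟨b', hb, hb'⟩ := hrep b
    refine ha'.trans (SameCycle.trans ?_ hb'.symm)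
    rw [ha, hb] at h
    by_cases hIa : G.Inflated x a' <;> by_cases hIb : G.Inflated x b'
    · rw [outerSrc_inl_of_inflated hIa, outerSrc_inl_of_inflated hIb] at h
      simp only [Option.some.injEq, ExtVertex.cyc.injEq, Subtype.mk.injEq] at h
      rw [h]
    · exfalso
      rw [outerSrc_inl_of_inflated hIa, eq_comm, outerSrc, contract_eq_some] at h
      obtain ⟨h1, h2⟩ := h
      refine hIb ?_
      have h3 : G.attach b' = .cyc ⟨a', hIa.1⟩ := h2
      by_cases h4 : G.vcap (G.src b') = ⊤
      · rw [G.attach_of_eq_top h4] at h3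
        cases h3
      · rw [G.attach_of_ne_top h4] at h3
        simp only [ExtVertex.cyc.injEq, Subtype.mk.injEq] at h3
        rwa [h3]
    · exfalso
      rw [outerSrc_inl_of_inflated hIb, outerSrc, contract_eq_some] at h
      obtain ⟨h1, h2⟩ := h
      refine hIa ?_
      have h3 : G.attach a' = .cyc ⟨b', hIb.1⟩ := h2
      by_cases h4 : G.vcap (G.src a') = ⊤
      · rw [G.attach_of_eq_top h4] at h3
        cases h3
      · rw [G.attach_of_ne_top h4] at h3
        simp only [ExtVertex.cyc.injEq, Subtype.mk.injEq] at h3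
        rwa [h3]
    · exact sameCycle_inflateRot_inl hIa
        ((G.src_eq_iff _ _).1 ((outerSrc_inl_eq_iff hx hIa hIb).1 h))
  · refine SameCycle.apply_eq fun δ => ?_
    rcases δ with d | ⟨d, (_ | _)⟩
    · by_cases h : G.Inflated x d
      · change G.outerSrc x (inflateRot G.rot (G.inflated_rot x) (.inl d)) = _
        rw [inflateRot_inl_of_mem h, outerSrc_inr, if_pos rfl]
      · change G.outerSrc x (inflateRot G.rot (G.inflated_rot x) (.inl d)) = _
        rw [inflateRot_inl_of_notMem h, outerSrc_inl_eq_iff hx (by rwa [inflated_rot]) h, G.src_rot]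
    · exact (outerSrc_inr x d false).symm
    · change G.outerSrc x (.inr (_, false)) = _
      rw [outerSrc_inr, outerSrc_inr]
      simp

theorem attach_ne (d : D) : G.attach d ≠ .s ∧ G.attach d ≠ .t := by
  unfold attach
  split_ifs <;> simp

theorem IsFree.extTail_ne {x : V} {e : G.ExtArc} (he : G.IsFree x e) :
    G.extTail e ≠ .s ∧ G.extTail e ≠ .t := by
  rcases e with d | ⟨d, (_ | _)⟩ | _ | _
  · exact attach_ne d
  · constructor <;> rintro ⟨⟩
  · constructor <;> rintro ⟨⟩
  · exact he.elim
  · exact he.elim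

theorem isFree_of_extTail {x : V} {e : G.ExtArc} (h : G.extTail e ∉ G.cycleAt x)
    (hs : G.extTail e ≠ .s) (ht : G.extTail e ≠ .t)
    (hterm : ∀ v, G.extTail e = .plain v → v.1 ∉ G.S ∧ v.1 ∉ G.T) : G.IsFree x e := by
  rcases e with d | ⟨d, b⟩ | ⟨v, b⟩ | ⟨v, b⟩
  · trivial
  · exact fun h' => h (G.extTail_cyc_mem_cycleAt_iff.2 h')
  · cases b
    · exact absurd v.2 (hterm _ rfl).1
    · exact absurd rfl hs
  · cases b
    · exact absurd rfl ht
    · exact absurd v.2 (hterm _ rfl).2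

/-- The reversal of an arc with flow is residual, so the walk up to its first entry into `C_x` can
be followed backwards from `x`. -/
theorem mem_residualReach_of_flowStep {x : V} {φ : G.ExtArc → ℝ} {p : G.ExtVertex}
    (h : Relation.ReflTransGen (G.FlowStep x φ) (some p) none) : p ∈ G.residualReach x φ := by
  suffices ∀ u, Relation.ReflTransGen (G.FlowStep x φ) u none →
      ∀ p, u = some p → p ∈ G.residualReach x φ from this _ h p rfl
  intro u hu
  induction hu using Relation.ReflTransGen.head_induction_on with
  | refl => simp
  | @head u w h _ ih =>
    rintro p rfl
    obtain ⟨e, he, htail, rfl, hφ⟩ := h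
    obtain ⟨htailC, rfl⟩ := contract_eq_some.1 htail
    by_cases hhead : G.extHead e ∈ G.cycleAt x
    · exact ⟨e, he, hhead, htailC, hφ, .refl⟩
    · obtain ⟨e', h1, h2, h3, h4, h5⟩ := ih _ (contract_eq_some.2 ⟨hhead, rfl⟩)
      exact ⟨e', h1, h2, h3, h4, h5.tail ⟨G.extRev e, G.isFree_extRev.2 he, rfl,
        G.extHead_extRev e, hhead, htailC, Or.inr (by rwa [extRev_extRev])⟩⟩

theorem IsOptimal.exists_out_iff_exists_in [Fintype G.ExtArc] {F : G.ExtArc → ℝ≥0} {x : V}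
    {φ : G.ExtArc → ℝ} (hφ : G.IsOptimal F x φ)
    (hF : G.extended.IsFeasibleFlow F) {p : G.ExtVertex} (hp : p ∉ G.cycleAt x) (hs : p ≠ .s)
    (ht : p ≠ .t) (hterm : ∀ v, p = .plain v → v.1 ∉ G.S ∧ v.1 ∉ G.T) :
    (∃ e, G.IsFree x e ∧ G.extTail e = p ∧ 0 < φ e) ↔
      ∃ e, G.IsFree x e ∧ G.extHead e = p ∧ 0 < φ e := by
  classical
  have h1 : ∀ e, G.extTail e = p → G.IsFree x e := by
    rintro e rfl
    exact isFree_of_extTail hp hs ht hterm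
  have h2 : ∀ e, G.extHead e = p → G.IsFree x e := fun e he => G.isFree_extRev.1 (h1 _ he)
  have h := hφ.conservation p hp
  have h0 : netOut G.extTail G.extHead (fun e => (F e : ℝ)) {p} = 0 :=
    (FlowNetwork.isFeasibleFlow_iff.1 hF).1 p hs ht
  rw [h0] at h
  have h3 := exists_pos_iff_of_netOut_eq_zero hφ.nonneg h
  constructor
  · rintro ⟨e, -, he, he'⟩
    obtain ⟨e', k, k'⟩ := h3.1 ⟨e, he, he'⟩
    exact ⟨e', h2 _ k, k, k'⟩
  · rintro ⟨e, -, he, he'⟩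
    obtain ⟨e', k, k'⟩ := h3.2 ⟨e, he, he'⟩
    exact ⟨e', h1 _ k, k, k'⟩

/-! ### Separators at `x` -/

section

variable [Fintype D] [Fintype G.ExtArc] [Finite V] {F : G.ExtArc → ℝ≥0} {x : V}

/-- An acyclic flow enters every vertex in at most two intervals. -/
theorem exists_separator_restrict (hS : G.S.card = 2) (hT : G.T.card = 1)
    (hF : G.extended.IsFeasibleFlow F) (hacyclic : G.toFlowNetwork.IsAcyclicFlow (G.restrict F))
    (hx : ∃ d, G.src d = x ∧ 0 < F (.old (G.rev d))) :
    ∃ I : Set D, (∀ d ∈ I, G.src d = x) ∧ (∀ d, G.src d = x → 0 < F (.old (G.rev d)) → d ∈ I) ∧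
      (∀ d, G.src d = x → 0 < F (.old d) → d ∉ I) ∧ {d | d ∈ I ∧ G.rot d ∉ I}.ncard ≤ 2 := by
  classical
  have hB : ∀ v ∉ G.S ∪ G.T, (∃ d, G.src d = v ∧ 0 < F (.old d)) ↔
      ∃ d, G.src d = v ∧ 0 < F (.old (G.rev d)) := by
    intro v hv
    rw [Finset.mem_union, not_or] at hv
    have h := sum_src_eq hF hv.1 hv.2
    have hpos : ∀ f : D → ℝ≥0, (∃ d, G.src d = v ∧ 0 < f d) ↔
        0 < ∑ d, if G.src d = v then (f d : ℝ) else 0 := fun f => by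
      rw [Finset.sum_pos_iff_of_nonneg fun d _ => by split_ifs <;> simp]
      refine exists_congr fun d => ?_
      by_cases hd : G.src d = v <;> simp [hd]
    have hsub : (∑ d, if G.src d = v then ((F (.old d) : ℝ) - F (.old (G.rev d))) else 0) =
        (∑ d, if G.src d = v then (F (.old d) : ℝ) else 0) -
          ∑ d, if G.src d = v then (F (.old (G.rev d)) : ℝ) else 0 := by
      rw [← Finset.sum_sub_distrib]
      exact Finset.sum_congr rfl fun d _ => by split_ifs <;> simp
    rw [hpos (fun d => F (.old d)), hpos (fun d => F (.old (G.rev d))),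
      sub_eq_zero.1 (hsub.symm.trans h)]
  obtain ⟨I, h1, h2, h3, h4⟩ := G.plane.exists_separator G.rev_rev G.rev_ne G.src_eq_iff
    (pos := fun d => 0 < F (.old d)) hacyclic (G.S ∪ G.T) hB hx
  refine ⟨I, h1, h2, h3, ?_⟩
  have := Finset.card_union_le G.S G.T
  omega

/-- If `x` cannot reach one of the sources in the residual graph, then the flow that is left enters
`x` in one interval. -/
theorem IsOptimal.exists_separator (hS : G.S.card = 2) (hT : G.T.card = 1)
    (hxtop : G.vcap x ≠ ⊤) (hF : G.extended.IsFeasibleFlow F) {φ : G.ExtArc → ℝ}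
    (hφ : G.IsOptimal F x φ) {v : V} (hv : v ∈ G.S)
    (hreach : ExtVertex.plain ⟨v, G.vcap_terminal v (Or.inl hv)⟩ ∉ G.residualReach x φ)
    (hin : ∃ d, G.src d = x ∧ 0 < φ (.old (G.rev d))) (hout : ∃ d, G.src d = x ∧ 0 < φ (.old d)) :
    ∃ I : Set D, (∀ d ∈ I, G.src d = x) ∧ (∀ d, G.src d = x → 0 < φ (.old (G.rev d)) → d ∈ I) ∧
      (∀ d, G.src d = x → 0 < φ (.old d) → d ∉ I) ∧ {d | d ∈ I ∧ G.rot d ∉ I}.ncard ≤ 1 := by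
  classical
  let B : Finset (Option G.ExtVertex) :=
    ((G.S.erase v).attach.image fun w => some (.plain ⟨w.1, G.vcap_terminal w.1
      (Or.inl (Finset.mem_of_mem_erase w.2))⟩)) ∪
    G.T.attach.image fun w => some (.plain ⟨w.1, G.vcap_terminal w.1 (Or.inr w.2)⟩)
  have hBcard : B.card ≤ 2 := by
    refine (Finset.card_union_le _ _).trans ?_
    have h1 := Finset.card_image_le (s := (G.S.erase v).attach) (f := fun w =>
      (some (.plain ⟨w.1, G.vcap_terminal w.1 (Or.inl (Finset.mem_of_mem_erase w.2))⟩) :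
        Option G.ExtVertex))
    have h2 := Finset.card_image_le (s := G.T.attach) (f := fun w =>
      (some (.plain ⟨w.1, G.vcap_terminal w.1 (Or.inr w.2)⟩) : Option G.ExtVertex))
    rw [Finset.card_attach, Finset.card_erase_of_mem hv] at h1
    rw [Finset.card_attach] at h2
    omega
  let toX : Option G.ExtVertex → Prop := fun u => Relation.ReflTransGen (G.FlowStep x φ) u none
  let fromX : Option G.ExtVertex → Prop := fun u => Relation.ReflTransGen (G.FlowStep x φ) none u
  -- Only the flow arcs on walks to or from `x` are kept. This removes the source `v`: no flow from
  -- it reaches `x`, and none enters it. At every other vertex outside `B` an arc that is kept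
  -- enters if and only if one leaves.
  let pos : G.OuterDart x → Prop := fun δ => 0 < φ (G.outerArc x δ) ∧
    (toX (G.outerSrc x (G.outerRev x δ)) ∨ fromX (G.outerSrc x δ))
  have hstep : ∀ δ : G.OuterDart x, 0 < φ (G.outerArc x δ) →
      G.FlowStep x φ (G.outerSrc x δ) (G.outerSrc x (G.outerRev x δ)) := fun δ hδ =>
    ⟨G.outerArc x δ, isFree_outerArc x δ, rfl, (outerSrc_outerRev x δ).symm, hδ⟩
  have hstep' : ∀ {u w}, G.FlowStep x φ u w → ∃ δ, G.outerSrc x δ = u ∧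
      G.outerSrc x (G.outerRev x δ) = w ∧ 0 < φ (G.outerArc x δ) := by
    rintro u w ⟨e, he, rfl, rfl, hpos⟩
    obtain ⟨δ, rfl⟩ := exists_outerArc_eq he
    exact ⟨δ, rfl, outerSrc_outerRev x δ, hpos⟩
  have hinl : ∀ d, G.src d = x ↔ G.outerSrc x (.inl d) = none := fun d => by
    rw [← attach_mem_cycleAt_iff hxtop, ← contract_eq_none]
    rfl
  have hposrev : ∀ δ, 0 < φ (G.outerArc x (G.outerRev x δ)) →
      (toX (G.outerSrc x δ) ∨ fromX (G.outerSrc x (G.outerRev x δ))) → pos (G.outerRev x δ) :=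
    fun δ h1 h2 => ⟨h1, by rwa [outerRev_outerRev]⟩
  have hB : ∀ w ∉ B, (∃ δ, G.outerSrc x δ = w ∧ pos δ) ↔
      ∃ δ, G.outerSrc x δ = w ∧ pos (G.outerRev x δ) := by
    intro w hw
    rcases w with _ | p
    · refine iff_of_true ?_ ?_
      · obtain ⟨d, hd, hd'⟩ := hout
        refine ⟨.inl d, (hinl d).1 hd, hd', Or.inr ?_⟩
        rw [(hinl d).1 hd]
      · obtain ⟨d, hd, hd'⟩ := hin
        refine ⟨.inl d, (hinl d).1 hd, hposrev (.inl d) hd' (Or.inl ?_)⟩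
        rw [(hinl d).1 hd]
    · have hincoming : fromX (some p) → ∃ δ, G.outerSrc x δ = some p ∧ pos (G.outerRev x δ) := by
        intro h
        rcases Relation.ReflTransGen.cases_tail h with h | ⟨u, hu, hup⟩
        · cases h
        · obtain ⟨δ, rfl, hδ, hδ'⟩ := hstep' hup
          refine ⟨G.outerRev x δ, hδ, ?_⟩
          rw [outerRev_outerRev]
          exact ⟨hδ', Or.inr hu⟩
      have houtgoing : toX (some p) → ∃ δ, G.outerSrc x δ = some p ∧ pos δ := by
        intro h
        rcases Relation.ReflTransGen.cases_head h with h | ⟨u, hup, hu⟩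
        · cases h
        · obtain ⟨δ, hδ, rfl, hδ'⟩ := hstep' hup
          exact ⟨δ, hδ, hδ', Or.inl hu⟩
      by_cases hpv : p = .plain ⟨v, G.vcap_terminal v (Or.inl hv)⟩
      · have hnot : ¬ toX (some p) := fun h => hreach (hpv ▸ mem_residualReach_of_flowStep h)
        constructor
        · rintro ⟨δ, hδ, hδ', h | h⟩
          · refine absurd (Relation.ReflTransGen.head (hstep δ hδ') h) ?_
            rwa [hδ]
          · exact hincoming (hδ ▸ h)
        · rintro ⟨δ, hδ, hδ', -⟩
          exfalso
          rw [outerSrc, contract_eq_some] at hδ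
          rcases δ with d | ⟨d, b⟩
          · have hsrc : G.src d = v := by
              have h5 : G.attach d = .plain ⟨v, G.vcap_terminal v (Or.inl hv)⟩ := hδ.2.trans hpv
              by_cases h6 : G.vcap (G.src d) = ⊤
              · rw [G.attach_of_eq_top h6] at h5
                simpa using h5
              · rw [G.attach_of_ne_top h6] at h5
                cases h5
            have h6 := hφ.le_cap (.old (G.rev d))
            have h7 : G.cap (G.rev d) = 0 := G.cap_into_source _ (by rwa [G.rev_rev, hsrc])
            have h8 : G.extCap (.old (G.rev d)) = 0 := h7
            rw [h8, nonpos_iff_eq_zero, ENNReal.ofReal_eq_zero] at h6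
            exact absurd hδ' (not_lt.2 h6)
          · have h5 := hδ.2.trans hpv
            cases b <;> cases h5
      · by_cases hfree : ∃ δ, G.outerSrc x δ = some p
        swap
        · exact iff_of_false (fun ⟨δ, h, _⟩ => hfree ⟨δ, h⟩) fun ⟨δ, h, _⟩ => hfree ⟨δ, h⟩
        obtain ⟨δ₀, hδ₀⟩ := hfree
        rw [outerSrc, contract_eq_some] at hδ₀
        have hps : p ≠ .s ∧ p ≠ .t := hδ₀.2 ▸ (isFree_outerArc x δ₀).extTail_ne
        have hterm : ∀ w, p = .plain w → w.1 ∉ G.S ∧ w.1 ∉ G.T := by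
          rintro w rfl
          refine ⟨fun hw' => hw ?_, fun hw' => hw ?_⟩
          · refine Finset.mem_union_left _ (Finset.mem_image.2 ⟨⟨w.1, Finset.mem_erase.2
              ⟨fun h => hpv ?_, hw'⟩⟩, Finset.mem_attach _ _, rfl⟩)
            exact congrArg ExtVertex.plain (Subtype.ext h)
          · exact Finset.mem_union_right _ (Finset.mem_image.2 ⟨⟨w.1, hw'⟩,
              Finset.mem_attach _ _, rfl⟩)
        have hpC : p ∉ G.cycleAt x := hδ₀.2 ▸ hδ₀.1
        have hcons := hφ.exists_out_iff_exists_in hF hpC hps.1 hps.2 hterm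
        constructor
        · rintro ⟨δ, hδ, hδ', h | h⟩
          · have hto : toX (some p) := hδ ▸ Relation.ReflTransGen.head (hstep δ hδ') h
            obtain ⟨e, he, he', hpos⟩ := hcons.1 ⟨_, isFree_outerArc x δ,
              (contract_eq_some.1 hδ).2, hδ'⟩
            obtain ⟨ε, hε⟩ := exists_outerArc_eq (G.isFree_extRev.2 he)
            have hεp : G.outerSrc x ε = some p := by
              rw [outerSrc, hε, contract_eq_some]
              rw [← he'] at hpC
              exact ⟨hpC, he'⟩
            refine ⟨ε, hεp, hposrev _ ?_ (Or.inl (hεp ▸ hto))⟩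
            rwa [outerArc_outerRev, hε, extRev_extRev]
          · exact hincoming (hδ ▸ h)
        · rintro ⟨δ, hδ, hδ', h⟩
          rw [outerRev_outerRev] at h
          rcases h with h | h
          · exact houtgoing (hδ ▸ h)
          · have hfrom : fromX (some p) := by
              have := h.tail (hstep _ hδ')
              rwa [outerRev_outerRev, hδ] at this
            rw [outerArc_outerRev] at hδ'
            obtain ⟨e, he, he', hpos⟩ := hcons.2 ⟨_, G.isFree_extRev.2 (isFree_outerArc x δ), by
              rw [extHead_extRev]
              exact (contract_eq_some.1 hδ).2, hδ'⟩
            obtain ⟨ε, hε⟩ := exists_outerArc_eq he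
            have hεp : G.outerSrc x ε = some p := by
              rw [outerSrc, hε, contract_eq_some]
              exact ⟨he' ▸ hpC, he'⟩
            exact ⟨ε, hεp, by rwa [hε], Or.inr (hεp ▸ hfrom)⟩
  have hx₀ : ∃ δ, G.outerSrc x δ = none ∧ pos (G.outerRev x δ) := by
    obtain ⟨d, hd, hd'⟩ := hin
    refine ⟨.inl d, (hinl d).1 hd, hposrev (.inl d) hd' (Or.inl ?_)⟩
    rw [(hinl d).1 hd]
  obtain ⟨I, h1, h2, h3, h4⟩ := (isPlaneRotation_outer (G := G) x).exists_separator
    (outerRev_outerRev x) (outerRev_ne x) (outerSrc_eq_iff hxtop) (pos := pos)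
    (fun u hu => hφ.acyclic u (Relation.TransGen.mono (by
      rintro _ _ ⟨δ, rfl, rfl, h⟩
      exact hstep δ h.1) _ _ hu)) B hB hx₀
  refine ⟨{d | (Sum.inl d : G.OuterDart x) ∈ I}, fun d hd => (hinl d).2 (h1 _ hd),
    fun d hd hd' => h2 (.inl d) ((hinl d).1 hd) (hposrev (.inl d) hd' (Or.inl ?_)),
    fun d hd hd' => h3 (.inl d) ((hinl d).1 hd) ⟨hd', Or.inr ?_⟩, ?_⟩
  · rw [(hinl d).1 hd]
  · rw [(hinl d).1 hd]
  · have h5 : {d | (Sum.inl d : G.OuterDart x) ∈ I ∧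
        (Sum.inl (G.rot d) : G.OuterDart x) ∉ I}.ncard ≤
        {δ | δ ∈ I ∧ G.outerRot x δ ∉ I}.ncard := by
      rw [← Set.ncard_image_of_injective _ (Sum.inl_injective : (Sum.inl : D →
        G.OuterDart x).Injective)]
      refine Set.ncard_le_ncard ?_ (Set.toFinite _)
      rintro _ ⟨d, ⟨hd, hd'⟩, rfl⟩
      refine ⟨hd, ?_⟩
      have : ¬ G.Inflated x d := fun h => h.2 ((hinl d).2 (h1 _ hd))
      rwa [outerRot, inflateRot_inl_of_notMem this]
    exact h5.trans (by omega)

end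

end PlaneNetwork

/-! ### The flow left at the vertex and the reachability of the sources -/

namespace PlaneNetwork

variable {V D : Type*} {G : PlaneNetwork V D}

section

variable [Fintype D] [Fintype G.ExtArc] [Finite V] {F : G.ExtArc → ℝ≥0} {x : V}

open Classical in
theorem netOut_cycleAt (hxtop : G.vcap x ≠ ⊤) (ψ : G.ExtArc → ℝ) :
    netOut G.extTail G.extHead ψ (G.cycleAt x) =
      ∑ d, if G.src d = x then ψ (.old d) - ψ (.old (G.rev d)) else 0 := by
  have hold : ∀ d, (G.cycleAt x).indicator (1 : G.ExtVertex → ℝ) (G.extTail (.old d)) -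
      (G.cycleAt x).indicator 1 (G.extHead (.old d)) =
        (if G.src d = x then 1 else 0) - if G.src (G.rev d) = x then 1 else 0 := fun d => by
    change (G.cycleAt x).indicator 1 (G.attach d) -
      (G.cycleAt x).indicator 1 (G.attach (G.rev d)) = _
    simp only [Set.indicator_apply, attach_mem_cycleAt_iff hxtop, Pi.one_apply]
  have hcyc : ∀ d b, (G.cycleAt x).indicator (1 : G.ExtVertex → ℝ) (G.extTail (.cyc d b)) -
      (G.cycleAt x).indicator 1 (G.extHead (.cyc d b)) = 0 := fun d b => by
    change _ - (G.cycleAt x).indicator 1 (G.extTail (.cyc d !b)) = _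
    simp only [Set.indicator_apply, G.extTail_cyc_mem_cycleAt_iff, Pi.one_apply, sub_self]
  have hsuper : ∀ v b, (G.cycleAt x).indicator (1 : G.ExtVertex → ℝ) (G.extTail (.super v b)) -
      (G.cycleAt x).indicator 1 (G.extHead (.super v b)) = 0 := fun v b => by
    change _ - (G.cycleAt x).indicator 1 (G.extTail (.super v !b)) = _
    simp only [Set.indicator_apply, G.extTail_super_notMem_cycleAt, if_false, sub_self]
  have hsink : ∀ v b, (G.cycleAt x).indicator (1 : G.ExtVertex → ℝ) (G.extTail (.toSink v b)) -
      (G.cycleAt x).indicator 1 (G.extHead (.toSink v b)) = 0 := fun v b => by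
    change _ - (G.cycleAt x).indicator 1 (G.extTail (.toSink v !b)) = _
    simp only [Set.indicator_apply, G.extTail_toSink_notMem_cycleAt, if_false, sub_self]
  rw [netOut, G.sum_extArc]
  simp only [hold, hcyc, hsuper, hsink, mul_zero, Finset.sum_const_zero, add_zero]
  have h1 : ∑ d, ψ (.old d) * (if G.src (G.rev d) = x then 1 else 0) =
      ∑ d, ψ (.old (G.rev d)) * (if G.src d = x then 1 else 0) := by
    rw [← Equiv.sum_comp G.rev]
    simp only [G.rev_rev]
  simp only [mul_sub, Finset.sum_sub_distrib, h1]
  rw [← Finset.sum_sub_distrib]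
  refine Finset.sum_congr rfl fun d _ => ?_
  split_ifs <;> simp

-- The difference between `φ` and `F` is balanced at every vertex outside `C_x` and on the whole
-- vertex set, hence on `C_x`, where `F` is balanced.
open Classical in
theorem IsOptimal.sum_src_eq (hxtop : G.vcap x ≠ ⊤) (hF : G.extended.IsFeasibleFlow F)
    {φ : G.ExtArc → ℝ} (hφ : G.IsOptimal F x φ) :
    (∑ d, if G.src d = x then φ (.old d) - φ (.old (G.rev d)) else 0) = 0 := by
  have hsub : ∀ A, netOut G.extTail G.extHead (φ - fun e => (F e : ℝ)) A =
      netOut G.extTail G.extHead φ A - netOut G.extTail G.extHead (fun e => (F e : ℝ)) A :=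
    fun A => by
      have := netOut_add G.extTail G.extHead (φ - fun e => (F e : ℝ)) (fun e => (F e : ℝ)) A
      rw [sub_add_cancel] at this
      rw [this, add_sub_cancel_right]
  have h1 : netOut G.extTail G.extHead (φ - fun e => (F e : ℝ)) (G.cycleAt x)ᶜ = 0 :=
    netOut_eq_zero _ _ _ _ fun p hp => by rw [hsub, hφ.conservation p hp, sub_self]
  have h2 := netOut_union G.extTail G.extHead (φ - fun e => (F e : ℝ))
    (disjoint_compl_right (a := G.cycleAt x))
  rw [Set.union_compl_self, netOut_univ, h1, add_zero, hsub] at h2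
  have h3 : netOut G.extTail G.extHead (fun e => (F e : ℝ)) (G.cycleAt x) = 0 := by
    refine netOut_eq_zero _ _ _ _ fun p hp => (FlowNetwork.isFeasibleFlow_iff.1 hF).1 p ?_ ?_
    · rintro rfl
      exact G.s_notMem_cycleAt hp
    · rintro rfl
      exact G.t_notMem_cycleAt hp
  rw [← netOut_cycleAt hxtop φ]
  linarith

open Classical in
/-- As long as more flow than `c(x)` is left at `x`, both sources can be reached from `x` in the
residual graph. -/
theorem IsOptimal.source_mem_residualReach (hS : G.S.card = 2) (hT : G.T.card = 1)
    (hxtop : G.vcap x ≠ ⊤) (hF : G.extended.IsFeasibleFlow F)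
    (hacyclic : G.toFlowNetwork.IsAcyclicFlow (G.restrict F)) {φ : G.ExtArc → ℝ}
    (hφ : G.IsOptimal F x φ)
    (hlt : (G.vcap x).toReal < ∑ d, if G.src d = x then φ (.old (G.rev d)) else 0)
    {v : V} (hv : v ∈ G.S) :
    ExtVertex.plain ⟨v, G.vcap_terminal v (Or.inl hv)⟩ ∈ G.residualReach x φ := by
  by_contra hreach
  have hsum := hφ.sum_src_eq hxtop hF
  have hsub : (∑ d, if G.src d = x then φ (.old d) - φ (.old (G.rev d)) else 0) =
      (∑ d, if G.src d = x then φ (.old d) else 0) -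
        ∑ d, if G.src d = x then φ (.old (G.rev d)) else 0 := by
    rw [← Finset.sum_sub_distrib]
    exact Finset.sum_congr rfl fun d _ => by split_ifs <;> simp
  have hlt' : (G.vcap x).toReal < ∑ d, if G.src d = x then φ (.old d) else 0 := by linarith
  have hex : ∀ ψ : D → ℝ, (∀ d, 0 ≤ ψ d) →
      (G.vcap x).toReal < (∑ d, if G.src d = x then ψ d else 0) → ∃ d, G.src d = x ∧ 0 < ψ d := by
    intro ψ h0 h
    have h1 : 0 < ∑ d, if G.src d = x then ψ d else 0 := ENNReal.toReal_nonneg.trans_lt h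
    rw [Finset.sum_pos_iff_of_nonneg fun d _ => by split_ifs <;> simp [h0]] at h1
    obtain ⟨d, -, hd⟩ := h1
    by_cases hd' : G.src d = x
    · exact ⟨d, hd', by simpa [hd'] using hd⟩
    · simp [hd'] at hd
  have hin := hex _ (fun d => hφ.nonneg _) hlt
  have hout := hex _ (fun d => hφ.nonneg _) hlt'
  have hle : ∀ d, G.src d = x → φ (.old d) ≤ F (.old d) := fun d hd =>
    hφ.le_of_tail _ ((attach_mem_cycleAt_iff hxtop).2 hd)
  have hle' : ∀ d, G.src d = x → φ (.old (G.rev d)) ≤ F (.old (G.rev d)) := fun d hd =>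
    hφ.le_of_head _ ((attach_mem_cycleAt_iff hxtop).2 (by rwa [G.rev_rev]))
  -- One interval `I` for `φ` and at most two in `J` for `F`: by submodularity `I ∩ J` and `I ∪ J`
  -- have at most three exits together, so one of them has at most one.
  obtain ⟨I, I1, I2, I3, I4⟩ := hφ.exists_separator hS hT hxtop hF hv hreach hin hout
  obtain ⟨J, J1, J2, J3, J4⟩ := exists_separator_restrict (x := x) hS hT hF hacyclic (by
    obtain ⟨d, hd, hd'⟩ := hin
    exact ⟨d, hd, by exact_mod_cast hd'.trans_le (hle' d hd)⟩)
  have hmod := ncard_exits_submodular G.rot I J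
  have hc : 0 ≤ (G.vcap x).toReal := ENNReal.toReal_nonneg
  rcases Nat.lt_or_ge {d | d ∈ I ∩ J ∧ G.rot d ∉ I ∩ J}.ncard 2 with h | h
  -- All of `φ` enters `x` within `I ∩ J`, where `F` dominates it and has no outgoing arc. Hence the
  -- cut bound for `F` also bounds what `φ` brings into `x`.
  · have hcut := abs_sum_sub_le hF hxtop (J := I ∩ J) fun d hd => I1 d hd.1
    have h1 : (({d | d ∈ I ∩ J ∧ G.rot d ∉ I ∩ J}.ncard : ℕ) : ℝ) ≤ 1 := by
      exact_mod_cast Nat.le_of_lt_succ h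
    have h2 : (∑ d, if G.src d = x then φ (.old (G.rev d)) else 0) ≤
        -∑ d, if d ∈ I ∩ J then ((F (.old d) : ℝ) - F (.old (G.rev d))) else 0 := by
      rw [← Finset.sum_neg_distrib]
      refine Finset.sum_le_sum fun d _ => ?_
      by_cases hd : d ∈ I ∩ J
      · have h3 : F (.old d) = 0 := by
          by_contra h0
          exact J3 d (I1 d hd.1) (pos_iff_ne_zero.2 h0) hd.2
        simpa [hd, I1 d hd.1, h3] using hle' d (I1 d hd.1)
      · rw [if_neg hd, neg_zero]
        split_ifs with hdx
        · by_contra! h0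
          refine hd ⟨I2 d hdx h0, J2 d hdx ?_⟩
          exact_mod_cast h0.trans_le (hle' d hdx)
        · exact le_rfl
    have h3 := neg_le_of_abs_le hcut
    have h4 := mul_le_of_le_one_left hc h1
    refine absurd (hlt.trans_le (h2.trans (le_trans ?_ h4))) (lt_irrefl _)
    rw [neg_le]
    convert h3
  -- Now the complement of `I ∪ J` at `x` is at most one interval. It contains every arc on which
  -- `φ` leaves `x` and none on which `F` enters, so the flow out of `x` is bounded instead.
  · have hJ'exits : {d | d ∈ {d | G.src d = x ∧ d ∉ I ∪ J} ∧
        G.rot d ∉ {d | G.src d = x ∧ d ∉ I ∪ J}}.ncard ≤ 1 := by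
      have h1 := ncard_entries G.rot (I ∪ J)
      refine le_trans (Set.ncard_le_ncard ?_ (Set.toFinite _)) (h1.trans_le (by omega))
      rintro d ⟨⟨hd, hd'⟩, hd''⟩
      refine ⟨hd', ?_⟩
      by_contra h2
      exact hd'' ⟨by rw [G.src_rot, hd], h2⟩
    have hcut := abs_sum_sub_le hF hxtop (J := {d | G.src d = x ∧ d ∉ I ∪ J}) fun d hd => hd.1
    have h1 : (({d | d ∈ {d | G.src d = x ∧ d ∉ I ∪ J} ∧
        G.rot d ∉ {d | G.src d = x ∧ d ∉ I ∪ J}}.ncard : ℕ) : ℝ) ≤ 1 := by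
      exact_mod_cast hJ'exits
    have h2 : (∑ d, if G.src d = x then φ (.old d) else 0) ≤
        ∑ d, if d ∈ {d | G.src d = x ∧ d ∉ I ∪ J} then
          ((F (.old d) : ℝ) - F (.old (G.rev d))) else 0 := by
      refine Finset.sum_le_sum fun d _ => ?_
      by_cases hd : d ∈ {d | G.src d = x ∧ d ∉ I ∪ J}
      · have h3 : F (.old (G.rev d)) = 0 := by
          by_contra h0
          exact hd.2 (Or.inr (J2 d hd.1 (pos_iff_ne_zero.2 h0)))
        rw [if_pos hd, if_pos hd.1, h3, NNReal.coe_zero, sub_zero]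
        exact hle d hd.1
      · rw [if_neg hd]
        split_ifs with hdx
        · by_contra! h0
          refine hd ⟨hdx, ?_⟩
          rintro (h4 | h4)
          · exact I3 d hdx h0 h4
          · refine J3 d hdx ?_ h4
            exact_mod_cast h0.trans_le (hle d hdx)
        · exact le_rfl
    have h3 := le_of_abs_le hcut
    have h4 := mul_le_of_le_one_left hc h1
    refine absurd (hlt'.trans_le (h2.trans (le_trans ?_ h4))) (lt_irrefl _)
    convert h3

end

/-! ### The flow in `H` -/

/-- The arcs of `H` by kind. -/
def auxArcEquiv (f : D → ℝ≥0) (x : V) : G.AuxArc f x ≃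
    {e : G.ExtArc // G.extended.tail e ∉ G.cycleAt x ∧ G.extended.head e ∉ G.cycleAt x} ⊕
      ({d : D // G.src d = x ∧ G.src (G.rev d) ≠ x ∧ 0 < f (G.rev d)} ⊕
        {d : D // G.src d = x ∧ G.src (G.rev d) ≠ x ∧ 0 < f d}) where
  toFun
    | .ext e => .inl e
    | .fromIn d => .inr (.inl d)
    | .toOut d => .inr (.inr d)
  invFun
    | .inl e => .ext e
    | .inr (.inl d) => .fromIn d
    | .inr (.inr d) => .toOut d
  left_inv a := by cases a <;> rfl
  right_inv a := by rcases a with _ | _ | _ <;> rfl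

instance [Finite D] (f : D → ℝ≥0) (x : V) : Finite (G.AuxArc f x) :=
  Finite.of_equiv _ (auxArcEquiv f x).symm

open Classical in
theorem sum_auxArc [Fintype D] [Fintype G.ExtArc] {f : D → ℝ≥0} {x : V} [Fintype (G.AuxArc f x)]
    {Ψ : G.AuxArc f x → ℝ} {ψ₁ : G.ExtArc → ℝ} {ψ₂ ψ₃ : D → ℝ} (h₁ : ∀ e, Ψ (.ext e) = ψ₁ e.1)
    (h₂ : ∀ d, Ψ (.fromIn d) = ψ₂ d.1) (h₃ : ∀ d, Ψ (.toOut d) = ψ₃ d.1) :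
    ∑ a, Ψ a = (∑ e, if G.extTail e ∉ G.cycleAt x ∧ G.extHead e ∉ G.cycleAt x then ψ₁ e else 0) +
      ((∑ d, if G.src d = x ∧ G.src (G.rev d) ≠ x ∧ 0 < f (G.rev d) then ψ₂ d else 0) +
        ∑ d, if G.src d = x ∧ G.src (G.rev d) ≠ x ∧ 0 < f d then ψ₃ d else 0) := by
  rw [← Equiv.sum_comp (auxArcEquiv f x).symm, Fintype.sum_sum_type, Fintype.sum_sum_type,
    ← Finset.sum_filter, ← Finset.sum_filter, ← Finset.sum_filter]
  congr 1
  · rw [Finset.sum_subtype (Finset.univ.filter fun e => G.extTail e ∉ G.cycleAt x ∧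
      G.extHead e ∉ G.cycleAt x) (p := fun e => G.extended.tail e ∉ G.cycleAt x ∧
        G.extended.head e ∉ G.cycleAt x) (fun e => by simp; rfl)]
    exact Finset.sum_congr rfl fun e _ => h₁ e
  · congr 1
    · rw [Finset.sum_subtype _ (p := fun d => G.src d = x ∧ G.src (G.rev d) ≠ x ∧ 0 < f (G.rev d))
        (fun e => by simp)]
      exact Finset.sum_congr rfl fun e _ => h₂ e
    · rw [Finset.sum_subtype _ (p := fun d => G.src d = x ∧ G.src (G.rev d) ≠ x ∧ 0 < f d)
        (fun e => by simp)]
      exact Finset.sum_congr rfl fun e _ => h₃ e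

/-- The flow in `H` that changes `F` to `φ` outside `C_x`. -/
noncomputable def reroute (F : G.ExtArc → ℝ≥0) (x : V) (φ : G.ExtArc → ℝ) :
    G.AuxArc (G.restrict F) x → ℝ≥0
  | .ext e => (φ e.1 - F e.1 - (φ (G.extRev e.1) - F (G.extRev e.1))).toNNReal
  | .fromIn d => (F (.old (G.rev d.1)) - φ (.old (G.rev d.1))).toNNReal
  | .toOut d => (F (.old d.1) - φ (.old d.1)).toNNReal

section

variable {F : G.ExtArc → ℝ≥0} {x : V}

theorem aux_head_notMem_source (e : G.AuxArc (G.restrict F) x) :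
    (G.aux F x).head e ∉ (G.aux F x).source := by
  rintro ⟨a, ha⟩
  cases e <;> cases ha

theorem aux_disjoint : Disjoint (G.aux F x).source (G.aux F x).sink := by
  rw [Set.disjoint_left]
  rintro _ ⟨a, rfl⟩ ⟨b, hb⟩
  cases hb

variable [Fintype D] [Fintype G.ExtArc] [Finite V] {φ : G.ExtArc → ℝ}

/-- A residual flow uses only one direction of each edge. Passing from the change of `φ` to its net
positive part adds a function `η` that agrees on an arc and its reversal, and such a function has
balance zero. -/
theorem sum_outer_eq (p : G.ExtVertex) :
    open Classical in
    (∑ e, if G.extTail e ∉ G.cycleAt x ∧ G.extHead e ∉ G.cycleAt x then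
      (max (φ e - F e - (φ (G.extRev e) - F (G.extRev e))) 0) *
        (({p} : Set _).indicator 1 (G.extTail e) - ({p} : Set _).indicator 1 (G.extHead e))
          else 0) =
      ∑ e, if G.extTail e ∉ G.cycleAt x ∧ G.extHead e ∉ G.cycleAt x then (φ e - F e) *
        (({p} : Set _).indicator 1 (G.extTail e) - ({p} : Set _).indicator 1 (G.extHead e))
          else 0 := by
  classical
  set η : G.ExtArc → ℝ := fun e =>
    max (φ e - F e - (φ (G.extRev e) - F (G.extRev e))) 0 - (φ e - F e)
  have hη : ∀ e, η (G.extRev e) = η e := fun e => by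
    simp only [η, extRev_extRev]
    rcases le_total (φ e - F e) (φ (G.extRev e) - F (G.extRev e)) with h | h
    · rw [max_eq_left (by linarith), max_eq_right (by linarith)]
      ring
    · rw [max_eq_right (by linarith), max_eq_left (by linarith)]
      ring
  rw [← sub_eq_zero, ← Finset.sum_sub_distrib]
  set w : G.ExtArc → ℝ := fun e => if G.extTail e ∉ G.cycleAt x ∧ G.extHead e ∉ G.cycleAt x then
    η e * (({p} : Set _).indicator 1 (G.extTail e) - ({p} : Set _).indicator 1 (G.extHead e))
      else 0
  have hw : ∀ e, w (G.extRev e) = -w e := fun e => by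
    simp only [w, extHead_extRev, hη]
    change (if G.extHead e ∉ G.cycleAt x ∧ _ then
      η e * (({p} : Set _).indicator 1 (G.extHead e) - _) else 0) = _
    by_cases h1 : G.extTail e ∈ G.cycleAt x <;> by_cases h2 : G.extHead e ∈ G.cycleAt x <;>
      simp [h1, h2]
    ring
  have h1 : ∑ e, w e = -∑ e, w e := by
    conv_lhs => rw [← Equiv.sum_comp G.extRevPerm]
    rw [← Finset.sum_neg_distrib]
    exact Finset.sum_congr rfl fun e _ => hw e
  refine Eq.trans ?_ (self_eq_neg.1 h1)
  refine Finset.sum_congr rfl fun e _ => ?_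
  simp only [w, η]
  split_ifs
  · ring
  · simp

/-- The balance at a vertex outside `C_x` is that of the change from `F` to `φ`, namely zero: a
decrease on an arc at `x` is a flow on its reversal, from `x^in` or to `x^out`. Where `F` vanishes
at `x`, so does `φ`; hence the arcs that `H` leaves out contribute nothing. -/
theorem IsOptimal.isFeasibleFlow_reroute (hφ : G.IsOptimal F x φ) (hxtop : G.vcap x ≠ ⊤) :
    (G.aux F x).IsFeasibleFlow (G.reroute F x φ) := by
  classical
  have := Fintype.ofFinite (G.AuxArc (G.restrict F) x)
  have hle : ∀ d, G.src d = x → φ (.old d) ≤ F (.old d) := fun d hd =>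
    hφ.le_of_tail _ ((attach_mem_cycleAt_iff hxtop).2 hd)
  have hle' : ∀ d, G.src d = x → φ (.old (G.rev d)) ≤ F (.old (G.rev d)) := fun d hd =>
    hφ.le_of_head _ ((attach_mem_cycleAt_iff hxtop).2 (by rwa [G.rev_rev]))
  refine FlowNetwork.isFeasibleFlow_iff.2 ⟨fun q hq hq' => ?_, fun a => ?_⟩
  · rcases q with ⟨p, hp⟩ | a | b
    rotate_left
    · exact absurd ⟨a, rfl⟩ hq
    · exact absurd ⟨b, rfl⟩ hq'
    have hind : ∀ q : {p // p ∉ G.cycleAt x}, ({AuxVertex.ext ⟨p, hp⟩} :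
        Set (G.AuxVertex (G.restrict F) x)).indicator (1 : G.AuxVertex (G.restrict F) x → ℝ)
          (.ext q) =
        ({p} : Set G.ExtVertex).indicator 1 q.1 := fun q => by
      simp [Set.indicator_apply, Subtype.ext_iff]
    have hindin : ∀ a, ({AuxVertex.ext ⟨p, hp⟩} :
        Set (G.AuxVertex (G.restrict F) x)).indicator (1 : G.AuxVertex (G.restrict F) x → ℝ)
          (.xin a) = 0 := fun a => by
      simp
    have hindout : ∀ a, ({AuxVertex.ext ⟨p, hp⟩} :
        Set (G.AuxVertex (G.restrict F) x)).indicator (1 : G.AuxVertex (G.restrict F) x → ℝ)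
          (.xout a) = 0 := fun a => by
      simp
    rw [netOut, sum_auxArc
      (ψ₁ := fun e => (max (φ e - F e - (φ (G.extRev e) - F (G.extRev e))) 0) *
        (({p} : Set _).indicator 1 (G.extTail e) - ({p} : Set _).indicator 1 (G.extHead e)))
      (ψ₂ := fun d => -((F (.old (G.rev d)) - φ (.old (G.rev d))) *
        ({p} : Set _).indicator 1 (G.attach (G.rev d))))
      (ψ₃ := fun d => (F (.old d) - φ (.old d)) * ({p} : Set _).indicator 1 (G.attach (G.rev d)))]
    rotate_left
    · intro e
      simp only [reroute, Real.coe_toNNReal']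
      congr 1
      exact congrArg₂ (· - ·) (hind ⟨_, e.2.1⟩) (hind ⟨_, e.2.2⟩)
    · intro d
      simp only [reroute]
      rw [Real.coe_toNNReal _ (sub_nonneg.2 (hle' d.1 d.2.1))]
      have := hind ⟨G.attach (G.rev d.1), G.attach_notMem_cycleAt d.2.2.1⟩
      refine (congrArg (_ * ·) (congrArg₂ (· - ·) (hindin _) this)).trans ?_
      simp
    · intro d
      simp only [reroute]
      rw [Real.coe_toNNReal _ (sub_nonneg.2 (hle d.1 d.2.1))]
      have := hind ⟨G.attach (G.rev d.1), G.attach_notMem_cycleAt d.2.2.1⟩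
      refine (congrArg (_ * ·) (congrArg₂ (· - ·) this (hindout _))).trans ?_
      simp
    rw [sum_outer_eq p]
    have key : netOut G.extTail G.extHead (φ - fun e => (F e : ℝ)) {p} = 0 := by
      have := netOut_add G.extTail G.extHead (φ - fun e => (F e : ℝ)) (fun e => (F e : ℝ)) {p}
      rw [sub_add_cancel, hφ.conservation p hp] at this
      linarith
    have hfree : ∀ e, ¬ G.IsFree x e → φ e - F e = 0 := fun e he => by
      rw [hφ.eq_of_not_isFree e he, sub_self]
    have hsplit : ∀ e, (φ e - F e) * (({p} : Set _).indicator 1 (G.extTail e) -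
        ({p} : Set _).indicator 1 (G.extHead e)) =
        (if G.extTail e ∉ G.cycleAt x ∧ G.extHead e ∉ G.cycleAt x then (φ e - F e) *
          (({p} : Set _).indicator 1 (G.extTail e) - ({p} : Set _).indicator 1 (G.extHead e))
            else 0) +
        (if G.extTail e ∉ G.cycleAt x ∧ G.extHead e ∉ G.cycleAt x then 0 else (φ e - F e) *
          (({p} : Set _).indicator 1 (G.extTail e) - ({p} : Set _).indicator 1 (G.extHead e))) :=
      fun e => by split_ifs <;> simp
    replace key := (Finset.sum_congr rfl fun e _ => hsplit e).symm.trans key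
    rw [Finset.sum_add_distrib] at key
    refine Eq.trans (congrArg _ ?_) key
    have hcyc : ∀ d b, (if G.extTail (.cyc d b) ∉ G.cycleAt x ∧
        G.extHead (.cyc d b) ∉ G.cycleAt x then 0 else (φ (.cyc d b) - F (.cyc d b)) *
          (({p} : Set _).indicator 1 (G.extTail (.cyc d b)) -
            ({p} : Set _).indicator 1 (G.extHead (.cyc d b)))) = 0 := fun d b => by
      have h2 : G.extHead (.cyc d b) ∈ G.cycleAt x ↔ G.src d.1 = x :=
        G.extTail_cyc_mem_cycleAt_iff (b := !b)
      rw [G.extTail_cyc_mem_cycleAt_iff, h2]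
      by_cases h : G.src d.1 = x
      · rw [hfree (.cyc d b) (fun h' => h' h), zero_mul, ite_self]
      · rw [if_pos ⟨h, h⟩]
    have hold : ∀ d, (if G.extTail (.old d) ∉ G.cycleAt x ∧
        G.extHead (.old d) ∉ G.cycleAt x then 0 else (φ (.old d) - F (.old d)) *
          (({p} : Set _).indicator 1 (G.extTail (.old d)) -
            ({p} : Set _).indicator 1 (G.extHead (.old d)))) =
        (if G.src (G.rev d) = x ∧ G.src d ≠ x then
          (φ (.old d) - F (.old d)) * ({p} : Set _).indicator 1 (G.attach d) else 0) +
        (if G.src d = x ∧ G.src (G.rev d) ≠ x then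
          (F (.old d) - φ (.old d)) * ({p} : Set _).indicator 1 (G.attach (G.rev d)) else 0) :=
      fun d => by
      have h1 : G.extTail (.old d) ∈ G.cycleAt x ↔ G.src d = x := attach_mem_cycleAt_iff hxtop
      have h2 : G.extHead (.old d) ∈ G.cycleAt x ↔ G.src (G.rev d) = x :=
        attach_mem_cycleAt_iff hxtop
      have hzero : ∀ d, G.src d = x →
          ({p} : Set _).indicator (1 : G.ExtVertex → ℝ) (G.attach d) = 0 := fun d hd => by
        have : G.attach d ≠ p := fun h => hp (h ▸ (attach_mem_cycleAt_iff hxtop).2 hd)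
        simp [this]
      rw [h1, h2]
      change (if _ then _ else _ * (({p} : Set _).indicator 1 (G.attach d) -
            ({p} : Set _).indicator 1 (G.attach (G.rev d)))) = _
      by_cases h3 : G.src d = x <;> by_cases h4 : G.src (G.rev d) = x
      · rw [hzero _ h3, hzero _ h4]
        simp [h3, h4]
      · rw [hzero _ h3, if_neg (fun h => h.1 h3), if_neg (fun h => h4 h.1), if_pos ⟨h3, h4⟩]
        ring
      · rw [hzero _ h4, if_neg (fun h => h.2 h4), if_pos ⟨h4, h3⟩, if_neg (fun h => h3 h.1)]
        ring
      · simp [h3, h4]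
    rw [G.sum_extArc]
    simp only [hcyc, hold, hfree (.super _ _) id, hfree (.toSink _ _) id, zero_mul, ite_self,
      Finset.sum_const_zero, add_zero, Finset.sum_add_distrib]
    rw [← Equiv.sum_comp G.rev fun d => if G.src (G.rev d) = x ∧ G.src d ≠ x then _ else _]
    simp only [G.rev_rev]
    refine congrArg₂ (· + ·) (Finset.sum_congr rfl fun d _ => ?_)
      (Finset.sum_congr rfl fun d _ => ?_)
    · by_cases h : G.src d = x ∧ G.src (G.rev d) ≠ x
      · rw [if_pos h]
        by_cases h' : 0 < G.restrict F (G.rev d)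
        · rw [if_pos ⟨h.1, h.2, h'⟩]
          ring
        · have h0 : F (.old (G.rev d)) = 0 := by simpa [restrict] using h'
          have h1 := hle' d h.1
          rw [h0, NNReal.coe_zero] at h1
          rw [if_neg fun h3 => h' h3.2.2, le_antisymm h1 (hφ.nonneg _), h0]
          simp
      · rw [if_neg h, if_neg fun h' => h ⟨h'.1, h'.2.1⟩]
    · by_cases h : G.src d = x ∧ G.src (G.rev d) ≠ x
      · rw [if_pos h]
        by_cases h' : 0 < G.restrict F d
        · rw [if_pos ⟨h.1, h.2, h'⟩]
        · have h0 : F (.old d) = 0 := by simpa [restrict] using h'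
          have h1 := hle d h.1
          rw [h0, NNReal.coe_zero] at h1
          rw [if_neg fun h3 => h' h3.2.2, le_antisymm h1 (hφ.nonneg _), h0]
          simp
      · rw [if_neg h, if_neg fun h' => h ⟨h'.1, h'.2.1⟩]
  · have hsub : ∀ e, ((F e - φ e).toNNReal : ℝ≥0) ≤ F e := fun e =>
      Real.toNNReal_le_iff_le_coe.2 (by linarith [hφ.nonneg e])
    cases a with
    | fromIn d => exact ENNReal.coe_le_coe.2 (hsub _)
    | toOut d => exact ENNReal.coe_le_coe.2 (hsub _)
    | ext e =>
      change ENNReal.ofReal (φ e.1 - F e.1 - (φ (G.extRev e.1) - F (G.extRev e.1))) ≤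
        G.extCap e.1 - F e.1 + F (G.extRev e.1)
      refine le_trans (ENNReal.ofReal_le_ofReal (q := (φ e.1 - F e.1) + F (G.extRev e.1)) ?_)
        (ENNReal.ofReal_add_le.trans (add_le_add ?_ ?_))
      · linarith [hφ.nonneg (G.extRev e.1)]
      · rw [ENNReal.ofReal_sub _ (NNReal.coe_nonneg _), ENNReal.ofReal_coe_nnreal]
        exact tsub_le_tsub_right (hφ.le_cap _) _
      · rw [ENNReal.ofReal_coe_nnreal]

end

end PlaneNetwork

/-! ### Arcs that are not needed -/

namespace FlowNetwork

variable {V E : Type*} {N : FlowNetwork V E} {P : Set E}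

theorem IsAugmentingPath.map_val {p : List {e // e ∉ P}}
    (hp : (N.deleteArcs P).IsAugmentingPath p) : N.IsAugmentingPath (p.map Subtype.val) := by
  obtain ⟨h1, h2, ⟨e, h3, h4⟩, ⟨e', h5, h6⟩⟩ := hp
  refine ⟨(List.isChain_map _).2 h1, ?_, ⟨e.1, by rw [List.head?_map, h3]; rfl, h4⟩,
    ⟨e'.1, by rw [List.getLast?_map, h5]; rfl, h6⟩⟩
  intro a ha
  obtain ⟨b, hb, rfl⟩ := List.mem_map.1 ha
  exact h2 b hb

/-- `g` has value at least `R` or saturates a cut. -/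
def IsMaxUpTo (N : FlowNetwork V E) (R : ℝ≥0∞) (g : E → ℝ≥0) : Prop :=
  N.IsFeasibleFlow g ∧ (R ≤ N.value g ∨ ∃ A : Set V, N.source ⊆ A ∧ (∀ v ∈ A, v ∉ N.sink) ∧
    (∀ e, N.tail e ∈ A → N.head e ∉ A → N.cap e ≤ g e) ∧
      ∀ e, N.tail e ∉ A → N.head e ∈ A → g e = 0)

variable [Finite V] [Fintype E] {R : ℝ≥0∞} {g : E → ℝ≥0}

/-- An augmenting path crosses the saturated cut in an arc of positive capacity, which `g` fills,
while nothing flows back. -/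
theorem IsMaxUpTo.value_pos (hg : N.IsMaxUpTo R g) (hR : 0 < R) (hsource : ∀ e, N.head e ∉ N.source)
    {p : List E} (hp : N.IsAugmentingPath p) : 0 < N.value g := by
  classical
  obtain ⟨hg, h | ⟨A, hA, hA', hout, hin⟩⟩ := hg
  · exact_mod_cast hR.trans_le h
  · obtain ⟨e, he, h1, h2⟩ := hp.exists_leaving hA hA'
    have he0 : 0 < g e := by exact_mod_cast (hp.positive e he).trans_le (hout e h1 h2)
    rw [← NNReal.coe_pos, value_eq_netOut hg hsource hA hA', netOut_eq_cut]
    have h3 : (∑ e, if N.tail e ∉ A ∧ N.head e ∈ A then (g e : ℝ) else 0) = 0 :=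
      Finset.sum_eq_zero fun e _ => by
        split_ifs with h
        · simp [hin e h.1 h.2]
        · rfl
    rw [h3, sub_zero]
    refine Finset.sum_pos' (fun e _ => by split_ifs <;> simp) ⟨e, Finset.mem_univ e, ?_⟩
    rw [if_pos ⟨h1, h2⟩]
    exact he0

theorem IsMaxUpTo.exists_isAugmentingPath_deleteArcs (hg : N.IsMaxUpTo R g) (hR : 0 < R)
    (hsource : ∀ e, N.head e ∉ N.source) (hdisj : Disjoint N.source N.sink)
    (hP : ∀ e ∈ P, g e = 0) (hp : ∃ p, N.IsAugmentingPath p) :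
    ∃ p, (N.deleteArcs P).IsAugmentingPath p := by
  classical
  obtain ⟨p, hp⟩ := hp
  have := Fintype.ofFinite {e // e ∉ P}
  refine exists_isAugmentingPath_of_value_pos ((isFeasibleFlow_deleteArcs_iff hP).2 hg.1)
    (fun e => hsource e.1) hdisj ?_
  rw [value_deleteArcs hP]
  exact hg.value_pos hR hsource hp

theorem IsMaxUpTo.exists_flow_deleteArcs_iff (hg : N.IsMaxUpTo R g)
    (hsource : ∀ e, N.head e ∉ N.source) (hP : ∀ e ∈ P, g e = 0) {r : ℝ≥0} (hr : r ≤ R) :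
    (∃ f, N.IsFeasibleFlow f ∧ N.value f = r) ↔
      ∃ f, (N.deleteArcs P).IsFeasibleFlow f ∧ (N.deleteArcs P).value f = r := by
  classical
  constructor
  · rintro ⟨f, hf, rfl⟩
    have hle : N.value f ≤ N.value g := by
      rcases hg.2 with h | ⟨A, hA, hA', hout, hin⟩
      · exact_mod_cast hr.trans h
      · exact value_le_of_saturated hg.1 hf hsource hA hA' hout hin
    -- Scaling `g` gives the required value without the arcs in `P`. If `g` has value 0, then so has
    -- `f`, and the quotient 0 is right.
    obtain ⟨h1, h2⟩ := isFeasibleFlow_smul hg.1 (c := N.value f / N.value g)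
      (div_le_one_of_le₀ hle zero_le)
    have hP' : ∀ e ∈ P, N.value f / N.value g * g e = 0 := fun e he => by rw [hP e he, mul_zero]
    refine ⟨_, (isFeasibleFlow_deleteArcs_iff hP').2 h1, ?_⟩
    rw [value_deleteArcs hP', h2]
    rcases eq_or_ne (N.value g) 0 with h | h
    · rw [h, mul_zero]
      exact (le_antisymm (hle.trans h.le) zero_le).symm
    · exact div_mul_cancel₀ _ h
  · rintro ⟨f, hf, rfl⟩
    let f' : E → ℝ≥0 := fun e => if h : e ∉ P then f ⟨e, h⟩ else 0
    have hf' : ∀ e ∈ P, f' e = 0 := fun e he => dif_neg (not_not.2 he)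
    have hff' : f = fun e => f' e.1 := funext fun e => by simp [f', e.2]
    rw [hff'] at hf ⊢
    exact ⟨f', (isFeasibleFlow_deleteArcs_iff hf').1 hf, (value_deleteArcs hf').symm⟩

end FlowNetwork

/-! ### The rerouted flow is large or saturates a cut -/

namespace PlaneNetwork

variable {V D : Type*} {G : PlaneNetwork V D} {F : G.ExtArc → ℝ≥0} {x : V}

theorem restrict_loop (hacyclic : G.toFlowNetwork.IsAcyclicFlow (G.restrict F)) {d : D}
    (hd : G.src (G.rev d) = G.src d) : F (.old d) = 0 := by
  by_contra h
  exact hacyclic (G.src d) (.single ⟨d, rfl, hd, pos_iff_ne_zero.2 h⟩)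

theorem ne_of_mem_residualReach {φ : G.ExtArc → ℝ} {p : G.ExtVertex}
    (hp : p ∈ G.residualReach x φ) : p ≠ .s ∧ p ≠ .t := by
  obtain ⟨e, he, -, -, -, hr⟩ := hp
  rcases Relation.ReflTransGen.cases_tail hr with rfl | ⟨_, -, e', he', -, rfl, -⟩
  · exact he.extTail_ne
  · exact (G.isFree_extRev.2 he').extTail_ne

theorem IsOptimal.reroute_ext_of_not_isFree [Fintype G.ExtArc] {φ : G.ExtArc → ℝ}
    (hφ : G.IsOptimal F x φ)
    {e : {e : G.ExtArc // G.extended.tail e ∉ G.cycleAt x ∧ G.extended.head e ∉ G.cycleAt x}}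
    (he : ¬ G.IsFree x e.1) : G.reroute F x φ (.ext e) = 0 := by
  change (φ e.1 - F e.1 - (φ (G.extRev e.1) - F (G.extRev e.1))).toNNReal = 0
  rw [hφ.eq_of_not_isFree _ he,
    hφ.eq_of_not_isFree (G.extRev e.1) fun h => he (G.isFree_extRev.1 h)]
  simp

theorem IsOptimal.reroute_eq_zero_of_mem_supersourceArcs [Fintype G.ExtArc] {φ : G.ExtArc → ℝ}
    (hφ : G.IsOptimal F x φ)
    {e : G.AuxArc (G.restrict F) x} (he : e ∈ G.supersourceArcs F x) :
    G.reroute F x φ e = 0 := by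
  have hinj : ∀ {p : {p // p ∉ G.cycleAt x}},
      (AuxVertex.ext p : G.AuxVertex (G.restrict F) x) = G.auxS _ x → p.1 = .s := fun h => by
    rw [auxS, AuxVertex.ext.injEq] at h
    rw [h]
  rcases e with e | d | d
  · refine hφ.reroute_ext_of_not_isFree fun h => ?_
    rcases he with he | he
    · exact h.extTail_ne.1 (hinj he)
    · exact (G.isFree_extRev.2 h).extTail_ne.1 (hinj he)
  · rcases he with he | he
    · cases he
    · exact absurd (hinj he) (attach_ne _).1
  · rcases he with he | he
    · exact absurd (hinj he) (attach_ne _).1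
    · cases he

/-- The vertices of `G°` that can be reached from `x` in the residual graph. -/
def reachCut (G : PlaneNetwork V D) (F : G.ExtArc → ℝ≥0) (x : V) (φ : G.ExtArc → ℝ) :
    Set (G.AuxVertex (G.restrict F) x)
  -- `s` always belongs to the set, and `t` does exactly if a sink of `G` does. With one sink, and
  -- both sources reached, no arc at `s` or `t` leaves the set.
  | .ext p => p.1 ∈ G.residualReach x φ ∨ p.1 = .s ∨
      p.1 = .t ∧ ∃ v : {v // v ∈ G.T}, .plain ⟨v.1, G.vcap_terminal _ (Or.inr v.2)⟩ ∈
        G.residualReach x φ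
  | .xin _ => True
  | .xout _ => False

theorem ext_mem_reachCut_iff {φ : G.ExtArc → ℝ} {p : {p // p ∉ G.cycleAt x}} (hs : p.1 ≠ .s)
    (ht : p.1 ≠ .t) :
    .ext p ∈ G.reachCut F x φ ↔ p.1 ∈ G.residualReach x φ := by
  change _ ∨ _ ↔ _
  simp [hs, ht]

variable [Fintype D]

open Classical in
theorem coe_inflow_restrict : ((G.toFlowNetwork.inflow (G.restrict F) x : ℝ≥0) : ℝ) =
    ∑ d, if G.src d = x then (F (.old (G.rev d)) : ℝ) else 0 := by
  rw [FlowNetwork.inflow, FlowNetwork.coe_finsum_mem, ← Equiv.sum_comp G.rev]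
  refine Finset.sum_congr rfl fun d _ => ?_
  change (if G.src (G.rev (G.rev d)) = x then (F (.old (G.rev d)) : ℝ) else 0) = _
  rw [G.rev_rev]

variable [Fintype G.ExtArc] {φ : G.ExtArc → ℝ}

open Classical in
theorem IsOptimal.coe_value_reroute (hφ : G.IsOptimal F x φ) (hxtop : G.vcap x ≠ ⊤)
    (hacyclic : G.toFlowNetwork.IsAcyclicFlow (G.restrict F)) :
    (((G.aux F x).value (G.reroute F x φ) : ℝ≥0) : ℝ) =
      ∑ d, if G.src d = x then F (.old (G.rev d)) - φ (.old (G.rev d)) else 0 := by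
  have := Fintype.ofFinite (G.AuxArc (G.restrict F) x)
  have hle' : ∀ d, G.src d = x → φ (.old (G.rev d)) ≤ F (.old (G.rev d)) := fun d hd =>
    hφ.le_of_head _ ((attach_mem_cycleAt_iff hxtop).2 (by rwa [G.rev_rev]))
  rw [FlowNetwork.value, FlowNetwork.coe_finsum_mem, sum_auxArc (ψ₁ := fun _ => 0)
    (ψ₂ := fun d => F (.old (G.rev d)) - φ (.old (G.rev d))) (ψ₃ := fun _ => 0)]
  · simp only [ite_self, Finset.sum_const_zero, zero_add, add_zero]
    refine Finset.sum_congr rfl fun d _ => ?_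
    by_cases hd : G.src d = x
    · rw [if_pos hd]
      split_ifs with h
      · rfl
      · have h0 : F (.old (G.rev d)) = 0 := by
          by_contra h0
          refine h ⟨hd, fun h' => h0 (restrict_loop hacyclic ?_), pos_iff_ne_zero.2 h0⟩
          rw [G.rev_rev, h', hd]
        have h1 := hle' d hd
        rw [h0, NNReal.coe_zero] at h1
        rw [h0, le_antisymm h1 (hφ.nonneg _)]
        simp
    · rw [if_neg hd, if_neg fun h => hd h.1]
  · intro e
    refine if_neg ?_
    rintro ⟨a, ha⟩
    cases ha
  · intro d
    refine (if_pos ⟨_, rfl⟩).trans ?_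
    exact Real.coe_toNNReal _ (sub_nonneg.2 (hle' d.1 d.2.1))
  · intro d
    refine if_neg ?_
    rintro ⟨a, ha⟩
    cases ha

variable [Finite V]

/-- If at most `c(x)` still enters `x`, the rerouted amount is at least the excess. Otherwise both
sources are reached, and the set reached from `x` is a saturated cut: on an arc leaving it `φ` fills
the capacity and vanishes on the reversal, so the rerouted flow equals the residual capacity. -/
theorem IsOptimal.isMaxUpTo_reroute (hS : G.S.card = 2) (hT : G.T.card = 1)
    (hF : G.extended.IsFeasibleFlow F) (hacyclic : G.toFlowNetwork.IsAcyclicFlow (G.restrict F))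
    (hxtop : G.vcap x ≠ ⊤) (hφ : G.IsOptimal F x φ) :
    (G.aux F x).IsMaxUpTo (G.excess (G.restrict F) x) (G.reroute F x φ) := by
  classical
  refine ⟨hφ.isFeasibleFlow_reroute hxtop, ?_⟩
  rcases le_or_gt (∑ d, if G.src d = x then φ (.old (G.rev d)) else 0) (G.vcap x).toReal
    with hle | hlt
  · left
    rw [excess, tsub_le_iff_right]
    have h1 := hφ.coe_value_reroute hxtop hacyclic
    have h2 : (∑ d, if G.src d = x then (F (.old (G.rev d)) : ℝ) - φ (.old (G.rev d)) else 0) =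
        (∑ d, if G.src d = x then (F (.old (G.rev d)) : ℝ) else 0) -
          ∑ d, if G.src d = x then φ (.old (G.rev d)) else 0 := by
      rw [← Finset.sum_sub_distrib]
      exact Finset.sum_congr rfl fun d _ => by split_ifs <;> simp
    rw [h2, ← coe_inflow_restrict] at h1
    have h3 : G.toFlowNetwork.inflow (G.restrict F) x ≤
        (G.aux F x).value (G.reroute F x φ) + (G.vcap x).toNNReal := by
      rw [← NNReal.coe_le_coe, NNReal.coe_add]
      change _ ≤ _ + (G.vcap x).toReal
      linarith
    calc ((G.toFlowNetwork.inflow (G.restrict F) x : ℝ≥0) : ℝ≥0∞) ≤ _ := ENNReal.coe_le_coe.2 h3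
      _ = _ := by rw [ENNReal.coe_add, ENNReal.coe_toNNReal hxtop]
  · right
    have hsource : ∀ v : {v // v ∈ G.S},
        ExtVertex.plain ⟨v.1, G.vcap_terminal _ (Or.inl v.2)⟩ ∈ G.residualReach x φ :=
      fun v => hφ.source_mem_residualReach hS hT hxtop hF hacyclic hlt v.2
    have hTeq : ∀ v w : {v // v ∈ G.T}, v = w := fun v w =>
      Subtype.ext (Finset.card_le_one.1 hT.le _ v.2 _ w.2)
    have hstep : ∀ e, G.IsFree x e → G.extTail e ∉ G.cycleAt x → G.extHead e ∉ G.cycleAt x →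
        G.extTail e ∈ G.residualReach x φ → G.extHead e ∉ G.residualReach x φ →
          G.extCap e ≤ ENNReal.ofReal (φ e) ∧ φ (G.extRev e) = 0 := by
      rintro e he h1 h2 ⟨e₀, k1, k2, k3, k4, k5⟩ h4
      have h5 : ¬ (ENNReal.ofReal (φ e) < G.extCap e ∨ 0 < φ (G.extRev e)) := fun h5 =>
        h4 ⟨e₀, k1, k2, k3, k4, k5.tail ⟨e, he, rfl, rfl, h1, h2, h5⟩⟩
      rw [not_or, not_lt, not_lt] at h5
      exact ⟨h5.1, le_antisymm h5.2 (hφ.nonneg _)⟩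
    have hFcap : ∀ e, ENNReal.ofReal (F e) ≤ G.extCap e := fun e => by
      rw [ENNReal.ofReal_coe_nnreal]
      exact hF.2 e
    have hFφ : ∀ e, G.extCap e ≤ ENNReal.ofReal (φ e) → (F e : ℝ) ≤ φ e := fun e he =>
      (ENNReal.ofReal_le_ofReal_iff (hφ.nonneg e)).1 ((hFcap e).trans he)
    refine ⟨G.reachCut F x φ, ?_, ?_, fun a h1 h2 => ?_, fun a h1 h2 => ?_⟩
    · rintro _ ⟨a, rfl⟩
      trivial
    · rintro _ hv ⟨a, rfl⟩
      exact hv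
    · rcases a with ⟨e, he, he'⟩ | d | d
      · by_cases hfree : G.IsFree x e
        · have hr := G.isFree_extRev.2 hfree
          have h3 := (ext_mem_reachCut_iff (p := ⟨_, he⟩) hfree.extTail_ne.1
            hfree.extTail_ne.2).1 h1
          have h4 := mt (ext_mem_reachCut_iff (p := ⟨_, he'⟩) hr.extTail_ne.1 hr.extTail_ne.2).2 h2
          obtain ⟨h5, h6⟩ := hstep e hfree he he' h3 h4
          change G.extCap e - F e + F (G.extRev e) ≤
            ENNReal.ofReal (φ e - F e - (φ (G.extRev e) - F (G.extRev e)))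
          rw [h6, zero_sub, sub_neg_eq_add, ENNReal.ofReal_add (sub_nonneg.2 (hFφ e h5))
            (NNReal.coe_nonneg _), ENNReal.ofReal_sub _ (NNReal.coe_nonneg _),
            ENNReal.ofReal_coe_nnreal, ENNReal.ofReal_coe_nnreal]
          gcongr
        · exfalso
          apply h2
          rcases e with d | ⟨d, b⟩ | ⟨v, (_ | _)⟩ | ⟨v, (_ | _)⟩
          · exact absurd trivial hfree
          · exact absurd (fun h => he (G.extTail_cyc_mem_cycleAt_iff.2 h)) hfree
          · exact Or.inr (Or.inl rfl)
          · exact Or.inl (hsource v)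
          · rcases h1 with h1 | h1 | ⟨-, w, hw⟩
            · exact absurd rfl (ne_of_mem_residualReach h1).2
            · cases h1
            · rw [hTeq w v] at hw
              exact Or.inl hw
          · refine Or.inr (Or.inr ⟨rfl, v, ?_⟩)
            rcases h1 with h1 | h1 | ⟨h1, -⟩
            · exact h1
            · cases h1
            · cases h1
      -- If some flow were left on this arc into `x`, its tail would be reached at once; so the
      -- whole flow has been cancelled.
      · have h3 := mt (ext_mem_reachCut_iff (p := ⟨_, G.attach_notMem_cycleAt d.2.2.1⟩)
          (attach_ne _).1 (attach_ne _).2).2 h2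
        have h4 : φ (.old (G.rev d.1)) ≤ 0 := by
          by_contra! h4
          refine h3 ⟨.old (G.rev d.1), trivial, ?_, G.attach_notMem_cycleAt d.2.2.1, h4, .refl⟩
          exact (attach_mem_cycleAt_iff hxtop).2 (by rw [G.rev_rev]; exact d.2.1)
        change ((F (.old (G.rev d.1)) : ℝ≥0) : ℝ≥0∞) ≤
          ENNReal.ofReal (F (.old (G.rev d.1)) - φ (.old (G.rev d.1)))
        rw [le_antisymm h4 (hφ.nonneg _), sub_zero, ENNReal.ofReal_coe_nnreal]
      · have h3 := (ext_mem_reachCut_iff (p := ⟨_, G.attach_notMem_cycleAt d.2.2.1⟩)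
          (attach_ne _).1 (attach_ne _).2).1 h1
        have h4 := hφ.maximal (.old d.1) trivial ((attach_mem_cycleAt_iff hxtop).2 d.2.1) h3
        change ((F (.old d.1) : ℝ≥0) : ℝ≥0∞) ≤ ENNReal.ofReal (F (.old d.1) - φ (.old d.1))
        rw [le_antisymm h4 (hφ.nonneg _), sub_zero, ENNReal.ofReal_coe_nnreal]
    · rcases a with ⟨e, he, he'⟩ | d | d
      · by_cases hfree : G.IsFree x e
        · have hr := G.isFree_extRev.2 hfree
          have h3 := mt (ext_mem_reachCut_iff (p := ⟨_, he⟩) hfree.extTail_ne.1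
            hfree.extTail_ne.2).2 h1
          have h4 := (ext_mem_reachCut_iff (p := ⟨_, he'⟩) hr.extTail_ne.1 hr.extTail_ne.2).1 h2
          obtain ⟨h5, h6⟩ := hstep (G.extRev e) hr he' (by rwa [extHead_extRev]) h4
            (by rwa [extHead_extRev])
          rw [extRev_extRev] at h6
          have h7 := hFφ _ h5
          change (φ e - F e - (φ (G.extRev e) - F (G.extRev e))).toNNReal = 0
          rw [Real.toNNReal_eq_zero, h6]
          linarith [NNReal.coe_nonneg (F e)]
        · exact hφ.reroute_ext_of_not_isFree hfree
      · exact absurd trivial h1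
      · exact h2.elim

end PlaneNetwork

/-! ### Planarity of the auxiliary network -/

theorem IsFirstReturn.exists_pow_eq {D K : Type*} {ι : K → D} (hι : ι.Injective) {σ : Perm D}
    {σK : Perm K} (h : IsFirstReturn ι σ σK) (n : ℕ) {a b : K} (hab : (σ ^ n) (ι a) = ι b) :
    ∃ m, (σK ^ m) a = b ∧ ∀ j ≤ m, ∃ i ≤ n, ι ((σK ^ j) a) = (σ ^ i) (ι a) := by
  induction n using Nat.strong_induction_on generalizing a with
  | _ n ih =>
    rcases Nat.eq_zero_or_pos n with rfl | hn
    · exact ⟨0, hι hab, fun j hj => ⟨0, le_rfl, by simp [Nat.le_zero.1 hj]⟩⟩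
    · obtain ⟨l, hl, hl'⟩ := h a
      rcases Nat.lt_or_ge l n with hln | hln
      · obtain ⟨m, hm, hm'⟩ := ih (n - (l + 1)) (by omega) (a := σK a) (by
          rw [hl, ← Perm.mul_apply, ← pow_add, ← hab]
          congr 2
          omega)
        refine ⟨m + 1, by rw [pow_succ, Perm.mul_apply, hm], fun j hj => ?_⟩
        rcases j with _ | j
        · exact ⟨0, Nat.zero_le _, rfl⟩
        · obtain ⟨i, hi, hi'⟩ := hm' j (by omega)
          refine ⟨i + (l + 1), by omega, ?_⟩
          rw [pow_succ, Perm.mul_apply, hi', hl, ← Perm.mul_apply, ← pow_add]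
      · exact absurd hab.symm (hl' n hn hln b)

/-- Splitting by labels keeps successive darts of equal label successive, so a run of constant label
stays at one vertex. -/
theorem Equiv.Perm.sameCycle_of_forall_apply_eq {D L : Type*} {σ σ' : Perm D} {ℓ : D → L}
    (h : ∀ e, ℓ (σ e) = ℓ e → σ' e = σ e) {a : D} {n : ℕ}
    (ha : ∀ i ≤ n, ℓ ((σ ^ i) a) = ℓ a) : σ'.SameCycle a ((σ ^ n) a) := by
  induction n with
  | zero => exact SameCycle.refl _ _
  | succ n ih =>
    refine (ih fun i hi => ha i (by omega)).trans ?_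
    have h1 : ℓ (σ ((σ ^ n) a)) = ℓ ((σ ^ n) a) := by
      rw [ha n (by omega), ← ha (n + 1) le_rfl, pow_succ', Perm.mul_apply]
    rw [pow_succ', Perm.mul_apply, ← h _ h1]
    exact ⟨1, by rw [zpow_one]⟩

namespace PlaneNetwork

variable {V D : Type*} {G : PlaneNetwork V D} {F : G.ExtArc → ℝ≥0} {x : V}

/-- The vertices of `H` to which the darts outside `C_x` are attached. -/
inductive AuxLabel (F : G.ExtArc → ℝ≥0) (x : V) :
    G.OuterDart x → G.AuxVertex (G.restrict F) x → Prop
  | ext (δ) (h : G.extTail (G.outerArc x δ) ∉ G.cycleAt x) : AuxLabel F x δ (.ext ⟨_, h⟩)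
  | xin (d : G.InDart (G.restrict F) x) : AuxLabel F x (.inl d.1) (.xin (Quot.mk _ d))
  | xout (d : G.OutDart (G.restrict F) x) : AuxLabel F x (.inl d.1) (.xout (Quot.mk _ d))

/-- Flow in both directions of an edge would be a closed walk of length two. Hence no edge at `x`
belongs to both a source and a sink of `H`. -/
theorem outDart_ne_inDart (hacyclic : G.toFlowNetwork.IsAcyclicFlow (G.restrict F))
    (a : G.InDart (G.restrict F) x) (b : G.OutDart (G.restrict F) x) : a.1 ≠ b.1 := fun h => by
  have h1 := a.2.2.2
  rw [h] at h1
  refine hacyclic (G.src b.1) (.tail (.single ⟨b.1, rfl, rfl, b.2.2.2⟩) ⟨G.rev b.1, rfl, ?_, h1⟩)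
  exact congrArg G.src (G.rev_rev b.1)

theorem AuxLabel.ext_iff {δ : G.OuterDart x} {p : {p // p ∉ G.cycleAt x}} :
    AuxLabel F x δ (.ext p) ↔ G.outerSrc x δ = some p.1 := by
  rw [outerSrc, contract_eq_some]
  constructor
  · intro h
    cases h with
    | ext _ h => exact ⟨h, rfl⟩
  · rintro ⟨h1, h2⟩
    obtain rfl : p = ⟨_, h1⟩ := Subtype.ext h2.symm
    exact .ext δ h1

theorem AuxLabel.unique (hxtop : G.vcap x ≠ ⊤)
    (hacyclic : G.toFlowNetwork.IsAcyclicFlow (G.restrict F)) {δ : G.OuterDart x}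
    {u w : G.AuxVertex (G.restrict F) x} (hu : AuxLabel F x δ u) (hw : AuxLabel F x δ w) :
    u = w := by
  have hmem : ∀ d, G.src d = x → G.extTail (G.outerArc x (.inl d)) ∈ G.cycleAt x := fun d hd =>
    (attach_mem_cycleAt_iff hxtop).2 hd
  generalize hε : δ = ε at hw
  cases hu with
  | ext _ h =>
    cases hw with
    | ext => subst hε; rfl
    | xin d => subst hε; exact absurd (hmem _ d.2.1) h
    | xout d => subst hε; exact absurd (hmem _ d.2.1) h
  | xin d =>
    cases hw with
    | ext _ h => subst hε; exact absurd (hmem _ d.2.1) h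
    | xin d' => rw [Subtype.ext (Sum.inl_injective hε)]
    | xout d' => exact absurd (Sum.inl_injective hε) (outDart_ne_inDart hacyclic d d')
  | xout d =>
    cases hw with
    | ext _ h => subst hε; exact absurd (hmem _ d.2.1) h
    | xin d' => exact absurd (Sum.inl_injective hε).symm (outDart_ne_inDart hacyclic d' d)
    | xout d' => rw [Subtype.ext (Sum.inl_injective hε)]

theorem outerRot_pow_inl [Finite D] {d : D} (hd : G.src d = x) (n : ℕ) :
    (G.outerRot x ^ n) (.inl d) = .inl ((G.rot ^ n) d) ∧ G.src ((G.rot ^ n) d) = x := by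
  induction n with
  | zero => exact ⟨rfl, hd⟩
  | succ n ih =>
    have h1 : ¬ G.Inflated x ((G.rot ^ n) d) := fun h => h.2 ih.2
    rw [pow_succ', Perm.mul_apply, ih.1, outerRot, inflateRot_inl_of_notMem h1, pow_succ',
      Perm.mul_apply, G.src_rot]
    exact ⟨rfl, ih.2⟩

/-- The darts of a plane drawing of `H` without its arcs at `s` and `t`. -/
def AuxDart (F : G.ExtArc → ℝ≥0) (x : V) : Type _ :=
  {δ : G.OuterDart x // (∃ u, AuxLabel F x δ u) ∧ ∃ u, AuxLabel F x (G.outerRev x δ) u}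

/-- The edge involution on the darts of `H`. -/
def auxRev (F : G.ExtArc → ℝ≥0) (x : V) : Perm (AuxDart F x) :=
  (G.outerRev x).subtypePerm fun δ => by
    rw [outerRev_outerRev]
    exact and_comm

/-- The dart of `H` given by an edge that carries flow into `x`. -/
def InDart.auxDart (d : G.InDart (G.restrict F) x) : AuxDart F x :=
  ⟨.inl d.1, ⟨_, .xin d⟩, ⟨_, .ext _ (G.attach_notMem_cycleAt d.2.2.1)⟩⟩

/-- The dart of `H` given by an edge that carries flow out of `x`. -/
def OutDart.auxDart (d : G.OutDart (G.restrict F) x) : AuxDart F x :=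
  ⟨.inl d.1, ⟨_, .xout d⟩, ⟨_, .ext _ (G.attach_notMem_cycleAt d.2.2.1)⟩⟩

/-- Edges without a label at one of their ends are deleted, and `x` is split by labels. Conversely,
darts with one label stay at one vertex: outside `C_x` the label is the old vertex, and at `x` the
darts of one terminal are linked by runs in which all other darts are deleted. -/
theorem exists_auxRot [Finite D] (hxtop : G.vcap x ≠ ⊤)
    (hacyclic : G.toFlowNetwork.IsAcyclicFlow (G.restrict F)) :
    ∃ (rot : Perm (AuxDart F x)) (ℓ : AuxDart F x → G.AuxVertex (G.restrict F) x),
      IsPlaneRotation rot (auxRev F x) ∧ (∀ k, AuxLabel F x k.1 (ℓ k)) ∧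
        ∀ a b, ℓ a = ℓ b ↔ rot.SameCycle a b := by
  have hι : (Subtype.val : AuxDart F x → G.OuterDart x).Injective := Subtype.val_injective
  have : Finite (AuxDart F x) := Finite.of_injective _ hι
  obtain ⟨rotK, hplane, hret⟩ := (isPlaneRotation_outer (G := G) x).exists_restrict
    (outerRev_outerRev x) (outerRev_ne x) hι (revK := auxRev F x) fun k => rfl
  choose ℓ hℓ using fun k : AuxDart F x => k.2.1
  obtain ⟨rot, hrot, hℓrot, hrotK⟩ := hplane.exists_split
    (fun k => Subtype.ext (outerRev_outerRev x k.1))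
    (fun k h => outerRev_ne x k.1 (congrArg Subtype.val h)) ℓ
  refine ⟨rot, ℓ, hrot, hℓ, fun a b => ⟨fun hab => ?_, SameCycle.apply_eq hℓrot⟩⟩
  have hrun : ∀ (a b : AuxDart F x) (d : D) (n : ℕ), G.src d = x → a.1 = .inl d →
      b.1 = .inl ((G.rot ^ n) d) →
      (∀ i ≤ n, ∀ u, AuxLabel F x (.inl ((G.rot ^ i) d)) u → u = ℓ a) → rot.SameCycle a b := by
    intro a b d n hd ha hb hlab
    obtain ⟨m, rfl, hm⟩ := hret.exists_pow_eq hι n (a := a) (b := b) (by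
      rw [ha, hb, (outerRot_pow_inl hd n).1])
    refine sameCycle_of_forall_apply_eq hrotK fun j hj => ?_
    obtain ⟨i, hi, hi'⟩ := hm j hj
    rw [ha, (outerRot_pow_inl hd i).1] at hi'
    refine hlab i hi _ ?_
    rw [← hi']
    exact hℓ _
  have hlab : ∀ {k : AuxDart F x} {u}, AuxLabel F x k.1 u → ℓ k = u := fun h =>
    AuxLabel.unique hxtop hacyclic (hℓ _) h
  -- Equality of terminals is only generated by the interval relation, so a chain of runs has to be
  -- followed through darts that are still present.
  have hgen : ∀ {ι : Type _} (v : ι → D) (r : ι → ι → Prop),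
      (∀ c, ∃ k : AuxDart F x, k.1 = .inl (v c)) →
      (∀ c c', r c c' → ∀ a b : AuxDart F x, a.1 = .inl (v c) → b.1 = .inl (v c') →
        rot.SameCycle a b) →
      ∀ c c', Relation.EqvGen r c c' → ∀ a b : AuxDart F x, a.1 = .inl (v c) →
        b.1 = .inl (v c') → rot.SameCycle a b := by
    intro ι v r hex hr c c' h
    induction h with
    | rel c c' h => exact hr c c' h
    | refl c => exact fun a b ha hb => hι (ha.trans hb.symm) ▸ SameCycle.refl _ _
    | symm _ _ _ ih => exact fun a b ha hb => (ih b a hb ha).symm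
    | trans _ c _ _ _ ih ih' =>
      intro a b ha hb
      obtain ⟨k, hk⟩ := hex c
      exact (ih a k ha hk).trans (ih' k b hk hb)
  have hmem : ∀ d, G.src d = x → G.extTail (G.outerArc x (.inl d)) ∈ G.cycleAt x := fun d hd =>
    (attach_mem_cycleAt_iff hxtop).2 hd
  have hin := hgen (fun c : G.InDart (G.restrict F) x => c.1) (fun a b =>
      ∃ n : ℕ, (G.rot ^ n) a.1 = b.1 ∧ ∀ i ≤ n, G.restrict F ((G.rot ^ i) a.1) = 0)
      (fun c => ⟨c.auxDart, rfl⟩) (by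
    rintro c c' ⟨n, hn, hn'⟩ a b ha hb
    refine hrun a b c.1 n c.2.1 ha (by rw [hb, hn]) fun i hi u hu => ?_
    rw [hlab (u := .xin (Quot.mk _ c)) (by rw [ha]; exact .xin c)]
    generalize hε : (Sum.inl ((G.rot ^ i) c.1) : G.OuterDart x) = ε at hu
    cases hu with
    | ext _ h => subst hε; exact absurd (hmem _ (outerRot_pow_inl c.2.1 i).2) h
    | xin d =>
      refine congrArg AuxVertex.xin (Quot.sound ⟨i, Sum.inl_injective hε, ?_⟩).symm
      exact fun j hj => hn' j (hj.trans hi)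
    | xout d =>
      have h := d.2.2.2
      rw [← Sum.inl_injective hε, hn' i hi] at h
      exact absurd h (lt_irrefl _))
  have hout := hgen (fun c : G.OutDart (G.restrict F) x => c.1) (fun a b =>
      ∃ n : ℕ, (G.rot ^ n) a.1 = b.1 ∧ ∀ i ≤ n, G.restrict F (G.rev ((G.rot ^ i) a.1)) = 0)
      (fun c => ⟨c.auxDart, rfl⟩) (by
    rintro c c' ⟨n, hn, hn'⟩ a b ha hb
    refine hrun a b c.1 n c.2.1 ha (by rw [hb, hn]) fun i hi u hu => ?_
    rw [hlab (u := .xout (Quot.mk _ c)) (by rw [ha]; exact .xout c)]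
    generalize hε : (Sum.inl ((G.rot ^ i) c.1) : G.OuterDart x) = ε at hu
    cases hu with
    | ext _ h => subst hε; exact absurd (hmem _ (outerRot_pow_inl c.2.1 i).2) h
    | xin d =>
      have h := d.2.2.2
      rw [← Sum.inl_injective hε, hn' i hi] at h
      exact absurd h (lt_irrefl _)
    | xout d =>
      refine congrArg AuxVertex.xout (Quot.sound ⟨i, Sum.inl_injective hε, ?_⟩).symm
      exact fun j hj => hn' j (hj.trans hi))
  have ha := hℓ a
  have hb := hℓ b
  rw [← hab] at hb
  generalize hu : ℓ a = u at ha hb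
  generalize hδ : a.1 = δ at ha
  generalize hε : b.1 = ε at hb
  cases ha with
  | ext _ h =>
    rw [AuxLabel.ext_iff, ← hε] at hb
    have ha : G.outerSrc x a.1 = some (G.extTail (G.outerArc x δ)) := by
      rw [hδ, outerSrc, contract_eq_some]
      exact ⟨h, rfl⟩
    have h1 := (hret.sameCycle_iff hι).2 ((outerSrc_eq_iff hxtop a.1 b.1).1 (ha.trans hb.symm))
    obtain ⟨n, rfl⟩ := h1.exists_nat_pow_eq
    refine sameCycle_of_forall_apply_eq hrotK fun i _ => ?_
    have h2 : rotK.SameCycle a ((rotK ^ i) a) := ⟨i, by rw [zpow_natCast]⟩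
    rw [hu]
    refine hlab (AuxLabel.ext_iff.2 ?_)
    rw [← (outerSrc_eq_iff hxtop _ _).2 ((hret.sameCycle_iff hι).1 h2), ha]
  | xin c =>
    generalize hw : AuxVertex.xin (Quot.mk _ c) = w at hb
    cases hb with
    | ext => cases hw
    | xout => cases hw
    | xin c' =>
      exact hin c c' (Quot.eqvGen_exact (AuxVertex.xin.inj hw)) a b hδ hε
  | xout c =>
    generalize hw : AuxVertex.xout (Quot.mk _ c) = w at hb
    cases hb with
    | ext => cases hw
    | xin => cases hw
    | xout c' =>
      exact hout c c' (Quot.eqvGen_exact (AuxVertex.xout.inj hw)) a b hδ hε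

theorem exists_auxDart_of_ext
    {e : {e : G.ExtArc // G.extended.tail e ∉ G.cycleAt x ∧ G.extended.head e ∉ G.cycleAt x}}
    (he : G.IsFree x e.1) : ∃ k : AuxDart F x, AuxLabel F x k.1 (.ext ⟨_, e.2.1⟩) ∧
      AuxLabel F x (auxRev F x k).1 (.ext ⟨_, e.2.2⟩) := by
  obtain ⟨e, h1, h2⟩ := e
  obtain ⟨δ, rfl⟩ := exists_outerArc_eq he
  have h3 : AuxLabel F x δ (.ext ⟨_, h1⟩) := .ext δ h1
  have h4 : AuxLabel F x (G.outerRev x δ) (.ext ⟨_, h2⟩) := by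
    rw [AuxLabel.ext_iff, outerSrc_outerRev, contract_eq_some]
    exact ⟨h2, rfl⟩
  exact ⟨⟨δ, ⟨_, h3⟩, ⟨_, h4⟩⟩, h3, h4⟩

/-- The arcs missing from the drawing are those at `s`, which are deleted, and those at `t`, which
form one pendant edge because there is one sink. -/
theorem isPlanar_auxDeleted [Finite D] (hT : G.T.card = 1) (hxtop : G.vcap x ≠ ⊤)
    (hacyclic : G.toFlowNetwork.IsAcyclicFlow (G.restrict F)) :
    (G.auxDeleted F x).underlyingGraph.IsPlanar := by
  have : Finite (AuxDart F x) := Finite.of_injective _ Subtype.val_injective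
  obtain ⟨rot, ℓ, hplane, hℓ, hrot⟩ := exists_auxRot hxtop hacyclic
  have hlab : ∀ {k : AuxDart F x} {u}, AuxLabel F x k.1 u → ℓ k = u := fun h =>
    AuxLabel.unique hxtop hacyclic (hℓ _) h
  obtain ⟨t₁, ht₁⟩ := Finset.card_eq_one.1 hT
  have ht₁' : t₁ ∈ G.T := by rw [ht₁, Finset.mem_singleton]
  let w : G.AuxVertex (G.restrict F) x :=
    .ext ⟨.plain ⟨t₁, G.vcap_terminal t₁ (Or.inr ht₁')⟩, G.plain_notMem_cycleAt _⟩
  let t : G.AuxVertex (G.restrict F) x := .ext ⟨.t, G.t_notMem_cycleAt⟩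
  have htw : t ≠ w := by
    simp [t, w]
  have ht : ∀ k, ℓ k ≠ t := fun k hk => by
    have h := hℓ k
    rw [hk, AuxLabel.ext_iff, outerSrc, contract_eq_some] at h
    exact (isFree_outerArc x k.1).extTail_ne.2 h.2
  obtain ⟨rot', hplane', hrot'⟩ := hplane.exists_pendant hrot htw ht
  have hrevrev : ∀ k, auxRev F x (auxRev F x k) = k := fun k =>
    Subtype.ext (outerRev_outerRev x k.1)
  have hrev : ∀ d, (Equiv.sumCongr (auxRev F x) Equiv.boolNot)
      ((Equiv.sumCongr (auxRev F x) Equiv.boolNot) d) = d := by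
    rintro (k | b)
    · exact congrArg Sum.inl (hrevrev k)
    · exact congrArg Sum.inr (Bool.not_not b)
  refine SimpleGraph.isPlanar_of_isPlaneRotation hplane' hrev ?_ hrot' _ ?_
  · rintro (k | b) h
    · exact outerRev_ne x k.1 (congrArg Subtype.val (Sum.inl_injective h))
    · exact Bool.not_ne_self b (Sum.inr_injective h)
  · suffices ∀ e : {e // e ∉ G.supersourceArcs F x}, ∃ d,
        Sum.elim ℓ (fun c => if c then w else t) d = (G.auxDeleted F x).tail e ∧
        Sum.elim ℓ (fun c => if c then w else t)
          ((Equiv.sumCongr (auxRev F x) Equiv.boolNot) d) = (G.auxDeleted F x).head e by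
      intro u v huv
      rw [FlowNetwork.underlyingGraph, SimpleGraph.fromRel_adj] at huv
      rcases huv with ⟨-, ⟨e, rfl, rfl⟩ | ⟨e, rfl, rfl⟩⟩
      · exact this e
      · obtain ⟨d, h1, h2⟩ := this e
        exact ⟨_, h2, by rw [hrev, h1]⟩
    rintro ⟨e | d | d, he⟩
    · by_cases hfree : G.IsFree x e.1
      · obtain ⟨k, h1, h2⟩ := exists_auxDart_of_ext (F := F) hfree
        exact ⟨.inl k, hlab h1, hlab h2⟩
      · obtain ⟨e, h1, h2⟩ := e
        rcases e with d | ⟨d, b⟩ | ⟨v, (_ | _)⟩ | ⟨v, b⟩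
        · exact absurd trivial hfree
        · exact absurd (fun h => h1 (G.extTail_cyc_mem_cycleAt_iff.2 h)) hfree
        · exact absurd (Or.inr rfl) he
        · exact absurd (Or.inl rfl) he
        · obtain rfl : v = ⟨t₁, ht₁'⟩ := Subtype.ext (Finset.mem_singleton.1 (ht₁ ▸ v.2))
          exact ⟨.inr b, by cases b <;> rfl, by cases b <;> rfl⟩
    · exact ⟨.inl d.auxDart, hlab (.xin d), hlab (.ext _ (G.attach_notMem_cycleAt d.2.2.1))⟩
    · refine ⟨.inl (auxRev F x d.auxDart), hlab (.ext _ (G.attach_notMem_cycleAt d.2.2.1)), ?_⟩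
      change ℓ (auxRev F x (auxRev F x d.auxDart)) = _
      rw [hrevrev]
      exact hlab (.xout d)

end PlaneNetwork

theorem mainTheorem8 {V D : Type*} [Finite V] [Finite D] (G : PlaneNetwork V D)
    (hS : G.S.card = 2) (hT : G.T.card = 1)
    (F : G.ExtArc → ℝ≥0) (hF : G.extended.IsMaxFlow F)
    (hacyclic : G.toFlowNetwork.IsAcyclicFlow (G.restrict F))
    (x : V) (hx : 0 < G.excess (G.restrict F) x) :
    ((∃ p, (G.aux F x).IsAugmentingPath p ∧ (G.aux F x).PathContains p (G.auxS _ x)) →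
      ∃ p, (G.aux F x).IsAugmentingPath p ∧ ¬ (G.aux F x).PathContains p (G.auxS _ x)) ∧
    ((∃ p, (G.aux F x).IsAugmentingPath p) ↔ ∃ p, (G.auxDeleted F x).IsAugmentingPath p) ∧
    (∀ r : ℝ≥0, (r : ℝ≥0∞) ≤ G.excess (G.restrict F) x →
      ((∃ g, (G.aux F x).IsFeasibleFlow g ∧ (G.aux F x).value g = r) ↔
        ∃ g, (G.auxDeleted F x).IsFeasibleFlow g ∧ (G.auxDeleted F x).value g = r)) ∧
    (G.auxDeleted F x).underlyingGraph.IsPlanar := by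
  have := Fintype.ofFinite D
  have := Fintype.ofFinite G.ExtArc
  have := Fintype.ofFinite (G.AuxArc (G.restrict F) x)
  have hxtop : G.vcap x ≠ ⊤ := fun h => by
    rw [PlaneNetwork.excess, h, ENNReal.sub_top] at hx
    exact lt_irrefl _ hx
  obtain ⟨φ, hφ⟩ := PlaneNetwork.exists_isOptimal hF.1 x
  have hmax := hφ.isMaxUpTo_reroute hS hT hF.1 hacyclic hxtop
  have hsource := PlaneNetwork.aux_head_notMem_source (F := F) (x := x)
  have hzero : ∀ e ∈ G.supersourceArcs F x, G.reroute F x φ e = 0 := fun e he =>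
    hφ.reroute_eq_zero_of_mem_supersourceArcs he
  have hpath : (∃ p, (G.aux F x).IsAugmentingPath p) →
      ∃ p, (G.auxDeleted F x).IsAugmentingPath p :=
    hmax.exists_isAugmentingPath_deleteArcs hx hsource PlaneNetwork.aux_disjoint hzero
  refine ⟨fun ⟨p, hp, _⟩ => ?_, ⟨hpath, fun ⟨p, hp⟩ => ⟨_, hp.map_val⟩⟩,
    fun r hr => hmax.exists_flow_deleteArcs_iff hsource hzero hr,
    PlaneNetwork.isPlanar_auxDeleted hT hxtop hacyclic⟩
  obtain ⟨q, hq⟩ := hpath ⟨p, hp⟩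
  refine ⟨_, hq.map_val, ?_⟩
  rintro ⟨e, he, h⟩
  obtain ⟨e', -, rfl⟩ := List.mem_map.1 he
  exact e'.2 h
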